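/- For $d,k,\Delta\in\mathbb N$ with $d\ge 1$ let $\mathbb M_{k,\Delta}$ be the family of all sets $\Omega\subseteq[d]$ with $|\Omega|=k$ in which any two distinct indices $i,j$ satisfy $|i-j|\ge\Delta$, and let $\mathcal M_{k,\Delta}=\{x\in\mathbb R^d : \mathrm{supp}(x)\subseteq\Omega \text{ for some } \Omega\in\mathbb M_{k,\Delta}\}$. A matrix $X\in\mathbb R^{n\times d}$ satisfies the model-RIP (of order $3$) for $\mathbb M_{k,\Delta}$ with constant $\delta$ if $$(1-\delta)\|x\|_2^2\le\|Xx\|_2^2\le(1+\delta)\|x\|_2^2$$ for every $x$ that is a sum of three vectors of $\mathcal M_{k,\Delta}$. Algorithms are programs for a real RAM: registers and arrays of natural numbers (counters and addresses, with addition and truncated subtraction) and of reals (with $+,-,\times,/$ and exact comparison, no rounding), each elementary instruction or test costing one step. The matrix $X$ can be accessed only through two instructions, which multiply $X$, respectively $X^T$, by a vector and cost $T_X$ steps each, where $T_X\ge n$ (the product with $X$ has $n$ coordinates that have to be written). Theorem. For every $\delta<1/2$ there are a constant $C$, natural numbers $K,p$ and one program, all depending only on $\delta$, such that the following holds for all $n,k,\Delta,\gamma\in\mathbb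 N$, $d\ge1$, $T_X\ge n$, every $X\in\mathbb R^{n\times d}$ that satisfies the model-RIP for $\mathbb M_{k,\Delta}$ with constant $\delta$, every $\theta^*\in\mathbb R^d$ with $\mathrm{supp}(\theta^*)\in\mathbb M_{k,\Delta}$, and every $e\in\mathbb R^n$. Let $y=X\theta^*+e$, and let the precision parameter $\gamma$ be such that $\|\theta^*\|_2\le 2^\gamma\|e\|_2$, or such that all coordinates of $\theta^*$ are fixed-point numbers with $\gamma$ bits before and after the binary point (that is, $|\theta^*_i|\le2^\gamma$ and $2^\gamma\theta^*_i\in\mathbb Z$ for all $i$). Then, on the input $n,d,k,\Delta,\gamma$ and $y$, the program halts with an output $\hat\theta\in\mathbb R^d$ such that $$\|\hat\theta-\theta^*\|_2\le C\,\|e\|_2,$$ after at most $K\,(T_X+d)\,(\lfloor\log_2 d\rfloor+\gamma+1)^p$ steps. That is, the running time is $\widetilde O(T_X+d)$, where $\widetilde O$ hides powers of $\log d$ and of the precision $\gamma$. -/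

import Mathlib

namespace SepSparse

noncomputable section

/-! ### Separated sparsity and the model-RIP -/

/-- The support of a vector, as a finite set of indices. -/
def supp {d : ℕ} (x : EuclideanSpace ℝ (Fin d)) : Finset (Fin d) :=
  Finset.univ.filter fun i => x i ≠ 0

/-- The family of `Δ`-separated supports of size `k`: index sets `Ω` with `|Ω| = k` in which any two
distinct indices are at distance at least `Δ`. -/
def separatedSupports (d k Δ : ℕ) : Set (Finset (Fin d)) :=
  {Ω | (∀ i ∈ Ω, ∀ j ∈ Ω, i ≠ j → (Δ : ℤ) ≤ |((i : ℕ) : ℤ) - ((j : ℕ) : ℤ)|) ∧ Ω.card = k}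

/-- The union of coordinate subspaces that belongs to a family of supports. -/
def modelVectors {d : ℕ} (M : Set (Finset (Fin d))) : Set (EuclideanSpace ℝ (Fin d)) :=
  {x | ∃ Ω ∈ M, supp x ⊆ Ω}

/-- The `B`-fold Minkowski sum of the model: all sums of `B` vectors of the model. -/
def modelSums {d : ℕ} (M : Set (Finset (Fin d))) (B : ℕ) : Set (EuclideanSpace ℝ (Fin d)) :=
  {x | ∃ f : Fin B → EuclideanSpace ℝ (Fin d), (∀ b, f b ∈ modelVectors M) ∧ x = ∑ b, f b}

/-- The product of a matrix with a vector, in Euclidean spaces. -/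
def mulVecE {n d : ℕ} (X : Matrix (Fin n) (Fin d) ℝ) (x : EuclideanSpace ℝ (Fin d)) :
    EuclideanSpace ℝ (Fin n) :=
  WithLp.toLp 2 (X.mulVec x.ofLp)

/-- `X` has the model-RIP of order `B` with constant `δ` for the family of supports `M`. -/
def ModelRIP {n d : ℕ} (M : Set (Finset (Fin d))) (B : ℕ) (δ : ℝ)
    (X : Matrix (Fin n) (Fin d) ℝ) : Prop :=
  ∀ x ∈ modelSums M B,
    (1 - δ) * ‖x‖ ^ 2 ≤ ‖mulVecE X x‖ ^ 2 ∧ ‖mulVecE X x‖ ^ 2 ≤ (1 + δ) * ‖x‖ ^ 2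

/-- `x` is a fixed-point number with `γ` bits before and `γ` bits after the binary point. -/
def IsFixedPoint (γ : ℕ) (x : ℝ) : Prop :=
  |x| ≤ 2 ^ γ ∧ ∃ m : ℤ, 2 ^ γ * x = m

/-! ### A real RAM with a step count

The machine has registers and arrays for natural numbers (used as counters and addresses, with
addition and truncated subtraction only) and registers and arrays for real numbers (with the four
arithmetic operations and exact comparisons, but no rounding and no conversion of a real into a
natural number). A program is a finite piece of code; it can access the matrix `X` only through the
two instructions that multiply `X` or its transpose by a vector. -/

/-- The memory of the machine. -/
structure State where
  nat : ℕ → ℕ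
  real : ℕ → ℝ
  natArr : ℕ → ℕ → ℕ
  realArr : ℕ → ℕ → ℝ

/-- The arithmetic operations on reals. -/
inductive ArithOp where
  | add | sub | mul | div

/-- The value of an arithmetic operation (division by zero yields zero). -/
def ArithOp.eval : ArithOp → ℝ → ℝ → ℝ
  | .add, a, b => a + b
  | .sub, a, b => a - b
  | .mul, a, b => a * b
  | .div, a, b => a / b

/-- Basic instructions; the first argument is the register or array that is written. -/
inductive Instr where
  /-- `nat[i] := c` -/
  | setNat (i c : ℕ)
  /-- `nat[i] := nat[j] + nat[l]` -/
  | addNat (i j l : ℕ)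
  /-- `nat[i] := nat[j] - nat[l]`, or `0` if this is negative -/
  | subNat (i j l : ℕ)
  /-- `nat[i] := natArr[a][nat[j]]` -/
  | loadNat (i a j : ℕ)
  /-- `natArr[a][nat[j]] := nat[i]` -/
  | storeNat (a j i : ℕ)
  /-- `real[i] := q` -/
  | setReal (i : ℕ) (q : ℚ)
  /-- `real[i] := nat[j]` -/
  | castReal (i j : ℕ)
  /-- `real[i] := real[j] op real[l]` -/
  | arith (op : ArithOp) (i j l : ℕ)
  /-- `real[i] := realArr[a][nat[j]]` -/
  | loadReal (i a j : ℕ)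
  /-- `realArr[a][nat[j]] := real[i]` -/
  | storeReal (a j i : ℕ)
  /-- `realArr[a] := X * realArr[b]` -/
  | mulX (a b : ℕ)
  /-- `realArr[a] := Xᵀ * realArr[b]` -/
  | mulXT (a b : ℕ)

/-- Write the value `v` into cell `j` of array number `a`. -/
def writeCell {α : Type} (f : ℕ → ℕ → α) (a j : ℕ) (v : α) : ℕ → ℕ → α :=
  Function.update f a (Function.update (f a) j v)

/-- Write the vector `v` into the first `m` cells of the real array `f`. -/
def writeVec {m : ℕ} (f : ℕ → ℝ) (v : Fin m → ℝ) : ℕ → ℝ :=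
  fun j => if h : j < m then v ⟨j, h⟩ else f j

/-- The vector in the first `m` cells of the real array `f`. -/
def readVec (m : ℕ) (f : ℕ → ℝ) : Fin m → ℝ := fun i => f i

/-- The effect of a basic instruction. -/
def Instr.run {n d : ℕ} (X : Matrix (Fin n) (Fin d) ℝ) : Instr → State → State
  | .setNat i c, s => { s with nat := Function.update s.nat i c }
  | .addNat i j l, s => { s with nat := Function.update s.nat i (s.nat j + s.nat l) }
  | .subNat i j l, s => { s with nat := Function.update s.nat i (s.nat j - s.nat l) }
  | .loadNat i a j, s => { s with nat := Function.update s.nat i (s.natArr a (s.nat j)) }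
  | .storeNat a j i, s =>
      { s with natArr := writeCell s.natArr a (s.nat j) (s.nat i) }
  | .setReal i q, s => { s with real := Function.update s.real i (q : ℝ) }
  | .castReal i j, s => { s with real := Function.update s.real i (s.nat j : ℝ) }
  | .arith op i j l, s =>
      { s with real := Function.update s.real i (op.eval (s.real j) (s.real l)) }
  | .loadReal i a j, s => { s with real := Function.update s.real i (s.realArr a (s.nat j)) }
  | .storeReal a j i, s =>
      { s with realArr := writeCell s.realArr a (s.nat j) (s.real i) }
  | .mulX a b, s =>
      let v := writeVec (s.realArr a) (X.mulVec (readVec d (s.realArr b)))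
      { s with realArr := Function.update s.realArr a v }
  | .mulXT a b, s =>
      let v := writeVec (s.realArr a) (X.transpose.mulVec (readVec n (s.realArr b)))
      { s with realArr := Function.update s.realArr a v }

/-- The cost of a basic instruction: `T` for a multiplication by `X` or by its transpose, and one
step for every other instruction. -/
def Instr.cost (T : ℕ) : Instr → ℕ
  | .mulX _ _ => T
  | .mulXT _ _ => T
  | _ => 1

/-- Comparisons of two registers. -/
inductive Test where
  | ltNat (i j : ℕ)
  | leNat (i j : ℕ)
  | ltReal (i j : ℕ)
  | leReal (i j : ℕ)

/-- The truth value of a comparison. -/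
def Test.holds : Test → State → Prop
  | .ltNat i j, s => s.nat i < s.nat j
  | .leNat i j, s => s.nat i ≤ s.nat j
  | .ltReal i j, s => s.real i < s.real j
  | .leReal i j, s => s.real i ≤ s.real j

/-- Structured programs. -/
inductive Prog where
  | skip
  | basic (c : Instr)
  | seq (p q : Prog)
  | ite (b : Test) (p q : Prog)
  | loop (b : Test) (p : Prog)

/-- `Exec X T p s s' t`: on the matrix `X`, with multiplications charged `T` steps, the program `p`
started in the state `s` halts in the state `s'` after exactly `t` steps. Every evaluation of a
test costs one step; `loop b p` repeats `p` while `b` holds. -/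
inductive Exec {n d : ℕ} (X : Matrix (Fin n) (Fin d) ℝ) (T : ℕ) :
    Prog → State → State → ℕ → Prop where
  | skip (s : State) : Exec X T .skip s s 0
  | basic (c : Instr) (s : State) : Exec X T (.basic c) s (c.run X s) (c.cost T)
  | seq (p q : Prog) (s s₁ s₂ : State) (t₁ t₂ : ℕ) :
      Exec X T p s s₁ t₁ → Exec X T q s₁ s₂ t₂ → Exec X T (.seq p q) s s₂ (t₁ + t₂)
  | iteTrue (b : Test) (p q : Prog) (s s₁ : State) (t : ℕ) :
      b.holds s → Exec X T p s s₁ t → Exec X T (.ite b p q) s s₁ (t + 1)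
  | iteFalse (b : Test) (p q : Prog) (s s₁ : State) (t : ℕ) :
      ¬ b.holds s → Exec X T q s s₁ t → Exec X T (.ite b p q) s s₁ (t + 1)
  | loopTrue (b : Test) (p : Prog) (s s₁ s₂ : State) (t₁ t₂ : ℕ) :
      b.holds s → Exec X T p s s₁ t₁ → Exec X T (.loop b p) s₁ s₂ t₂ →
      Exec X T (.loop b p) s s₂ (t₁ + t₂ + 1)
  | loopFalse (b : Test) (p : Prog) (s : State) :
      ¬ b.holds s → Exec X T (.loop b p) s s 1

/-- The initial state: the numbers `n, d, k, Δ, γ` are in the natural number registers `0, …, 4`,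
the observations `y` are in the first `n` cells of the real array `0`, everything else is zero. -/
def initState {n : ℕ} (d k Δ γ : ℕ) (y : EuclideanSpace ℝ (Fin n)) : State where
  nat := fun i =>
    match i with
    | 0 => n
    | 1 => d
    | 2 => k
    | 3 => Δ
    | 4 => γ
    | _ => 0
  real := fun _ => 0
  natArr := fun _ _ => 0
  realArr := fun a => if a = 0 then writeVec (fun _ => 0) y.ofLp else fun _ => 0

/-- The output: the vector in the first `d` cells of the real array `1`. -/
def output (d : ℕ) (s : State) : EuclideanSpace ℝ (Fin d) :=
  WithLp.toLp 2 (readVec d (s.realArr 1))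

end

end SepSparse

/-! The algorithm is projected gradient descent, `x ↦ P (x + Xᵀ (y - X x))`, with a nearly optimal
projection `P` onto the model. If `x'` is at least as close to the gradient point as `θ`, up to `η ^
2` in squared distance, then expanding squares bounds `‖x' - θ‖ ^ 2` by `2 (⟪u, v⟫ - ⟪X u, X v⟫) + 2
⟪X u, e⟫ + η ^ 2` with `u = x' - θ`, `v = x - θ`. Both differences lie in the span of the three
model vectors `x, x', θ`, so the RIP of order 3 gives contraction by `2 δ < 1` up to `4 ‖e‖ + η`
(`ModelRIP.step`).

The exact projection selects a separated set of size `k` of maximal weight, which is too expensive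
to tabulate in `k` and `d` together. The cardinality constraint is therefore replaced by a price per
index. For a fixed price a dynamic program over positions is solved in `O(d)` steps
(`IsValueFunction.gain_le`, `Traced.optimalSeq`), and bisection produces two prices `lo < hi` whose
optimal sequences have lengths `b ≥ k ≥ a`. An initial piece of the shorter one and a final piece of
the longer one are spliced into a separated sequence of length exactly `k`. The discarded pieces
also form a separated sequence, and comparing it with the optimum for `hi` shows that the splice
loses at most `(hi - lo) (b - k)` (`sum_le_sum_splice`). The loss is exponentially small in the
number of bisections.

With `ℓ ≈ log d + γ`, `O(ℓ)` gradient steps of `O(ℓ)` bisections each leave an error `‖θ‖ / 2 ^ (6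
ℓ) + C ‖e‖` (`exists_rates`). If `‖θ‖ ≤ 2 ^ γ ‖e‖`, this is `O(‖e‖)`. If `θ` is fixed-point, then
either the noise is so small that rounding the iterate recovers `θ` exactly, or the first term is
itself `O(‖e‖)`. The program cannot tell these cases apart, so it keeps whichever of the iterate and
its rounding has the smaller residual; by the RIP a small residual means a small error
(`main_error`).

Running times are handled by a language with counting loops only. It has a total denotation, frame
rules read off from syntactic write lists, and a syntactic time bound (`exec_toProg`). Two factors
`ℓ`, one for gradient steps and one for bisections, give the exponent 2. -/

namespace SepSparse

/-! ### Programs with counting loops -/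

/-- Programs whose only loops are counting loops: `rep i b p` runs `p` for the values
`0, 1, …, nat[b] - 1` of the counter `nat[i]`. Register `5` is scratch space of the loops. -/
inductive Code where
  | skip
  | basic (c : Instr)
  | seq (p q : Code)
  | ite (b : Test) (p q : Code)
  | rep (i b : ℕ) (p : Code)

namespace Code

/-- Sequential composition of a list of programs. -/
def block : List Code → Code
  | [] => .skip
  | [p] => p
  | p :: ps => .seq p (block ps)

/-- Sequential composition of a list of instructions. -/
def instrs : List Instr → Code
  | [] => .skip
  | [c] => .basic c
  | c :: cs => .seq (.basic c) (instrs cs)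

/-- The translation into structured programs. -/
def toProg : Code → Prog
  | .skip => .skip
  | .basic c => .basic c
  | .seq p q => .seq p.toProg q.toProg
  | .ite b p q => .ite b p.toProg q.toProg
  | .rep i b p => .seq (.basic (.setNat i 0))
      (.loop (.ltNat i b) (.seq p.toProg (.seq (.basic (.setNat 5 1)) (.basic (.addNat i i 5)))))

/-- The state after `j` passes through the body of a counting loop, whose effect is `f`. -/
def iter (f : State → State) (i : ℕ) (s : State) : ℕ → State
  | 0 => { s with nat := Function.update s.nat i 0 }
  | j + 1 =>
    { f (iter f i s j) with
      nat := Function.update (Function.update (f (iter f i s j)).nat 5 1) i (j + 1) }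

open Classical in
/-- The final state of a program. -/
noncomputable def den {n d : ℕ} (X : Matrix (Fin n) (Fin d) ℝ) : Code → State → State
  | .skip, s => s
  | .basic c, s => c.run X s
  | .seq p q, s => q.den X (p.den X s)
  | .ite b p q, s => if b.holds s then p.den X s else q.den X s
  | .rep i b p, s => iter (p.den X) i s (s.nat b)

/-- The natural number registers that a program may write. -/
def natWrites : Code → List ℕ
  | .skip => []
  | .basic (.setNat i _) => [i]
  | .basic (.addNat i _ _) => [i]
  | .basic (.subNat i _ _) => [i]
  | .basic (.loadNat i _ _) => [i]
  | .basic _ => []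
  | .seq p q => p.natWrites ++ q.natWrites
  | .ite _ p q => p.natWrites ++ q.natWrites
  | .rep i _ p => i :: 5 :: p.natWrites

/-- The real registers that a program may write. -/
def realWrites : Code → List ℕ
  | .skip => []
  | .basic (.setReal i _) => [i]
  | .basic (.castReal i _) => [i]
  | .basic (.arith _ i _ _) => [i]
  | .basic (.loadReal i _ _) => [i]
  | .basic _ => []
  | .seq p q => p.realWrites ++ q.realWrites
  | .ite _ p q => p.realWrites ++ q.realWrites
  | .rep _ _ p => p.realWrites

/-- The arrays of natural numbers that a program may write. -/
def natArrWrites : Code → List ℕ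
  | .skip => []
  | .basic (.storeNat a _ _) => [a]
  | .basic _ => []
  | .seq p q => p.natArrWrites ++ q.natArrWrites
  | .ite _ p q => p.natArrWrites ++ q.natArrWrites
  | .rep _ _ p => p.natArrWrites

/-- The arrays of reals that a program may write. -/
def realArrWrites : Code → List ℕ
  | .skip => []
  | .basic (.storeReal a _ _) => [a]
  | .basic (.mulX a _) => [a]
  | .basic (.mulXT a _) => [a]
  | .basic _ => []
  | .seq p q => p.realArrWrites ++ q.realArrWrites
  | .ite _ p q => p.realArrWrites ++ q.realArrWrites
  | .rep _ _ p => p.realArrWrites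

/-- Between two passes the loop itself changes only its counter and register `5`. An observable that
ignores these two registers (`h0`) and is kept by the body is therefore kept by the loop. -/
theorem iter_frame {α : Type} (g : State → α) (f : State → State) (i : ℕ) (s : State)
    (h0 : ∀ (s : State) (v : ℕ → ℕ), (∀ r, r ≠ i → r ≠ 5 → v r = s.nat r) →
      g { s with nat := v } = g s)
    (h : ∀ s, g (f s) = g s) (j : ℕ) : g (iter f i s j) = g s := by
  induction j with
  | zero =>
    refine h0 _ _ fun r hr _ => ?_
    simp [Function.update_of_ne hr]
  | succ j ih =>
    rw [iter, h0, h, ih]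
    intro r hr hr5
    simp [Function.update_of_ne hr, Function.update_of_ne hr5]

variable {n d : ℕ} (X : Matrix (Fin n) (Fin d) ℝ)

theorem den_seq (p q : Code) (s : State) : (Code.seq p q).den X s = q.den X (p.den X s) := rfl

/-- Frame rule. For a concrete program the side condition is membership in an explicit list, so
later uses discharge it by `decide` or `simp`. -/
theorem den_nat {r : ℕ} : ∀ {p : Code} {s : State}, r ∉ p.natWrites → (p.den X s).nat r = s.nat r
  | .skip, _, _ => rfl
  | .basic c, s, h => by
    cases c <;> simp_all [natWrites, den, Instr.run, Function.update_of_ne]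
  | .seq p q, s, h => by
    simp only [natWrites, List.mem_append, not_or] at h
    rw [den, den_nat h.2, den_nat h.1]
  | .ite b p q, s, h => by
    simp only [natWrites, List.mem_append, not_or] at h
    rw [den]
    split_ifs
    · exact den_nat h.1
    · exact den_nat h.2
  | .rep i b p, s, h => by
    simp only [natWrites, List.mem_cons, not_or] at h
    rw [den]
    exact iter_frame (fun s => s.nat r) _ _ _ (fun s v hv => hv r h.1 h.2.1)
      (fun s => den_nat h.2.2) _

theorem den_real {r : ℕ} :
    ∀ {p : Code} {s : State}, r ∉ p.realWrites → (p.den X s).real r = s.real r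
  | .skip, _, _ => rfl
  | .basic c, s, h => by
    cases c <;> simp_all [realWrites, den, Instr.run, Function.update_of_ne]
  | .seq p q, s, h => by
    simp only [realWrites, List.mem_append, not_or] at h
    rw [den, den_real h.2, den_real h.1]
  | .ite b p q, s, h => by
    simp only [realWrites, List.mem_append, not_or] at h
    rw [den]
    split_ifs
    · exact den_real h.1
    · exact den_real h.2
  | .rep i b p, s, h => by
    rw [den]
    exact iter_frame (fun s => s.real r) _ _ _ (fun _ _ _ => rfl)
      (fun s => den_real (p := p) h) _

theorem den_natArr {r : ℕ} :
    ∀ {p : Code} {s : State}, r ∉ p.natArrWrites → (p.den X s).natArr r = s.natArr r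
  | .skip, _, _ => rfl
  | .basic c, s, h => by
    cases c <;> simp_all [natArrWrites, den, Instr.run, writeCell, Function.update_of_ne]
  | .seq p q, s, h => by
    simp only [natArrWrites, List.mem_append, not_or] at h
    rw [den, den_natArr h.2, den_natArr h.1]
  | .ite b p q, s, h => by
    simp only [natArrWrites, List.mem_append, not_or] at h
    rw [den]
    split_ifs
    · exact den_natArr h.1
    · exact den_natArr h.2
  | .rep i b p, s, h => by
    rw [den]
    exact iter_frame (fun s => s.natArr r) _ _ _ (fun _ _ _ => rfl)
      (fun s => den_natArr (p := p) h) _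

theorem den_realArr {r : ℕ} :
    ∀ {p : Code} {s : State}, r ∉ p.realArrWrites → (p.den X s).realArr r = s.realArr r
  | .skip, _, _ => rfl
  | .basic c, s, h => by
    cases c <;> simp_all [realArrWrites, den, Instr.run, writeCell, Function.update_of_ne]
  | .seq p q, s, h => by
    simp only [realArrWrites, List.mem_append, not_or] at h
    rw [den, den_realArr h.2, den_realArr h.1]
  | .ite b p q, s, h => by
    simp only [realArrWrites, List.mem_append, not_or] at h
    rw [den]
    split_ifs
    · exact den_realArr h.1
    · exact den_realArr h.2
  | .rep i b p, s, h => by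
    rw [den]
    exact iter_frame (fun s => s.realArr r) _ _ _ (fun _ _ _ => rfl)
      (fun s => den_realArr (p := p) h) _

/-- The write list of a loop does not depend on the register that bounds it, so `b` may be given any
value. -/
theorem iter_nat {r i b : ℕ} {p : Code} {s : State} {j : ℕ} (h : r ∉ (Code.rep i b p).natWrites) :
    (iter (p.den X) i s j).nat r = s.nat r := by
  simp only [natWrites, List.mem_cons, not_or] at h
  exact iter_frame (fun s => s.nat r) _ _ _ (fun s v hv => hv r h.1 h.2.1)
    (fun s => den_nat X h.2.2) _

theorem iter_counter (f : State → State) (i : ℕ) (s : State) (j : ℕ) :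
    (iter f i s j).nat i = j := by
  cases j <;> simp [iter]

theorem iter_real {r i : ℕ} {p : Code} {s : State} {j : ℕ} (h : r ∉ p.realWrites) :
    (iter (p.den X) i s j).real r = s.real r :=
  iter_frame (fun s => s.real r) _ _ _ (fun _ _ _ => rfl) (fun _ => den_real X h) _

theorem iter_natArr {r i : ℕ} {p : Code} {s : State} {j : ℕ} (h : r ∉ p.natArrWrites) :
    (iter (p.den X) i s j).natArr r = s.natArr r :=
  iter_frame (fun s => s.natArr r) _ _ _ (fun _ _ _ => rfl) (fun _ => den_natArr X h) _

theorem iter_realArr {r i : ℕ} {p : Code} {s : State} {j : ℕ} (h : r ∉ p.realArrWrites) :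
    (iter (p.den X) i s j).realArr r = s.realArr r :=
  iter_frame (fun s => s.realArr r) _ _ _ (fun _ _ _ => rfl) (fun _ => den_realArr X h) _

/-! ### Running times -/

/-- The registers in `B` are never written, and they bound all loops, whose counters are not
written by their bodies. -/
def Guarded (B : List ℕ) : Code → Prop
  | .skip => True
  | .basic c => ∀ r ∈ B, r ∉ (Code.basic c).natWrites
  | .seq p q => p.Guarded B ∧ q.Guarded B
  | .ite _ p q => p.Guarded B ∧ q.Guarded B
  | .rep i b p => b ∈ B ∧ i ∉ B ∧ 5 ∉ B ∧ i ≠ 5 ∧ i ∉ p.natWrites ∧ p.Guarded B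

instance decidableGuarded (B : List ℕ) : ∀ p : Code, Decidable (p.Guarded B)
  | .skip => inferInstanceAs (Decidable True)
  | .basic c => inferInstanceAs (Decidable (∀ r ∈ B, r ∉ (Code.basic c).natWrites))
  | .seq p q =>
    have := decidableGuarded B p
    have := decidableGuarded B q
    inferInstanceAs (Decidable (p.Guarded B ∧ q.Guarded B))
  | .ite _ p q =>
    have := decidableGuarded B p
    have := decidableGuarded B q
    inferInstanceAs (Decidable (p.Guarded B ∧ q.Guarded B))
  | .rep i b p =>
    have := decidableGuarded B p
    inferInstanceAs (Decidable (b ∈ B ∧ i ∉ B ∧ 5 ∉ B ∧ i ≠ 5 ∧ i ∉ p.natWrites ∧ p.Guarded B))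

/-- A bound for the running time, if the registers that bound the loops have the values `σ`. -/
def timeBound (T : ℕ) (σ : ℕ → ℕ) : Code → ℕ
  | .skip => 0
  | .basic c => c.cost T
  | .seq p q => p.timeBound T σ + q.timeBound T σ
  | .ite _ p q => max (p.timeBound T σ) (q.timeBound T σ) + 1
  | .rep _ b p => σ b * (p.timeBound T σ + 3) + 2

theorem Guarded.notMem_natWrites {B : List ℕ} {r : ℕ} (hr : r ∈ B) :
    ∀ {p : Code}, p.Guarded B → r ∉ p.natWrites
  | .skip, _ => by simp [natWrites]
  | .basic c, h => h r hr
  | .seq p q, h => by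
    simp [natWrites, Guarded.notMem_natWrites hr h.1, Guarded.notMem_natWrites hr h.2]
  | .ite _ p q, h => by
    simp [natWrites, Guarded.notMem_natWrites hr h.1, Guarded.notMem_natWrites hr h.2]
  | .rep i b p, h => by
    obtain ⟨_, h2, h3, _, _, h6⟩ := h
    have := Guarded.notMem_natWrites hr h6
    simp only [natWrites, List.mem_cons, not_or]
    exact ⟨fun h => h2 (h ▸ hr), fun h => h3 (h ▸ hr), this⟩

/-- Induction on the number `m` of remaining passes. Each pass costs the body, one test and two
instructions that advance the counter, hence `c + 3`; the last, failing test costs `1`. -/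
theorem exec_loop {T : ℕ} {p : Code} {i b c : ℕ} {s₀ : State} (hi : i ∉ p.natWrites)
    (hb : b ∉ (Code.rep i b p).natWrites) (hi5 : i ≠ 5)
    (h : ∀ j, j < s₀.nat b → ∃ t ≤ c, Exec X T p.toProg (iter (p.den X) i s₀ j)
      (p.den X (iter (p.den X) i s₀ j)) t) (m : ℕ) :
    ∀ j, j + m = s₀.nat b → ∃ t ≤ m * (c + 3) + 1,
      Exec X T (.loop (.ltNat i b)
        (.seq p.toProg (.seq (.basic (.setNat 5 1)) (.basic (.addNat i i 5)))))
        (iter (p.den X) i s₀ j) (iter (p.den X) i s₀ (s₀.nat b)) t := by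
  have hbv : ∀ j, (iter (p.den X) i s₀ j).nat b = s₀.nat b := fun j => iter_nat X hb
  have hiv := iter_counter (p.den X) i s₀
  induction m with
  | zero =>
    intro j hj
    refine ⟨1, by simp, ?_⟩
    obtain rfl : j = s₀.nat b := by simpa using hj
    refine Exec.loopFalse _ _ _ ?_
    simp [Test.holds, hbv, hiv]
  | succ m ih =>
    intro j hj
    obtain ⟨t₁, ht₁, h₁⟩ := h j (by omega)
    obtain ⟨t₂, ht₂, h₂⟩ := ih (j + 1) (by omega)
    refine ⟨t₁ + (Instr.cost T (.setNat 5 1) + Instr.cost T (.addNat i i 5)) + t₂ + 1,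
      by simp only [Instr.cost]; nlinarith, ?_⟩
    refine Exec.loopTrue _ _ _ (iter (p.den X) i s₀ (j + 1)) _ _ _ ?_ ?_ h₂
    · simp only [Test.holds, hbv, hiv]; omega
    · refine Exec.seq _ _ _ _ _ _ _ h₁ ?_
      have h3 := Exec.basic (X := X) (T := T) (.setNat 5 1) (p.den X (iter (p.den X) i s₀ j))
      have := Exec.seq _ _ _ _ _ _ _ h3 (Exec.basic (.addNat i i 5) _)
      -- The body leaves the counter alone, so adding `1` produces exactly the value `j + 1` that
      -- `iter` prescribes.
      have hv : (p.den X (iter (p.den X) i s₀ j)).nat i = j := by rw [den_nat X hi, hiv]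
      convert this using 1
      simp [Instr.run, iter, Function.update_of_ne hi5, hv]

theorem exec_toProg {T : ℕ} {B : List ℕ} {σ : ℕ → ℕ} :
    ∀ {p : Code} {s : State}, p.Guarded B → (∀ r ∈ B, s.nat r = σ r) →
      ∃ t ≤ p.timeBound T σ, Exec X T p.toProg s (p.den X s) t
  | .skip, s, _, _ => ⟨0, le_rfl, Exec.skip s⟩
  | .basic c, s, _, _ => ⟨_, le_rfl, Exec.basic c s⟩
  | .seq p q, s, h, hs => by
    obtain ⟨t₁, ht₁, h₁⟩ := exec_toProg (T := T) h.1 hs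
    obtain ⟨t₂, ht₂, h₂⟩ := exec_toProg (T := T) (s := p.den X s) h.2 fun r hr => by
      rw [den_nat X (Guarded.notMem_natWrites hr h.1), hs r hr]
    exact ⟨t₁ + t₂, add_le_add ht₁ ht₂, Exec.seq _ _ _ _ _ _ _ h₁ h₂⟩
  | .ite b p q, s, h, hs => by
    rw [den]
    split_ifs with hb
    · obtain ⟨t₁, ht₁, h₁⟩ := exec_toProg (T := T) h.1 hs
      exact ⟨t₁ + 1, by simp only [timeBound]; omega, Exec.iteTrue _ _ _ _ _ _ hb h₁⟩
    · obtain ⟨t₁, ht₁, h₁⟩ := exec_toProg (T := T) h.2 hs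
      exact ⟨t₁ + 1, by simp only [timeBound]; omega, Exec.iteFalse _ _ _ _ _ _ hb h₁⟩
  | .rep i b p, s, h, hs => by
    have hw : ∀ r ∈ B, r ∉ (Code.rep i b p).natWrites := fun r hr =>
      Guarded.notMem_natWrites hr h
    obtain ⟨hb, hi, h5, hi5, hip, hp⟩ := h
    have hframe : ∀ r ∈ B, ∀ j, (iter (p.den X) i s j).nat r = σ r := fun r hr j => by
      rw [← hs r hr, iter_nat X (hw r hr)]
    obtain ⟨t, ht, he⟩ := exec_loop X (T := T) (c := p.timeBound T σ) (s₀ := s) hip (hw b hb) hi5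
      (fun j _ => exec_toProg hp fun r hr => hframe r hr j) (s.nat b) 0 (by simp)
    refine ⟨1 + t, by simp only [timeBound, ← hs b hb]; omega, ?_⟩
    exact Exec.seq _ _ _ _ _ _ _ (Exec.basic _ _) he

end Code

/-! ### Separated sequences -/

/-- The first `c` terms of `A` are smaller than `d`, and each exceeds the one before it by at
least `D`. -/
def GapSeq (D d c : ℕ) (A : ℕ → ℕ) : Prop :=
  (∀ j < c, A j < d) ∧ ∀ j, j + 1 < c → A j + D ≤ A (j + 1)

/-- The total weight of the first `c` terms of `A`, at the price `lam` per term. -/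
noncomputable def gain (w : ℕ → ℝ) (lam : ℝ) (c : ℕ) (A : ℕ → ℕ) : ℝ :=
  ∑ j ∈ Finset.range c, (w (A j) - lam)

/-- The first `c` terms of `A` are a separated sequence of maximal gain. -/
def OptimalSeq (w : ℕ → ℝ) (lam : ℝ) (D d c : ℕ) (A : ℕ → ℕ) : Prop :=
  GapSeq D d c A ∧ ∀ c' A', GapSeq D d c' A' → gain w lam c' A' ≤ gain w lam c A

theorem gain_eq (w : ℕ → ℝ) (lam : ℝ) (c : ℕ) (A : ℕ → ℕ) :
    gain w lam c A = (∑ j ∈ Finset.range c, w (A j)) - c * lam := by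
  simp [gain, Finset.sum_sub_distrib]

theorem GapSeq.add_mul_le {D d c : ℕ} {A : ℕ → ℕ} (h : GapSeq D d c A) {i : ℕ} (l : ℕ)
    (hl : i + l < c) : A i + l * D ≤ A (i + l) := by
  induction l with
  | zero => simp
  | succ l ih =>
    have h1 := ih (by omega)
    have h2 := h.2 (i + l) (by omega)
    rw [add_mul, one_mul, ← add_assoc i l 1]
    omega

theorem GapSeq.add_le {D d c : ℕ} {A : ℕ → ℕ} (h : GapSeq D d c A) {i j : ℕ} (hij : i < j)
    (hj : j < c) : A i + D ≤ A j := by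
  obtain ⟨l, rfl⟩ := Nat.exists_eq_add_of_lt hij
  have := h.add_mul_le (i := i) (l + 1) (by omega)
  rw [add_mul, one_mul, ← add_assoc i l 1] at this
  omega

theorem GapSeq.length_le {D d c : ℕ} {A : ℕ → ℕ} (h : GapSeq D d c A) (hD : 1 ≤ D) : c ≤ d := by
  rcases Nat.eq_zero_or_pos c with rfl | hc
  · omega
  have h1 := h.add_mul_le (i := 0) (c - 1) (by omega)
  have h2 := h.1 (c - 1) (by omega)
  have h3 : (c - 1) * 1 ≤ (c - 1) * D := Nat.mul_le_mul_left _ hD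
  rw [zero_add] at h1
  omega

theorem GapSeq.injOn {D d c : ℕ} {A : ℕ → ℕ} (h : GapSeq D d c A) (hD : 1 ≤ D) :
    Set.InjOn A (Finset.range c) := by
  intro i hi j hj hij
  simp only [Finset.coe_range, Set.mem_Iio] at hi hj
  rcases lt_trichotomy i j with hlt | heq | hlt
  · have := h.add_le hlt hj; omega
  · exact heq
  · have := h.add_le hlt hi; omega

/-- Increasing enumeration of `Ω`. Distinct indices differ by at least `1`, so the gap `max Δ 1` is
correct also for `Δ = 0`; a positive gap is what makes the sequences injective. -/
theorem exists_gapSeq {d k Δ : ℕ} {Ω : Finset (Fin d)} (h : Ω ∈ separatedSupports d k Δ) :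
    ∃ A : ℕ → ℕ, GapSeq (max Δ 1) d k A ∧ (∀ i ∈ Ω, ∃ j < k, A j = i) ∧
      ∀ w : ℕ → ℝ, ∑ j ∈ Finset.range k, w (A j) = ∑ i ∈ Ω, w i := by
  obtain ⟨hsep, hcard⟩ := h
  let f := Ω.orderEmbOfFin hcard
  have hf : ∀ (j : ℕ) (hj : j < k),
      (if h : j < k then ((f ⟨j, h⟩ : Fin d) : ℕ) else 0) = f ⟨j, hj⟩ := fun j hj => dif_pos hj
  refine ⟨fun j => if h : j < k then ((f ⟨j, h⟩ : Fin d) : ℕ) else 0, ⟨?_, ?_⟩, ?_, ?_⟩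
  · intro j hj
    simp only [hf j hj, Fin.is_lt]
  · intro j hj
    simp only [hf j (by omega), hf (j + 1) hj]
    have hlt : f ⟨j, by omega⟩ < f ⟨j + 1, hj⟩ := f.strictMono (by simp [Fin.lt_def])
    have := hsep _ (Ω.orderEmbOfFin_mem hcard ⟨j, by omega⟩) _
      (Ω.orderEmbOfFin_mem hcard ⟨j + 1, hj⟩) hlt.ne
    change (Δ : ℤ) ≤ |((f ⟨j, by omega⟩ : ℕ) : ℤ) - ((f ⟨j + 1, hj⟩ : ℕ) : ℤ)| at this
    rw [Fin.lt_def] at hlt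
    rw [abs_of_neg (by omega)] at this
    omega
  · intro i hi
    have : i ∈ Set.range f := by rw [Finset.range_orderEmbOfFin]; exact hi
    obtain ⟨⟨j, hj⟩, rfl⟩ := this
    exact ⟨j, hj, by simp only [hf j hj]⟩
  · intro w
    rw [Finset.sum_range]
    have : ∀ j : Fin k, w (if h : (j : ℕ) < k then ((f ⟨j, h⟩ : Fin d) : ℕ) else 0) = w (f j) :=
      fun j => by rw [hf j j.2]
    simp only [this]
    conv_rhs => rw [← Finset.image_orderEmbOfFin_univ Ω hcard]
    rw [Finset.sum_image fun a _ b _ hab => f.injective hab]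

theorem GapSeq.mem_separatedSupports {Δ d k : ℕ} {A : ℕ → ℕ} (h : GapSeq (max Δ 1) d k A) :
    (Finset.univ.filter fun i : Fin d => ∃ j < k, A j = i) ∈ separatedSupports d k Δ := by
  constructor
  · intro i hi j hj hij
    simp only [Finset.mem_filter, Finset.mem_univ, true_and] at hi hj
    obtain ⟨a, ha, hai⟩ := hi
    obtain ⟨b, hb, hbj⟩ := hj
    rcases lt_trichotomy a b with hab | rfl | hab
    · have := h.add_le hab hb
      rw [abs_of_nonpos (by omega)]; omega
    · exact absurd (Fin.ext (hai.symm.trans hbj)) hij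
    · have := h.add_le hab ha
      rw [abs_of_nonneg (by omega)]; omega
  · rw [← Finset.card_range k]
    symm
    refine Finset.card_bij (fun j hj => ⟨A j, h.1 j (by simpa using hj)⟩) ?_ ?_ ?_
    · intro j hj
      simp only [Finset.mem_filter, Finset.mem_univ, true_and]
      exact ⟨j, by simpa using hj, rfl⟩
    · intro i hi j hj hij
      exact h.injOn (le_max_right _ _) hi hj (by simpa using hij)
    · intro i hi
      simp only [Finset.mem_filter, Finset.mem_univ, true_and] at hi
      obtain ⟨a, ha, hai⟩ := hi
      exact ⟨a, by simpa using ha, Fin.ext hai⟩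

theorem sum_filter_gapSeq {D d k : ℕ} {A : ℕ → ℕ} (h : GapSeq D d k A) (hD : 1 ≤ D)
    (w : ℕ → ℝ) :
    ∑ i ∈ Finset.univ.filter (fun i : Fin d => ∃ j < k, A j = i), w i =
      ∑ j ∈ Finset.range k, w (A j) := by
  symm
  refine Finset.sum_bij (fun j hj => (⟨A j, h.1 j (by simpa using hj)⟩ : Fin d)) ?_ ?_ ?_ ?_
  · intro j hj
    simp only [Finset.mem_filter, Finset.mem_univ, true_and]
    exact ⟨j, by simpa using hj, rfl⟩
  · intro i hi j hj hij
    exact h.injOn hD hi hj (by simpa using hij)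
  · intro i hi
    simp only [Finset.mem_filter, Finset.mem_univ, true_and] at hi
    obtain ⟨a, ha, hai⟩ := hi
    exact ⟨a, by simpa using ha, Fin.ext hai⟩
  · intros; rfl

/-- The number of terms that fit around the position `i` bounds the size of every separated set
that contains `i`. -/
theorem lt_of_mem_separatedSupports {d k Δ : ℕ} {Ω : Finset (Fin d)}
    (h : Ω ∈ separatedSupports d k Δ) {i : Fin d} (hi : i ∈ Ω) :
    k < (i : ℕ) / max Δ 1 + 1 + ((d - 1 - i) / max Δ 1 + 1) := by
  obtain ⟨A, hA, hmem, -⟩ := exists_gapSeq h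
  obtain ⟨j, hj, hji⟩ := hmem i hi
  have hD : 0 < max Δ 1 := by omega
  have h1 := hA.add_mul_le (i := 0) j (by omega)
  have h2 := hA.add_mul_le (i := j) (k - 1 - j) (by omega)
  have h3 := hA.1 (k - 1) (by omega)
  rw [zero_add] at h1
  rw [show j + (k - 1 - j) = k - 1 by omega] at h2
  have h4 : j ≤ (i : ℕ) / max Δ 1 := (Nat.le_div_iff_mul_le hD).2 (by omega)
  have h5 : k - 1 - j ≤ (d - 1 - i) / max Δ 1 := (Nat.le_div_iff_mul_le hD).2 (by omega)
  omega

/-- Converse of the preceding count. The indices that pass this test are therefore exactly those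
whose columns are controlled by the RIP, when `k ≥ 1`. -/
theorem exists_mem_separatedSupports {d k Δ : ℕ} (hk : 1 ≤ k) (i : Fin d)
    (h : k < (i : ℕ) / max Δ 1 + 1 + ((d - 1 - i) / max Δ 1 + 1)) :
    ∃ Ω ∈ separatedSupports d k Δ, i ∈ Ω := by
  have hi := i.2
  set D := max Δ 1 with hDdef
  have hD : 0 < D := by omega
  -- The support is an arithmetic progression of difference `D` through `i`, with as many of its `k`
  -- terms as possible, `j` of them, placed before `i`.
  set j := min ((i : ℕ) / D) (k - 1) with hj
  have h1 : j * D ≤ i := (Nat.le_div_iff_mul_le hD).1 (min_le_left _ _)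
  have h2 : (k - 1 - j) * D ≤ d - 1 - i := by
    refine (Nat.le_div_iff_mul_le hD).1 ?_
    generalize (d - 1 - (i : ℕ)) / D = v at h
    omega
  have hjk : j ≤ k - 1 := min_le_right _ _
  have hA : GapSeq D d k fun l => i + l * D - j * D := by
    constructor
    · intro l hl
      have h3 : l * D ≤ (k - 1) * D := Nat.mul_le_mul_right _ (by omega)
      have h4 : (k - 1 - j) * D + j * D = (k - 1) * D := by rw [← add_mul]; congr 1; omega
      dsimp only
      omega
    · intro l _
      dsimp only
      rw [add_mul, one_mul]
      omega
  refine ⟨_, hA.mem_separatedSupports, ?_⟩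
  simp only [Finset.mem_filter, Finset.mem_univ, true_and]
  exact ⟨j, by omega, by omega⟩

/-! ### Dynamic programming -/

/-- The recursion of the dynamic program for separated sequences of maximal gain; `V q` is the
largest gain of the sequences with all terms in `[q, d)`. -/
def IsValueFunction (w : ℕ → ℝ) (lam : ℝ) (D d : ℕ) (V : ℕ → ℝ) : Prop :=
  (∀ q, d ≤ q → V q = 0) ∧ ∀ q < d, V q = max (V (q + 1)) (w q + V (q + D) - lam)

theorem IsValueFunction.nonneg {w : ℕ → ℝ} {lam : ℝ} {D d : ℕ} {V : ℕ → ℝ}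
    (h : IsValueFunction w lam D d V) (q : ℕ) : 0 ≤ V q := by
  induction hm : d - q generalizing q with
  | zero => exact (h.1 q (by omega)).ge
  | succ m ih =>
    rw [h.2 q (by omega)]
    exact le_max_of_le_left (ih _ (by omega))

/-- The first term of a sequence in `[q, d)` is either `q`, and then the others start at `q + D`, or
at least `q + 1`. These are the two branches of the recursion. -/
theorem IsValueFunction.gain_le {w : ℕ → ℝ} {lam : ℝ} {D d : ℕ} {V : ℕ → ℝ}
    (h : IsValueFunction w lam D d V) (hD : 1 ≤ D) (q : ℕ) :
    ∀ (c : ℕ) (A : ℕ → ℕ), GapSeq D d c A → (∀ j < c, q ≤ A j) → gain w lam c A ≤ V q := by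
  induction hm : d - q using Nat.strong_induction_on generalizing q with
  | _ m ih =>
    intro c A hA hq
    rcases c with _ | c
    · simpa [gain] using h.nonneg q
    have hd : q < d := (hq 0 (by omega)).trans_lt (hA.1 0 (by omega))
    rw [h.2 q hd]
    rcases (hq 0 (by omega)).eq_or_lt with h0 | h0
    · refine le_max_of_le_right ?_
      rw [gain, Finset.sum_range_succ', ← h0]
      have key : gain w lam c (fun j => A (j + 1)) ≤ V (q + D) := by
        refine ih (d - (q + D)) (by omega) (q + D) rfl c _ ⟨fun j hj => hA.1 _ (by omega),
          fun j hj => hA.2 _ (by omega)⟩ fun j hj => ?_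
        have := hA.add_le (i := 0) (j := j + 1) (by omega) (by omega)
        omega
      rw [gain] at key
      linarith
    · refine le_max_of_le_left (ih (d - (q + 1)) (by omega) (q + 1) rfl _ A hA fun j hj => ?_)
      rcases Nat.eq_zero_or_pos j with rfl | hj0
      · exact h0
      · have := hA.add_le hj0 hj
        omega

/-! ### Combining two optimal sequences -/

/-- The first `m` terms of `A`, followed by the terms of `B` from number `m + s` on. -/
def splice (A B : ℕ → ℕ) (m s : ℕ) : ℕ → ℕ := fun j => if j < m then A j else B (j + s)

/-- The term `m` of `A` is too small to follow the first `m + s` terms of `B`. -/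
def Blocked (A B : ℕ → ℕ) (D a s m : ℕ) : Prop := m < a ∧ 1 ≤ m + s ∧ A m < B (m + s - 1) + D

instance (A B : ℕ → ℕ) (D a s m : ℕ) : Decidable (Blocked A B D a s m) :=
  inferInstanceAs (Decidable (_ ∧ _ ∧ _))

/-- With `s = b - k`, only the junction needs an argument. As `m - 1` is blocked, `A (m - 1) < B (m
+ s - 2) + D ≤ B (m + s - 1)`, and one more gap of `B` gives `A (m - 1) + D ≤ B (m + s)`. -/
theorem GapSeq.splice {A B : ℕ → ℕ} {D d a b k m : ℕ} (hA : GapSeq D d a A) (hB : GapSeq D d b B)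
    (hkb : k ≤ b) (hma : m ≤ a)
    (hpre : m = 0 ∨ Blocked A B D a (b - k) (m - 1)) : GapSeq D d k (splice A B m (b - k)) := by
  constructor
  · intro j hj
    simp only [SepSparse.splice]
    split_ifs with h
    · exact hA.1 j (by omega)
    · exact hB.1 _ (by omega)
  · intro j hj
    simp only [SepSparse.splice]
    by_cases h1 : j + 1 < m
    · rw [if_pos (by omega), if_pos h1]
      exact hA.2 j (by omega)
    by_cases h2 : j < m
    · rw [if_pos h2, if_neg h1]
      obtain rfl : m = j + 1 := by omega
      rcases hpre with h0 | ⟨h3, h4, h5⟩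
      · omega
      rw [Nat.add_sub_cancel] at h3 h4 h5
      have h6 := hB.add_le (i := j + (b - k) - 1) (j := j + (b - k)) (by omega) (by omega)
      have h7 := hB.add_le (i := j + (b - k)) (j := j + 1 + (b - k)) (by omega) (by omega)
      omega
    · rw [if_neg h2, if_neg h1, show j + 1 + (b - k) = j + (b - k) + 1 by omega]
      exact hB.2 _ (by omega)

/-- The pieces that `splice` discards: the first `m + (b - k)` terms of `B`, then `A` from term `m`
on. Separation at the junction is precisely that `m` is not blocked. -/
theorem GapSeq.cosplice {A B : ℕ → ℕ} {D d a b k m : ℕ} (hA : GapSeq D d a A)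
    (hB : GapSeq D d b B) (hak : a ≤ k) (hkb : k ≤ b)
    (hfree : ¬ Blocked A B D a (b - k) m) :
    GapSeq D d (a + (b - k)) fun j => if j < m + (b - k) then B j else A (j - (b - k)) := by
  constructor
  · intro j hj
    dsimp only
    split_ifs with h
    · exact hB.1 j (by omega)
    · exact hA.1 _ (by omega)
  · intro j hj
    dsimp only
    by_cases h1 : j + 1 < m + (b - k)
    · rw [if_pos (by omega), if_pos h1]
      exact hB.2 j (by omega)
    by_cases h2 : j < m + (b - k)
    · rw [if_pos h2, if_neg h1]
      simp only [Blocked, not_and, not_lt] at hfree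
      have := hfree (by omega) (by omega)
      rwa [show m + (b - k) - 1 = j by omega, show m = j + 1 - (b - k) by omega] at this
    · rw [if_neg h2, if_neg h1, show j + 1 - (b - k) = j - (b - k) + 1 by omega]
      exact hA.2 _ (by omega)

/-- Exchange identity: the splice and its complement together use each term of `A` and of `B` once.
-/
theorem sum_splice_add (w : ℕ → ℝ) (A B : ℕ → ℕ) {a b k m : ℕ} (hak : a ≤ k) (hkb : k ≤ b)
    (hma : m ≤ a) :
    ∑ j ∈ Finset.range k, w (splice A B m (b - k) j) +
      ∑ j ∈ Finset.range (a + (b - k)), w (if j < m + (b - k) then B j else A (j - (b - k))) =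
      ∑ j ∈ Finset.range a, w (A j) + ∑ j ∈ Finset.range b, w (B j) := by
  have e1 : ∑ j ∈ Finset.range k, w (splice A B m (b - k) j) =
      ∑ j ∈ Finset.range m, w (A j) + ∑ j ∈ Finset.range (k - m), w (B (m + (b - k) + j)) := by
    conv_lhs => rw [show k = m + (k - m) by omega]
    rw [Finset.sum_range_add]
    congr 1
    · exact Finset.sum_congr rfl fun j hj => by
        rw [splice, if_pos (by simpa using hj)]
    · refine Finset.sum_congr rfl fun j hj => ?_
      rw [splice, if_neg (by omega)]
      congr 2; omega
  have e2 : ∑ j ∈ Finset.range (a + (b - k)),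
        w (if j < m + (b - k) then B j else A (j - (b - k))) =
      ∑ j ∈ Finset.range (m + (b - k)), w (B j) + ∑ j ∈ Finset.range (a - m), w (A (m + j)) := by
    rw [show a + (b - k) = m + (b - k) + (a - m) by omega, Finset.sum_range_add]
    congr 1
    · exact Finset.sum_congr rfl fun j hj => by rw [if_pos (by simpa using hj)]
    · refine Finset.sum_congr rfl fun j hj => ?_
      rw [if_neg (by omega)]
      congr 2; omega
  have e3 : ∑ j ∈ Finset.range a, w (A j) =
      ∑ j ∈ Finset.range m, w (A j) + ∑ j ∈ Finset.range (a - m), w (A (m + j)) := by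
    conv_lhs => rw [show a = m + (a - m) by omega]
    rw [Finset.sum_range_add]
  have e4 : ∑ j ∈ Finset.range b, w (B j) = ∑ j ∈ Finset.range (m + (b - k)), w (B j) +
      ∑ j ∈ Finset.range (k - m), w (B (m + (b - k) + j)) := by
    conv_lhs => rw [show b = m + (b - k) + (k - m) by omega]
    rw [Finset.sum_range_add]
  rw [e1, e2, e3, e4]
  ring

/-- Splicing an optimal sequence for the price `hi` and a longer one for the price `lo` gives an
almost optimal sequence of the prescribed length `k`. -/
theorem sum_le_sum_splice {w : ℕ → ℝ} {lo hi : ℝ} {A B O : ℕ → ℕ} {D d a b k m : ℕ}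
    (hA : OptimalSeq w hi D d a A) (hB : OptimalSeq w lo D d b B)
    (hak : a ≤ k) (hkb : k ≤ b) (hma : m ≤ a) (hfree : ¬ Blocked A B D a (b - k) m)
    (hO : GapSeq D d k O) :
    ∑ j ∈ Finset.range k, w (O j) ≤
      ∑ j ∈ Finset.range k, w (splice A B m (b - k) j) + (hi - lo) * (b - k) := by
  -- At price `hi` the complement pays for `b - k` more terms than `A`; at price `lo` the competitor
  -- `O` pays for `b - k` fewer than `B`. Adding both inequalities and the exchange identity leaves
  -- the loss `(hi - lo) (b - k)`.
  have h1 := hA.2 _ _ (hA.1.cosplice hB.1 hak hkb hfree)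
  have h2 := hB.2 _ _ hO
  have h3 := sum_splice_add w A B hak hkb hma
  rw [gain_eq, gain_eq] at h1 h2
  push_cast [Nat.cast_sub hkb] at h1
  nlinarith

theorem OptimalSeq.congr {w : ℕ → ℝ} {lam : ℝ} {D d c : ℕ} {A A' : ℕ → ℕ}
    (h : OptimalSeq w lam D d c A) (hA : ∀ j < c, A' j = A j) : OptimalSeq w lam D d c A' := by
  have e : gain w lam c A' = gain w lam c A :=
    Finset.sum_congr rfl fun j hj => by rw [hA j (by simpa using hj)]
  refine ⟨⟨fun j hj => ?_, fun j hj => ?_⟩, fun c' B hB => e ▸ h.2 c' B hB⟩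
  · rw [hA j hj]
    exact h.1.1 j hj
  · rw [hA _ hj, hA j (by omega)]
    exact h.1.2 j hj

/-! ### Extreme prices, where the bisection starts -/

/-- A single term already costs at least the largest total weight, so no nonempty sequence has
positive gain. -/
theorem optimalSeq_zero {w : ℕ → ℝ} {W lam : ℝ} {D d : ℕ} {A : ℕ → ℕ} (hW0 : 0 ≤ W)
    (hW : ∀ c A, GapSeq D d c A → ∑ j ∈ Finset.range c, w (A j) ≤ W) (h : W ≤ lam) :
    OptimalSeq w lam D d 0 A := by
  refine ⟨⟨by simp, by simp⟩, fun c A' hA' => ?_⟩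
  rcases Nat.eq_zero_or_pos c with rfl | hc
  · simp [gain]
  have h1 := hW c A' hA'
  have h2 : (1 : ℝ) ≤ c := by exact_mod_cast hc
  rw [gain_eq, gain_eq]
  simp only [Finset.range_zero, Finset.sum_empty, Nat.cast_zero, zero_mul, sub_zero]
  nlinarith

/-- Each term is subsidised by more than the largest total weight `W`. A sequence shorter than `O`
loses more in subsidy than it could gain in weight. -/
theorem OptimalSeq.le_length_of_small {w : ℕ → ℝ} {W lam : ℝ} {D d b k : ℕ} {B O : ℕ → ℕ}
    (hB : OptimalSeq w lam D d b B) (hw : ∀ q < d, 0 ≤ w q) (hO : GapSeq D d k O)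
    (hW0 : 0 ≤ W) (hW : ∀ c A, GapSeq D d c A → ∑ j ∈ Finset.range c, w (A j) ≤ W)
    (h : lam < -W) : k ≤ b := by
  have h1 := hB.2 k O hO
  have h2 := hW b B hB.1
  have h3 : 0 ≤ ∑ j ∈ Finset.range k, w (O j) := Finset.sum_nonneg fun j hj =>
    hw _ (hO.1 j (by simpa using hj))
  rw [gain_eq, gain_eq] at h1
  by_contra hkb
  have h4 : (b : ℝ) + 1 ≤ k := by exact_mod_cast (by omega : b + 1 ≤ k)
  nlinarith

theorem GapSeq.sum_le {w : ℕ → ℝ} {D d c : ℕ} {A : ℕ → ℕ} (h : GapSeq D d c A) (hD : 1 ≤ D)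
    (hw : ∀ q < d, 0 ≤ w q) : ∑ j ∈ Finset.range c, w (A j) ≤ ∑ q ∈ Finset.range d, w q := by
  rw [← Finset.sum_image (f := w) (h.injOn hD)]
  refine Finset.sum_le_sum_of_subset_of_nonneg ?_ fun q hq _ =>
    hw q (by simpa using hq)
  intro q hq
  simp only [Finset.mem_image, Finset.mem_range] at hq ⊢
  obtain ⟨j, hj, rfl⟩ := hq
  exact h.1 j hj

/-! ### Geometry of the model-RIP -/

section Geometry

open scoped InnerProductSpace

variable {n d : ℕ} {M : Set (Finset (Fin d))} {δ : ℝ} {X : Matrix (Fin n) (Fin d) ℝ}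

theorem supp_subset_iff {x : EuclideanSpace ℝ (Fin d)} {Ω : Finset (Fin d)} :
    supp x ⊆ Ω ↔ ∀ i, i ∉ Ω → x i = 0 := by
  simp only [supp, Finset.subset_iff, Finset.mem_filter, Finset.mem_univ, true_and]
  exact forall_congr' fun i => by rw [not_imp_comm]

theorem smul_mem_modelVectors {x : EuclideanSpace ℝ (Fin d)} (h : x ∈ modelVectors M) (a : ℝ) :
    a • x ∈ modelVectors M := by
  obtain ⟨Ω, hΩ, hx⟩ := h
  refine ⟨Ω, hΩ, supp_subset_iff.2 fun i hi => ?_⟩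
  simp [supp_subset_iff.1 hx i hi]

theorem add_mem_modelSums {x y z : EuclideanSpace ℝ (Fin d)} (hx : x ∈ modelVectors M)
    (hy : y ∈ modelVectors M) (hz : z ∈ modelVectors M) (a b c : ℝ) :
    a • x + b • y + c • z ∈ modelSums M 3 := by
  refine ⟨![a • x, b • y, c • z], ?_, ?_⟩
  · intro i
    fin_cases i
    · exact smul_mem_modelVectors hx a
    · exact smul_mem_modelVectors hy b
    · exact smul_mem_modelVectors hz c
  · simp [Fin.sum_univ_three]

theorem mulVecE_add (x y : EuclideanSpace ℝ (Fin d)) :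
    mulVecE X (x + y) = mulVecE X x + mulVecE X y := by
  simp [mulVecE, Matrix.mulVec_add]

theorem mulVecE_smul (a : ℝ) (x : EuclideanSpace ℝ (Fin d)) :
    mulVecE X (a • x) = a • mulVecE X x := by
  simp [mulVecE, Matrix.mulVec_smul]

theorem mulVecE_sub (x y : EuclideanSpace ℝ (Fin d)) :
    mulVecE X (x - y) = mulVecE X x - mulVecE X y := by
  simp [mulVecE, Matrix.mulVec_sub]

theorem inner_mulVecE_transpose (x : EuclideanSpace ℝ (Fin d)) (r : EuclideanSpace ℝ (Fin n)) :
    ⟪x, mulVecE X.transpose r⟫_ℝ = ⟪mulVecE X x, r⟫_ℝ := by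
  simp only [mulVecE, EuclideanSpace.inner_eq_star_dotProduct, star_trivial]
  rw [Matrix.mulVec_transpose, ← Matrix.dotProduct_mulVec]

theorem ModelRIP.mono {δ' : ℝ} (h : ModelRIP M 3 δ X) (hδ : δ ≤ δ') : ModelRIP M 3 δ' X := by
  intro x hx
  obtain ⟨h1, h2⟩ := h x hx
  have := sq_nonneg ‖x‖
  constructor <;> nlinarith

/-- Crude form of the upper bound, from `1 + δ ≤ 4`; the lower bound below uses `1 - δ ≥ 1 / 4` in
the same way. -/
theorem ModelRIP.norm_mulVecE_le (h : ModelRIP M 3 δ X) (hδ : δ ≤ 3)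
    {x : EuclideanSpace ℝ (Fin d)} (hx : x ∈ modelSums M 3) : ‖mulVecE X x‖ ≤ 2 * ‖x‖ := by
  refine abs_le_of_sq_le_sq' ?_ (by positivity) |>.2
  have := (h x hx).2
  nlinarith [sq_nonneg ‖x‖]

theorem ModelRIP.norm_le (h : ModelRIP M 3 δ X) (hδ : δ ≤ 3 / 4)
    {x : EuclideanSpace ℝ (Fin d)} (hx : x ∈ modelSums M 3) : ‖x‖ ≤ 2 * ‖mulVecE X x‖ := by
  refine abs_le_of_sq_le_sq' ?_ (by positivity) |>.2
  have := (h x hx).1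
  nlinarith [sq_nonneg ‖x‖]

/-- The bilinear form of the model-RIP. -/
theorem ModelRIP.inner_sub_inner_le (h : ModelRIP M 3 δ X) {u v : EuclideanSpace ℝ (Fin d)}
    (huv : ∀ a b : ℝ, a • u + b • v ∈ modelSums M 3) :
    ⟪u, v⟫_ℝ - ⟪mulVecE X u, mulVecE X v⟫_ℝ ≤ δ * (‖u‖ * ‖v‖) := by
  rcases eq_or_ne u 0 with rfl | hu
  · simp [mulVecE]
  rcases eq_or_ne v 0 with rfl | hv
  · simp [mulVecE]
  have hu' := norm_pos_iff.2 hu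
  have hv' := norm_pos_iff.2 hv
  -- Polarisation with the rescaled vectors `‖v‖ u` and `‖u‖ v` of equal norm: the lower bound is
  -- applied to their sum and the upper bound to their difference.
  have h1 := (h _ (huv ‖v‖ ‖u‖)).1
  have h2 := (h _ (huv ‖v‖ (-‖u‖))).2
  simp only [mulVecE_add, mulVecE_smul] at h1 h2
  rw [norm_add_sq_real, norm_add_sq_real] at h1 h2
  simp only [norm_smul, inner_smul_left, inner_smul_right, norm_neg,
    RCLike.conj_to_real, Real.norm_eq_abs, abs_norm] at h1 h2
  have h3 : 0 < ‖u‖ * ‖v‖ := by positivity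
  have h4 : (‖u‖ * ‖v‖) * (⟪u, v⟫_ℝ - ⟪mulVecE X u, mulVecE X v⟫_ℝ) ≤
      (‖u‖ * ‖v‖) * (δ * (‖u‖ * ‖v‖)) := by nlinarith
  exact le_of_mul_le_mul_left h4 h3

/-- The columns of `X` that belong to some support of the model are bounded. -/
theorem ModelRIP.abs_transpose_le (h : ModelRIP M 3 δ X) (hδ : δ ≤ 3) {Ω : Finset (Fin d)}
    (hΩ : Ω ∈ M) {i : Fin d} (hi : i ∈ Ω) (r : EuclideanSpace ℝ (Fin n)) :
    |mulVecE X.transpose r i| ≤ 2 * ‖r‖ := by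
  set x : EuclideanSpace ℝ (Fin d) := EuclideanSpace.single i 1
  have hx : x ∈ modelVectors M := ⟨Ω, hΩ, supp_subset_iff.2 fun j hj => by
    have : j ≠ i := fun h => hj (h ▸ hi)
    simp [x, this]⟩
  have hx1 : ‖x‖ = 1 := by simp [x]
  have h1 : mulVecE X.transpose r i = ⟪mulVecE X x, r⟫_ℝ := by
    rw [← inner_mulVecE_transpose]
    simp [x, EuclideanSpace.inner_single_left]
  have h2 : ‖mulVecE X x‖ ≤ 2 := by
    have := h.norm_mulVecE_le hδ (x := x)
      (by simpa using add_mem_modelSums hx hx hx 1 0 0)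
    rwa [hx1, mul_one] at this
  rw [h1]
  exact (abs_real_inner_le_norm _ _).trans (mul_le_mul_of_nonneg_right h2 (norm_nonneg _))

/-- One step of projected gradient descent with an approximate projection. -/
theorem ModelRIP.step (h : ModelRIP M 3 δ X) (hδ0 : 0 ≤ δ) (hδ : δ ≤ 3)
    {x x' θ : EuclideanSpace ℝ (Fin d)} {e : EuclideanSpace ℝ (Fin n)}
    (hx : x ∈ modelVectors M) (hx' : x' ∈ modelVectors M) (hθ : θ ∈ modelVectors M) {η : ℝ}
    (hη : 0 ≤ η)
    (hproj : ‖x' - (x + mulVecE X.transpose (mulVecE X θ + e - mulVecE X x))‖ ^ 2 ≤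
      ‖θ - (x + mulVecE X.transpose (mulVecE X θ + e - mulVecE X x))‖ ^ 2 + η ^ 2) :
    ‖x' - θ‖ ≤ 2 * δ * ‖x - θ‖ + 4 * ‖e‖ + η := by
  set u := x' - θ with hu
  set v := x - θ with hv
  set r := mulVecE X θ + e - mulVecE X x with hr
  have hr' : r = e - mulVecE X v := by rw [hr, hv, mulVecE_sub]; abel
  have h1 : x' - (x + mulVecE X.transpose r) = u - (v + mulVecE X.transpose r) := by
    rw [hu, hv]; abel
  have h2 : θ - (x + mulVecE X.transpose r) = -(v + mulVecE X.transpose r) := by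
    rw [hv]; abel
  rw [h1, h2, norm_neg, norm_sub_sq_real, inner_add_right, inner_mulVecE_transpose, hr',
    inner_sub_right (mulVecE X u)] at hproj
  -- Here order 3 is needed: `a u + b v = a x' + b x - (a + b) θ`.
  have h3 := h.inner_sub_inner_le (u := u) (v := v) fun a b => by
    have := add_mem_modelSums hx' hx hθ a b (-(a + b))
    convert this using 1
    rw [hu, hv]
    module
  have h4 : ‖mulVecE X u‖ ≤ 2 * ‖u‖ := h.norm_mulVecE_le hδ (by
    have := add_mem_modelSums hx' hx hθ 1 0 (-1)
    convert this using 1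
    rw [hu]
    module)
  have h5 : ⟪mulVecE X u, e⟫_ℝ ≤ 2 * ‖u‖ * ‖e‖ :=
    (real_inner_le_norm _ _).trans (mul_le_mul_of_nonneg_right h4 (norm_nonneg _))
  have hu0 := norm_nonneg u
  have he0 := norm_nonneg e
  have hv0 := norm_nonneg v
  have h6 : ‖u‖ ^ 2 ≤ ‖u‖ * (2 * δ * ‖v‖ + 4 * ‖e‖) + η ^ 2 := by nlinarith
  set m := 2 * δ * ‖v‖ + 4 * ‖e‖ with hm
  have hm0 : 0 ≤ m := by positivity
  -- From `t ^ 2 ≤ t m + η ^ 2` it follows that `t ≤ m + η`: otherwise `t (t - m) > (m + η) η ≥ η ^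
  -- 2`.
  by_contra hlt
  push Not at hlt
  nlinarith

/-- Restricting a vector to a support of almost maximal weight is almost a projection. -/
theorem norm_restrict_sub_sq_le {x' θ z : EuclideanSpace ℝ (Fin d)} {Ω' Ω : Finset (Fin d)}
    (hx' : ∀ i, x' i = if i ∈ Ω' then z i else 0) (hθ : supp θ ⊆ Ω) {η : ℝ}
    (h : ∑ i ∈ Ω, z i ^ 2 ≤ ∑ i ∈ Ω', z i ^ 2 + η) :
    ‖x' - z‖ ^ 2 ≤ ‖θ - z‖ ^ 2 + η := by
  rw [EuclideanSpace.norm_sq_eq, EuclideanSpace.norm_sq_eq]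
  have h1 : ∑ i, ‖(x' - z) i‖ ^ 2 = ∑ i, z i ^ 2 - ∑ i ∈ Ω', z i ^ 2 := by
    rw [← Finset.sum_add_sum_compl Ω' fun i => z i ^ 2, add_sub_cancel_left,
      ← Finset.sum_add_sum_compl Ω' fun i => ‖(x' - z) i‖ ^ 2]
    have : ∑ i ∈ Ω', ‖(x' - z) i‖ ^ 2 = 0 := Finset.sum_eq_zero fun i hi => by simp [hx', hi]
    rw [this, zero_add]
    refine Finset.sum_congr rfl fun i hi => ?_
    simp [hx', Finset.mem_compl.1 hi]
  have h2 : ∑ i, z i ^ 2 - ∑ i ∈ Ω, z i ^ 2 ≤ ∑ i, ‖(θ - z) i‖ ^ 2 := by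
    rw [← Finset.sum_add_sum_compl Ω fun i => z i ^ 2, add_sub_cancel_left,
      ← Finset.sum_add_sum_compl Ω fun i => ‖(θ - z) i‖ ^ 2]
    have : ∑ i ∈ Ωᶜ, z i ^ 2 = ∑ i ∈ Ωᶜ, ‖(θ - z) i‖ ^ 2 := Finset.sum_congr rfl fun i hi => by
      simp [supp_subset_iff.1 hθ i (Finset.mem_compl.1 hi)]
    rw [this]
    exact le_add_of_nonneg_left (Finset.sum_nonneg fun i _ => by positivity)
  linarith

/-- Of two candidates in the model, one with the smaller residual is close to the signal. -/
theorem ModelRIP.norm_sub_le_of_residual (h : ModelRIP M 3 δ X) (hδ : δ ≤ 3 / 4)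
    {o u θ : EuclideanSpace ℝ (Fin d)} {e : EuclideanSpace ℝ (Fin n)}
    (ho : o ∈ modelVectors M) (hu : u ∈ modelVectors M) (hθ : θ ∈ modelVectors M)
    (hres : ‖mulVecE X θ + e - mulVecE X o‖ ≤ ‖mulVecE X θ + e - mulVecE X u‖) :
    ‖o - θ‖ ≤ 4 * ‖u - θ‖ + 4 * ‖e‖ := by
  -- The chain is `‖o - θ‖ ≤ 2 ‖X (o - θ)‖ ≤ 2 (‖e‖ + residual of o) ≤ 2 (‖e‖ + residual of u) ≤ 2
  -- (2 ‖e‖ + 2 ‖u - θ‖)`.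
  have h1 := h.norm_le hδ (x := o - θ) (by
    have := add_mem_modelSums ho hu hθ 1 0 (-1)
    convert this using 1
    module)
  have h2 := h.norm_mulVecE_le (by linarith) (x := u - θ) (by
    have := add_mem_modelSums ho hu hθ 0 1 (-1)
    convert this using 1
    module)
  have e1 : mulVecE X (o - θ) = e - (mulVecE X θ + e - mulVecE X o) := by
    rw [mulVecE_sub]; abel
  have e2 : mulVecE X θ + e - mulVecE X u = e - mulVecE X (u - θ) := by
    rw [mulVecE_sub]; abel
  have h3 := norm_sub_le e (mulVecE X θ + e - mulVecE X o)
  have h4 := norm_sub_le e (mulVecE X (u - θ))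
  rw [← e1] at h3
  rw [← e2] at h4
  linarith

theorem ModelRIP.norm_residual_le (h : ModelRIP M 3 δ X) (hδ : δ ≤ 3)
    {x θ : EuclideanSpace ℝ (Fin d)} {e : EuclideanSpace ℝ (Fin n)}
    (hx : x ∈ modelVectors M) (hθ : θ ∈ modelVectors M) :
    ‖mulVecE X θ + e - mulVecE X x‖ ≤ 2 * ‖x - θ‖ + ‖e‖ := by
  have h2 := h.norm_mulVecE_le hδ (x := x - θ) (by
    have := add_mem_modelSums hx hx hθ 1 0 (-1)
    convert this using 1
    module)
  have e2 : mulVecE X θ + e - mulVecE X x = e - mulVecE X (x - θ) := by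
    rw [mulVecE_sub]; abel
  have h4 := norm_sub_le e (mulVecE X (x - θ))
  rw [← e2] at h4
  linarith

end Geometry

/-! ### Convergence -/

/-- An affine recursion with a contracting linear part. -/
theorem le_of_affine_recursion {b : ℕ → ℝ} {ρ c : ℝ} (hρ0 : 0 ≤ ρ) (hρ1 : ρ < 1) (hc : 0 ≤ c)
    (h : ∀ t, b (t + 1) ≤ ρ * b t + c) (t : ℕ) : b t ≤ ρ ^ t * b 0 + c / (1 - ρ) := by
  have h1 : 0 < 1 - ρ := by linarith
  induction t with
  | zero =>
    have : 0 ≤ c / (1 - ρ) := by positivity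
    simpa using this
  | succ t ih =>
    -- `c / (1 - ρ)` is the fixed point of the recursion.
    have e : ρ * (c / (1 - ρ)) + c = c / (1 - ρ) := by field_simp; ring
    calc b (t + 1) ≤ ρ * b t + c := h t
      _ ≤ ρ * (ρ ^ t * b 0 + c / (1 - ρ)) + c := by gcongr
      _ = ρ ^ (t + 1) * b 0 + c / (1 - ρ) := by rw [pow_succ]; linear_combination e

/-! ### Reading an optimal sequence off the value function -/

theorem gain_update (w : ℕ → ℝ) (lam : ℝ) (c : ℕ) (A : ℕ → ℕ) (i : ℕ) :
    gain w lam (c + 1) (Function.update A c i) = gain w lam c A + (w i - lam) := by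
  rw [gain, Finset.sum_range_succ, Function.update_self, gain]
  congr 1
  refine Finset.sum_congr rfl fun j hj => ?_
  rw [Function.update_of_ne (by simp at hj; omega)]

/-- The first `c` terms of `A` can be extended by terms from `max j nx` on to a sequence of maximal
gain. -/
structure Traced (w : ℕ → ℝ) (lam : ℝ) (D : ℕ) (V : ℕ → ℝ) (j nx c : ℕ) (A : ℕ → ℕ) : Prop where
  lt : ∀ l < c, A l < j
  gap : ∀ l, l + 1 < c → A l + D ≤ A (l + 1)
  next : ∀ l < c, A l + D ≤ nx
  val : gain w lam c A + V (max j nx) = V 0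

theorem Traced.take {w : ℕ → ℝ} {lam : ℝ} {D d : ℕ} {V : ℕ → ℝ} {j nx c : ℕ} {A : ℕ → ℕ}
    (h : Traced w lam D V j nx c A) (hV : IsValueFunction w lam D d V) (hD : 1 ≤ D) (hj : j < d)
    (hn : nx ≤ j) (hlt : V (j + 1) < w j + V (j + D) - lam) :
    Traced w lam D V (j + 1) (j + D) (c + 1) (Function.update A c j) where
  lt l hl := by
    rcases eq_or_ne l c with rfl | hne
    · simp
    · rw [Function.update_of_ne hne]
      have := h.lt l (by omega)
      omega
  gap l hl := by
    rw [Function.update_of_ne (a := l) (by omega)]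
    rcases eq_or_ne (l + 1) c with rfl | hne
    · have := h.next l (by omega)
      simp only [Function.update_self]
      omega
    · rw [Function.update_of_ne hne]
      exact h.gap l (by omega)
  next l hl := by
    rcases eq_or_ne l c with rfl | hne
    · simp
    · rw [Function.update_of_ne hne]
      have := h.next l (by omega)
      omega
  val := by
    have h1 := h.val
    rw [max_eq_left hn, hV.2 j hj, max_eq_right hlt.le] at h1
    rw [gain_update, max_eq_right (by omega), ← h1]
    ring

/-- Either `j` is too close to the last term, and `max j nx` stays equal to `nx`, or the recursion
gives `V j = V (j + 1)`. In both cases nothing is lost. -/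
theorem Traced.skip {w : ℕ → ℝ} {lam : ℝ} {D d : ℕ} {V : ℕ → ℝ} {j nx c : ℕ} {A : ℕ → ℕ}
    (h : Traced w lam D V j nx c A) (hV : IsValueFunction w lam D d V) (hj : j < d)
    (hn : nx ≤ j → ¬ V (j + 1) < w j + V (j + D) - lam) :
    Traced w lam D V (j + 1) nx c A where
  lt l hl := (h.lt l hl).trans (by omega)
  gap := h.gap
  next := h.next
  val := by
    have h1 := h.val
    rcases le_or_gt nx j with hle | hgt
    · rw [max_eq_left hle, hV.2 j hj, max_eq_left (not_lt.1 (hn hle))] at h1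
      rw [max_eq_left (by omega), h1]
    · rwa [max_eq_right (by omega)] at h1 ⊢

/-- At `j = d` no value is left, so the gain of the list is `V 0`, which bounds every gain. -/
theorem Traced.optimalSeq {w : ℕ → ℝ} {lam : ℝ} {D d : ℕ} {V : ℕ → ℝ} {nx c : ℕ} {A : ℕ → ℕ}
    (h : Traced w lam D V d nx c A) (hV : IsValueFunction w lam D d V) (hD : 1 ≤ D) :
    OptimalSeq w lam D d c A := by
  refine ⟨⟨h.lt, h.gap⟩, fun c' A' hA' => ?_⟩
  have h1 := h.val
  rw [hV.1 _ (le_max_left _ _), add_zero] at h1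
  rw [h1]
  exact hV.gain_le hD 0 c' A' hA' fun j _ => Nat.zero_le _

/-! ### The program -/

namespace Code

/-- Tabulate the value function of the weights `realArr[5]` at the price `real[0]` in `realArr[6]`,
and the decisions to take an index in `natArr[1]`. -/
def valueTable : Code :=
  .rep 13 1 <| block [
    instrs [.setNat 5 1, .addNat 15 13 5, .subNat 15 1 15, .addNat 16 15 5, .loadReal 3 6 16,
      .addNat 16 15 3, .loadReal 4 6 16, .loadReal 5 5 15, .arith .add 4 5 4, .arith .sub 4 4 0],
    .ite (.ltReal 3 4)
      (instrs [.storeReal 6 15 4, .storeNat 1 15 5])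
      (instrs [.storeReal 6 15 3, .setNat 16 0, .storeNat 1 15 16])]

/-- Take the index `nat[13]` if it is not before `nat[18]` and `natArr[1]` says so. -/
def traceBody : Code :=
  .ite (.leNat 18 13)
    (block [
      instrs [.loadNat 15 1 13, .setNat 5 1],
      .ite (.leNat 5 15)
        (instrs [.storeNat 2 19 13, .addNat 19 19 5, .addNat 18 13 3])
        .skip])
    .skip

/-- Follow the decisions in `natArr[1]`, and list the indices taken in `natArr[2]` and their number
in `nat[19]`. -/
def traceBack : Code := block [instrs [.setNat 19 0, .setNat 18 0], .rep 13 1 traceBody]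

variable {n d : ℕ} (X : Matrix (Fin n) (Fin d) ℝ)

/-- Pass `j` fills the entry `d - (j + 1)`, so the table is built downwards; the recursion at `q`
refers only to `q + 1` and `q + D`, which are final by then. The cells from `d` on must be zero
beforehand and supply the boundary values, also when `q + D` exceeds `d`. -/
theorem den_valueTable {s : State} (hd : s.nat 1 = d) (hD : 1 ≤ s.nat 3)
    (hV : ∀ q, d ≤ q → s.realArr 6 q = 0) :
    IsValueFunction (s.realArr 5) (s.real 0) (s.nat 3) d ((valueTable.den X s).realArr 6) ∧
    ∀ q < d, (valueTable.den X s).natArr 1 q =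
      if (valueTable.den X s).realArr 6 (q + 1) <
        s.realArr 5 q + (valueTable.den X s).realArr 6 (q + s.nat 3) - s.real 0 then 1 else 0 := by
  rw [valueTable, den, hd]
  set p := block _ with hp
  have h1 : ∀ j, (iter (p.den X) 13 s j).nat 1 = d := fun j => by
    rw [iter_nat X (b := 1) (by decide), hd]
  have h3 : ∀ j, (iter (p.den X) 13 s j).nat 3 = s.nat 3 := fun j =>
    iter_nat X (b := 1) (by decide)
  have h0 : ∀ j, (iter (p.den X) 13 s j).real 0 = s.real 0 := fun j => iter_real X (by decide)
  have h5 : ∀ j, (iter (p.den X) 13 s j).realArr 5 = s.realArr 5 := fun j =>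
    iter_realArr X (by decide)
  have hi := iter_counter (p.den X) 13 s
  have key : ∀ j ≤ d, (∀ q, d ≤ q → (iter (p.den X) 13 s j).realArr 6 q = 0) ∧
      ∀ q < d, d - j ≤ q →
        (iter (p.den X) 13 s j).realArr 6 q = max ((iter (p.den X) 13 s j).realArr 6 (q + 1))
          (s.realArr 5 q + (iter (p.den X) 13 s j).realArr 6 (q + s.nat 3) - s.real 0) ∧
        (iter (p.den X) 13 s j).natArr 1 q =
          if (iter (p.den X) 13 s j).realArr 6 (q + 1) <
            s.realArr 5 q + (iter (p.den X) 13 s j).realArr 6 (q + s.nat 3) - s.real 0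
          then 1 else 0 := by
    intro j
    induction j with
    | zero =>
      exact fun _ => ⟨fun q hq => by simpa [iter] using hV q hq, fun q hq hq' => by omega⟩
    | succ j ih =>
      intro hj
      obtain ⟨ih1, ih2⟩ := ih (by omega)
      have e1 := h1 j
      have e3 := h3 j
      have e0 := h0 j
      have e5 := h5 j
      have ei := hi j
      rw [iter]
      generalize iter (p.den X) 13 s j = u at *
      have hstep : (p.den X u).realArr 6 = Function.update (u.realArr 6) (d - (j + 1))
            (max (u.realArr 6 (d - (j + 1) + 1))
              (s.realArr 5 (d - (j + 1)) + u.realArr 6 (d - (j + 1) + s.nat 3) - s.real 0)) ∧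
          (p.den X u).natArr 1 = Function.update (u.natArr 1) (d - (j + 1))
            (if u.realArr 6 (d - (j + 1) + 1) <
              s.realArr 5 (d - (j + 1)) + u.realArr 6 (d - (j + 1) + s.nat 3) - s.real 0
              then 1 else 0) := by
        simp only [hp, block, instrs, den, Instr.run, Test.holds, ArithOp.eval]
        simp [e1, e3, e0, e5, ei]
        split_ifs with hlt
        · simp [writeCell, max_eq_right hlt.le]
        · simp [writeCell, max_eq_left (not_lt.1 hlt)]
      obtain ⟨hs1, hs2⟩ := hstep
      dsimp only
      rw [hs1, hs2]
      constructor
      · intro q hq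
        rw [Function.update_of_ne (by omega), ih1 q hq]
      · intro q hq hq'
        rw [Function.update_of_ne (a := q + 1) (by omega),
          Function.update_of_ne (a := q + s.nat 3) (by omega)]
        rcases eq_or_ne q (d - (j + 1)) with rfl | hne
        · simp only [Function.update_self]
          exact ⟨trivial, trivial⟩
        · rw [Function.update_of_ne hne, Function.update_of_ne hne]
          exact ih2 q hq (by omega)
  obtain ⟨k1, k2⟩ := key d le_rfl
  exact ⟨⟨k1, fun q hq => (k2 q hq (by omega)).1⟩, fun q hq => (k2 q hq (by omega)).2⟩

/-- The decisions are replayed upwards, with `Traced` as the loop invariant; `nat[18]` is the first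
index that the gap condition still admits. -/
theorem den_traceBack {s : State} {w : ℕ → ℝ} {lam : ℝ} {D : ℕ} {V : ℕ → ℝ} (hd : s.nat 1 = d)
    (hD : s.nat 3 = D) (hD1 : 1 ≤ D) (hV : IsValueFunction w lam D d V)
    (hch : ∀ q < d, s.natArr 1 q = if V (q + 1) < w q + V (q + D) - lam then 1 else 0) :
    OptimalSeq w lam D d ((traceBack.den X s).nat 19) ((traceBack.den X s).natArr 2) := by
  set s₀ := (instrs [.setNat 19 0, .setNat 18 0]).den X s with hs₀
  have e : traceBack.den X s = iter (traceBody.den X) 13 s₀ d := by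
    simp [traceBack, block, den, ← hs₀, ← hd]
    simp [hs₀, instrs, den, Instr.run]
  rw [e]
  set p := traceBody with hp
  have h1 : ∀ j, (iter (p.den X) 13 s₀ j).nat 3 = D := fun j => by
    rw [iter_nat X (b := 1) (by decide), hs₀, den_nat X (by decide), hD]
  have h2 : ∀ j, (iter (p.den X) 13 s₀ j).natArr 1 = s.natArr 1 := fun j => by
    rw [iter_natArr X (by decide), hs₀, den_natArr X (by decide)]
  have hi := iter_counter (p.den X) 13 s₀
  have key : ∀ j ≤ d, Traced w lam D V j ((iter (p.den X) 13 s₀ j).nat 18)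
      ((iter (p.den X) 13 s₀ j).nat 19) ((iter (p.den X) 13 s₀ j).natArr 2) := by
    intro j
    induction j with
    | zero =>
      intro _
      have e1 : (iter (p.den X) 13 s₀ 0).nat 18 = 0 := by simp [iter, hs₀, instrs, den, Instr.run]
      have e2 : (iter (p.den X) 13 s₀ 0).nat 19 = 0 := by simp [iter, hs₀, instrs, den, Instr.run]
      rw [e1, e2]
      exact ⟨by simp, by simp, by simp, by simp [gain]⟩
    | succ j ih =>
      intro hj
      have hT := ih (by omega)
      have e1 := h1 j
      have e2 := h2 j
      have ei := hi j
      rw [iter]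
      generalize iter (p.den X) 13 s₀ j = u at *
      have hc := hch j (by omega)
      simp only [hp, traceBody, block, instrs, den, Instr.run, Test.holds]
      by_cases hn : u.nat 18 ≤ j
      · by_cases hlt : V (j + 1) < w j + V (j + D) - lam
        · simpa [hn, hlt, e1, e2, ei, hc, writeCell] using hT.take hV hD1 (by omega) hn hlt
        · simpa [hn, hlt, e1, e2, ei, hc, writeCell] using hT.skip hV (by omega) fun _ => hlt
      · simpa [hn, ei] using hT.skip hV (by omega) fun h => absurd h hn
  exact (key d le_rfl).optimalSeq hV hD1

/-- Compute a separated sequence of maximal gain at the price `real[0]`. -/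
def solve : Code := block [valueTable, traceBack]

/-- The zeros of `realArr[6]` beyond `d` are returned because the next call needs them. -/
theorem den_solve {s : State} (hd : s.nat 1 = d) (hD : 1 ≤ s.nat 3)
    (hV : ∀ q, d ≤ q → s.realArr 6 q = 0) :
    (∀ q, d ≤ q → (solve.den X s).realArr 6 q = 0) ∧
      OptimalSeq (s.realArr 5) (s.real 0) (s.nat 3) d ((solve.den X s).nat 19)
        ((solve.den X s).natArr 2) := by
  obtain ⟨h1, h2⟩ := den_valueTable X hd hD hV
  simp only [solve, block, den]
  refine ⟨fun q hq => ?_, den_traceBack X ?_ ?_ hD h1 h2⟩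
  · rw [den_realArr X (by decide), h1.1 q hq]
  · rw [den_nat X (by decide), hd]
  · rw [den_nat X (by decide)]

/-- Copy the result of `solve` to `natArr[a]`, and its length to `nat[r]`. -/
def copyList (a r : ℕ) : Code :=
  block [
    .rep 13 1 (instrs [.loadNat 15 2 13, .storeNat a 13 15]),
    instrs [.setNat 15 0, .addNat r 19 15]]

theorem den_copyList {s : State} {w : ℕ → ℝ} {lam : ℝ} {D a r : ℕ} (ha : a ≠ 2)
    (hd : s.nat 1 = d) (hD : 1 ≤ D) (h : OptimalSeq w lam D d (s.nat 19) (s.natArr 2)) :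
    ((copyList a r).den X s).nat r = s.nat 19 ∧
      OptimalSeq w lam D d (s.nat 19) (((copyList a r).den X s).natArr a) := by
  set p := instrs [.loadNat 15 2 13, .storeNat a 13 15] with hp
  have e : (copyList a r).den X s =
      (instrs [.setNat 15 0, .addNat r 19 15]).den X (iter (p.den X) 13 s d) := by
    simp [copyList, block, den, ← hp, hd]
  rw [e]
  have h1 : ∀ j, (iter (p.den X) 13 s j).natArr 2 = s.natArr 2 := fun j =>
    iter_natArr X (by simp [hp, instrs, natArrWrites, ha.symm])
  have h2 : ∀ j, (iter (p.den X) 13 s j).nat 19 = s.nat 19 := fun j =>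
    iter_nat X (b := 1) (by simp [hp, instrs, natWrites])
  have hi := iter_counter (p.den X) 13 s
  have key : ∀ j, ∀ q < j, (iter (p.den X) 13 s j).natArr a q = s.natArr 2 q := by
    intro j
    induction j with
    | zero => simp
    | succ j ih =>
      intro q hq
      have e1 := h1 j
      have ei := hi j
      rw [iter]
      generalize iter (p.den X) 13 s j = u at *
      simp only [hp, instrs, den, Instr.run]
      rcases eq_or_ne q j with rfl | hne
      · simp [writeCell, ei, e1]
      · simpa [writeCell, ei, Function.update_of_ne hne] using ih q (by omega)
  refine ⟨by simp [instrs, den, Instr.run, h2], h.congr fun j hj => ?_⟩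
  -- Copying `d` cells is enough, since a separated sequence has at most `d` terms.
  have := h.1.length_le hD
  simpa [instrs, den, Instr.run] using key d j (by omega)

/-! ### Bisection on the price -/

/-- The prices `real[1] < real[2]` bracket the price of the sequences of length `k`, and optimal
sequences for both prices are stored. -/
structure Bracketed (w : ℕ → ℝ) (D d k : ℕ) (g : ℝ) (s : State) : Prop where
  lower : OptimalSeq w (s.real 1) D d (s.nat 20) (s.natArr 4)
  upper : OptimalSeq w (s.real 2) D d (s.nat 23) (s.natArr 3)
  le : k ≤ s.nat 20
  ge : s.nat 23 ≤ k
  gap : s.real 2 - s.real 1 = g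
  zero : ∀ q, d ≤ q → s.realArr 6 q = 0

/-- Initialise the bracket by twice the total weight `real[10]`. -/
def bracketInit : Code :=
  block [
    instrs [.setReal 3 0],
    .ite (.leReal 10 3) (instrs [.setReal 10 1]) .skip,
    instrs [.arith .add 2 10 10, .arith .sub 1 3 2, .arith .add 0 1 3, .setNat 23 0],
    solve,
    copyList 4 20]

/-- The prices are `2 W` and `-2 W`. At the upper one the empty sequence is optimal, so only its
length has to be stored. The lower one must lie strictly below `-W`, which is why a zero total
weight is replaced by `1`. -/
theorem den_bracketInit {s : State} {k : ℕ} (hd : s.nat 1 = d) (hD : 1 ≤ s.nat 3)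
    (hV : ∀ q, d ≤ q → s.realArr 6 q = 0) (hw : ∀ q < d, 0 ≤ s.realArr 5 q)
    (hW : s.real 10 = ∑ q ∈ Finset.range d, s.realArr 5 q)
    (hO : ∃ O, GapSeq (s.nat 3) d k O) :
    Bracketed (s.realArr 5) (s.nat 3) d k (4 * if s.real 10 ≤ 0 then 1 else s.real 10)
      (bracketInit.den X s) := by
  set s₁ := (block [instrs [.setReal 3 0],
    .ite (.leReal 10 3) (instrs [.setReal 10 1]) .skip,
    instrs [.arith .add 2 10 10, .arith .sub 1 3 2, .arith .add 0 1 3, .setNat 23 0]]).den X s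
    with hs₁
  have e : bracketInit.den X s = (copyList 4 20).den X (solve.den X s₁) := by
    simp only [bracketInit, block, den, hs₁]
  set W := if s.real 10 ≤ 0 then 1 else s.real 10 with hWdef
  have hW1 : s.real 10 ≤ W ∧ 0 < W := by
    rw [hWdef]
    split_ifs with h
    · exact ⟨by linarith, one_pos⟩
    · exact ⟨le_rfl, not_le.1 h⟩
  have r2 : s₁.real 2 = 2 * W ∧ s₁.real 1 = -(2 * W) ∧ s₁.real 0 = -(2 * W) := by
    simp only [hs₁, block, instrs, den, Instr.run, Test.holds, ArithOp.eval]
    simp only [hWdef]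
    by_cases h : s.real 10 ≤ 0
    · simp [h]; norm_num
    · simp [h]; constructor <;> ring
  obtain ⟨r2, r1, r0⟩ := r2
  have n1 : s₁.nat 1 = d := by rw [hs₁, den_nat X (by decide), hd]
  have n3 : s₁.nat 3 = s.nat 3 := by rw [hs₁, den_nat X (by decide)]
  have n23 : s₁.nat 23 = 0 := by simp [hs₁, block, instrs, den, Instr.run]
  have a6 : s₁.realArr 6 = s.realArr 6 := by rw [hs₁, den_realArr X (by decide)]
  have a5 : s₁.realArr 5 = s.realArr 5 := by rw [hs₁, den_realArr X (by decide)]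
  obtain ⟨z, opt⟩ := den_solve X (s := s₁) n1 (by rw [n3]; exact hD) (by rw [a6]; exact hV)
  rw [a5, r0, n3] at opt
  set s₂ := solve.den X s₁ with hs₂
  have n1' : s₂.nat 1 = d := by rw [hs₂, den_nat X (by decide), n1]
  obtain ⟨c1, c2⟩ := den_copyList X (a := 4) (r := 20) (by decide) n1' hD opt
  rw [← c1] at c2
  rw [e]
  have f1 : ((copyList 4 20).den X s₂).real 1 = -(2 * W) := by
    rw [den_real X (by decide), hs₂, den_real X (by decide), r1]
  have f2 : ((copyList 4 20).den X s₂).real 2 = 2 * W := by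
    rw [den_real X (by decide), hs₂, den_real X (by decide), r2]
  have f23 : ((copyList 4 20).den X s₂).nat 23 = 0 := by
    rw [den_nat X (by decide), hs₂, den_nat X (by decide), n23]
  have f6 : ((copyList 4 20).den X s₂).realArr 6 = s₂.realArr 6 := by
    rw [den_realArr X (by decide)]
  have hsum : ∀ c A, GapSeq (s.nat 3) d c A →
      ∑ j ∈ Finset.range c, s.realArr 5 (A j) ≤ W := fun c A hA =>
    (hA.sum_le hD hw).trans (hW ▸ hW1.1)
  obtain ⟨O, hO⟩ := hO
  refine ⟨by rw [f1]; exact c2, ?_, ?_, by simp [f23], by rw [f1, f2]; ring, fun q hq => by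
    rw [f6, z q hq]⟩
  · rw [f2, f23]
    exact optimalSeq_zero hW1.2.le hsum (by linarith)
  · exact c2.le_length_of_small hw hO hW1.2.le hsum (by linarith)

/-- Halve the bracket. -/
def bisectBody : Code :=
  block [
    instrs [.arith .add 0 1 2, .setReal 3 2, .arith .div 0 0 3],
    solve,
    -- Registers are copied by adding a zero; `solve` has overwritten `real[3]`, so the zero is
    -- restored here.
    instrs [.setReal 3 0],
    .ite (.leNat 2 19)
      (block [copyList 4 20, instrs [.arith .add 1 0 3]])
      (block [copyList 3 23, instrs [.arith .add 2 0 3]])]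

/-- The optimal sequence for the midpoint replaces the end of the bracket that its length allows.
Monotonicity of the length in the price is not needed. -/
theorem den_bisectBody {s : State} {w : ℕ → ℝ} {k : ℕ} {g : ℝ} (hd : s.nat 1 = d)
    (hk : s.nat 2 = k) (hD : 1 ≤ s.nat 3) (hw : s.realArr 5 = w)
    (h : Bracketed w (s.nat 3) d k g s) :
    Bracketed w (s.nat 3) d k (g / 2) (bisectBody.den X s) := by
  set s₁ := (instrs [.arith .add 0 1 2, .setReal 3 2, .arith .div 0 0 3]).den X s with hs₁
  have r0 : s₁.real 0 = (s.real 1 + s.real 2) / 2 := by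
    simp [hs₁, instrs, den, Instr.run, ArithOp.eval]
  have n1 : s₁.nat 1 = d := by rw [hs₁, den_nat X (by decide), hd]
  have n3 : s₁.nat 3 = s.nat 3 := by rw [hs₁, den_nat X (by decide)]
  have a6 : s₁.realArr 6 = s.realArr 6 := by rw [hs₁, den_realArr X (by decide)]
  have a5 : s₁.realArr 5 = w := by rw [hs₁, den_realArr X (by decide), hw]
  obtain ⟨z, opt⟩ := den_solve X (s := s₁) n1 (by rw [n3]; exact hD) (by rw [a6]; exact h.zero)
  rw [a5, r0, n3] at opt
  set s₂ := (instrs [.setReal 3 0]).den X (solve.den X s₁) with hs₂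
  have e : bisectBody.den X s =
      (Code.ite (.leNat 2 19) (block [copyList 4 20, instrs [.arith .add 1 0 3]])
        (block [copyList 3 23, instrs [.arith .add 2 0 3]])).den X s₂ := by
    simp only [bisectBody, block, den, hs₁, hs₂]
  have m1 : s₂.nat 1 = d := by
    rw [hs₂, den_nat X (by decide), den_nat X (by decide), n1]
  have m2 : s₂.nat 2 = k := by
    rw [hs₂, den_nat X (by decide), den_nat X (by decide), hs₁, den_nat X (by decide), hk]
  have m19 : s₂.nat 19 = (solve.den X s₁).nat 19 := by rw [hs₂, den_nat X (by decide)]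
  have m20 : s₂.nat 20 = s.nat 20 := by
    rw [hs₂, den_nat X (by decide), den_nat X (by decide), hs₁, den_nat X (by decide)]
  have m23 : s₂.nat 23 = s.nat 23 := by
    rw [hs₂, den_nat X (by decide), den_nat X (by decide), hs₁, den_nat X (by decide)]
  have l2 : s₂.natArr 2 = (solve.den X s₁).natArr 2 := by rw [hs₂, den_natArr X (by decide)]
  have l3 : s₂.natArr 3 = s.natArr 3 := by
    rw [hs₂, den_natArr X (by decide), den_natArr X (by decide), hs₁, den_natArr X (by decide)]
  have l4 : s₂.natArr 4 = s.natArr 4 := by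
    rw [hs₂, den_natArr X (by decide), den_natArr X (by decide), hs₁, den_natArr X (by decide)]
  have t0 : s₂.real 0 = (s.real 1 + s.real 2) / 2 := by
    rw [hs₂, den_real X (by decide), den_real X (by decide), r0]
  have t1 : s₂.real 1 = s.real 1 := by
    rw [hs₂, den_real X (by decide), den_real X (by decide), hs₁, den_real X (by decide)]
  have t2 : s₂.real 2 = s.real 2 := by
    rw [hs₂, den_real X (by decide), den_real X (by decide), hs₁, den_real X (by decide)]
  have t3 : s₂.real 3 = 0 := by simp [hs₂, instrs, den, Instr.run]
  have t6 : ∀ q, d ≤ q → s₂.realArr 6 q = 0 := by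
    rw [hs₂, den_realArr X (by decide)]
    exact z
  rw [← m19, ← l2] at opt
  have hgap := h.gap
  rw [e, den]
  split_ifs with hc
  · simp only [Test.holds, m2] at hc
    obtain ⟨c1, c2⟩ := den_copyList X (a := 4) (r := 20) (by decide) m1 hD opt
    simp only [block, den]
    set s₃ := (copyList 4 20).den X s₂ with hs₃
    have u1 : ((instrs [.arith .add 1 0 3]).den X s₃).real 1 = (s.real 1 + s.real 2) / 2 := by
      have v0 : s₃.real 0 = (s.real 1 + s.real 2) / 2 := by rw [hs₃, den_real X (by decide), t0]
      have v3 : s₃.real 3 = 0 := by rw [hs₃, den_real X (by decide), t3]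
      simp [instrs, den, Instr.run, ArithOp.eval, v0, v3]
    have u2 : ((instrs [.arith .add 1 0 3]).den X s₃).real 2 = s.real 2 := by
      rw [den_real X (by decide), hs₃, den_real X (by decide), t2]
    refine ⟨?_, ?_, ?_, ?_, ?_, ?_⟩
    · rw [u1, den_nat X (by decide), den_natArr X (by decide), c1]
      exact c2
    · rw [u2, den_nat X (by decide), den_natArr X (by decide), hs₃, den_nat X (by decide),
        den_natArr X (by decide), m23, l3]
      exact h.upper
    · rw [den_nat X (by decide), c1]
      exact hc
    · rw [den_nat X (by decide), hs₃, den_nat X (by decide), m23]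
      exact h.ge
    · rw [u1, u2]
      linarith
    · rw [den_realArr X (by decide), hs₃, den_realArr X (by decide)]
      exact t6
  · simp only [Test.holds, m2] at hc
    obtain ⟨c1, c2⟩ := den_copyList X (a := 3) (r := 23) (by decide) m1 hD opt
    simp only [block, den]
    set s₃ := (copyList 3 23).den X s₂ with hs₃
    have u1 : ((instrs [.arith .add 2 0 3]).den X s₃).real 2 = (s.real 1 + s.real 2) / 2 := by
      have v0 : s₃.real 0 = (s.real 1 + s.real 2) / 2 := by rw [hs₃, den_real X (by decide), t0]
      have v3 : s₃.real 3 = 0 := by rw [hs₃, den_real X (by decide), t3]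
      simp [instrs, den, Instr.run, ArithOp.eval, v0, v3]
    have u2 : ((instrs [.arith .add 2 0 3]).den X s₃).real 1 = s.real 1 := by
      rw [den_real X (by decide), hs₃, den_real X (by decide), t1]
    refine ⟨?_, ?_, ?_, ?_, ?_, ?_⟩
    · rw [u2, den_nat X (by decide), den_natArr X (by decide), hs₃, den_nat X (by decide),
        den_natArr X (by decide), m20, l4]
      exact h.lower
    · rw [u1, den_nat X (by decide), den_natArr X (by decide), c1]
      exact c2
    · rw [den_nat X (by decide), hs₃, den_nat X (by decide), m20]
      exact h.le
    · rw [den_nat X (by decide), c1]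
      omega
    · rw [u1, u2]
      linarith
    · rw [den_realArr X (by decide), hs₃, den_realArr X (by decide)]
      exact t6

/-! ### Splicing and the approximate projection -/

/-- Find the position at which the two stored sequences are spliced. -/
def spliceBody : Code :=
  .ite (.ltNat 22 23)
    (block [
      instrs [.addNat 15 22 21, .setNat 5 1],
      .ite (.leNat 5 15)
        (block [
          instrs [.subNat 15 15 5, .loadNat 15 4 15, .addNat 15 15 3, .loadNat 16 3 22],
          .ite (.ltNat 16 15) (instrs [.addNat 22 22 5]) .skip])
        .skip])
    .skip

/-- Linear search for an unblocked `m`. The last alternative says that the search has either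
advanced in every pass or come to rest; the middle one is what `GapSeq.splice` asks for. -/
theorem iter_spliceBody {s : State} {D a : ℕ} {A B : ℕ → ℕ} (hm : s.nat 22 = 0)
    (hD : s.nat 3 = D) (ha : s.nat 23 = a) (hA : s.natArr 3 = A) (hB : s.natArr 4 = B) (j : ℕ) :
    let m := (iter (spliceBody.den X) 13 s j).nat 22
    m ≤ a ∧ (m = 0 ∨ Blocked A B D a (s.nat 21) (m - 1)) ∧
      (m = j ∨ ¬ Blocked A B D a (s.nat 21) m) := by
  set p := spliceBody with hp
  have h3 : ∀ j, (iter (p.den X) 13 s j).nat 3 = D := fun j => by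
    rw [iter_nat X (b := 1) (by decide), hD]
  have h21 : ∀ j, (iter (p.den X) 13 s j).nat 21 = s.nat 21 := fun j => by
    rw [iter_nat X (b := 1) (by decide)]
  have h23 : ∀ j, (iter (p.den X) 13 s j).nat 23 = a := fun j => by
    rw [iter_nat X (b := 1) (by decide), ha]
  have hA' : ∀ j, (iter (p.den X) 13 s j).natArr 3 = A := fun j => by
    rw [iter_natArr X (by decide), hA]
  have hB' : ∀ j, (iter (p.den X) 13 s j).natArr 4 = B := fun j => by
    rw [iter_natArr X (by decide), hB]
  induction j with
  | zero => simp [iter, hm]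
  | succ j ih =>
    have e3 := h3 j
    have e21 := h21 j
    have e23 := h23 j
    have eA := hA' j
    have eB := hB' j
    rw [iter]
    generalize iter (p.den X) 13 s j = u at *
    have hstep : (p.den X u).nat 22 =
        if Blocked A B D a (s.nat 21) (u.nat 22) then u.nat 22 + 1 else u.nat 22 := by
      simp only [hp, spliceBody, block, instrs, den, Instr.run, Test.holds, Blocked]
      by_cases c1 : u.nat 22 < a
      · by_cases c2 : 1 ≤ u.nat 22 + s.nat 21
        · by_cases c3 : A (u.nat 22) < B (u.nat 22 + s.nat 21 - 1) + D
          · simp [c1, c2, c3, e3, e21, e23, eA, eB]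
          · simp [c1, c2, c3, e3, e21, e23, eA, eB]
        · simp [c1, c2, e21, e23]
      · simp [c1, e23]
    obtain ⟨i1, i2, i3⟩ := ih
    simp only [ne_eq, Nat.reduceEqDiff, not_false_eq_true,
      Function.update_of_ne, hstep]
    split_ifs with hb
    · rcases i3 with i3 | i3
      · exact ⟨hb.1, Or.inr (by simpa using hb), Or.inl (by omega)⟩
      · exact absurd hb i3
    · exact ⟨i1, i2, Or.inr hb⟩

theorem iter_bisectBody {s : State} {w : ℕ → ℝ} {k : ℕ} {g : ℝ} (hd : s.nat 1 = d)
    (hk : s.nat 2 = k) (hD : 1 ≤ s.nat 3) (hw : s.realArr 5 = w)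
    (h : Bracketed w (s.nat 3) d k g s) (j : ℕ) :
    Bracketed w (s.nat 3) d k (g / 2 ^ j) (iter (bisectBody.den X) 12 s j) := by
  induction j with
  | zero =>
    rw [pow_zero, div_one]
    exact ⟨by simpa [iter] using h.lower, by simpa [iter] using h.upper,
      by simpa [iter] using h.le, by simpa [iter] using h.ge, h.gap, h.zero⟩
  | succ j ih =>
    have e3 : (iter (bisectBody.den X) 12 s j).nat 3 = s.nat 3 :=
      iter_nat X (b := 7) (by decide)
    rw [← e3] at ih
    have := den_bisectBody X (by rw [iter_nat X (b := 7) (by decide), hd])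
      (by rw [iter_nat X (b := 7) (by decide), hk]) (by rw [e3]; exact hD)
      (by rw [iter_realArr X (by decide), hw]) ih
    rw [e3, div_div, ← pow_succ] at this
    exact ⟨by simpa [iter] using this.lower, by simpa [iter] using this.upper,
      by simpa [iter] using this.le, by simpa [iter] using this.ge, this.gap, this.zero⟩

/-- Set `realArr[1]` to zero. -/
def clear : Code := .rep 13 1 (instrs [.setReal 3 0, .storeReal 1 13 3])

theorem den_clear {s : State} (hd : s.nat 1 = d) (q : ℕ) (hq : q < d) :
    (clear.den X s).realArr 1 q = 0 := by
  rw [clear, den, hd]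
  set p := instrs [.setReal 3 0, .storeReal 1 13 3] with hp
  have key : ∀ j, ∀ q < j, (iter (p.den X) 13 s j).realArr 1 q = 0 := by
    intro j
    induction j with
    | zero => simp
    | succ j ih =>
      intro q hq
      have ei := iter_counter (p.den X) 13 s j
      rw [iter]
      generalize iter (p.den X) 13 s j = u at *
      simp only [hp, instrs, den, Instr.run]
      rcases eq_or_ne q j with rfl | hne
      · simp [writeCell, ei]
      · simpa [writeCell, ei, Function.update_of_ne hne] using ih q (by omega)
  exact key d q hq

/-- Copy one entry of `realArr[4]`, selected by the spliced sequence, to `realArr[1]`. -/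
def selectBody : Code :=
  .ite (.ltNat 13 2)
    (block [
      .ite (.ltNat 13 22)
        (instrs [.loadNat 15 3 13])
        (instrs [.addNat 15 13 21, .loadNat 15 4 15]),
      instrs [.loadReal 3 4 15, .storeReal 1 15 3]])
    .skip

open Classical in
theorem iter_selectBody {s : State} (h1 : ∀ q < d, s.realArr 1 q = 0) (j : ℕ) :
    ∀ q < d, (iter (selectBody.den X) 13 s j).realArr 1 q =
      if ∃ l < min j (s.nat 2), splice (s.natArr 3) (s.natArr 4) (s.nat 22) (s.nat 21) l = q
      then s.realArr 4 q else 0 := by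
  set p := selectBody with hp
  induction j with
  | zero => simpa [iter] using h1
  | succ j ih =>
    have e2 : (iter (p.den X) 13 s j).nat 2 = s.nat 2 := iter_nat X (b := 1) (by decide)
    have e21 : (iter (p.den X) 13 s j).nat 21 = s.nat 21 := iter_nat X (b := 1) (by decide)
    have e22 : (iter (p.den X) 13 s j).nat 22 = s.nat 22 := iter_nat X (b := 1) (by decide)
    have eA : (iter (p.den X) 13 s j).natArr 3 = s.natArr 3 := iter_natArr X (by decide)
    have eB : (iter (p.den X) 13 s j).natArr 4 = s.natArr 4 := iter_natArr X (by decide)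
    have ez : (iter (p.den X) 13 s j).realArr 4 = s.realArr 4 := iter_realArr X (by decide)
    have ei := iter_counter (p.den X) 13 s j
    intro q hq
    have ihq := ih q hq
    rw [iter]
    generalize iter (p.den X) 13 s j = u at *
    dsimp only
    by_cases hjk : j < s.nat 2
    · have hstep : (p.den X u).realArr 1 =
          Function.update (u.realArr 1) (splice (s.natArr 3) (s.natArr 4) (s.nat 22) (s.nat 21) j)
            (s.realArr 4 (splice (s.natArr 3) (s.natArr 4) (s.nat 22) (s.nat 21) j)) := by
        simp only [hp, selectBody, block, instrs, den, Instr.run, Test.holds, splice]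
        by_cases c : j < s.nat 22
        · simp [hjk, c, e2, e22, eA, ez, ei, writeCell]
        · simp [hjk, c, e2, e21, e22, eB, ez, ei, writeCell]
      rw [hstep]
      rcases eq_or_ne q (splice (s.natArr 3) (s.natArr 4) (s.nat 22) (s.nat 21) j) with h | h
      · rw [← h, Function.update_self, if_pos ⟨j, by omega, h.symm⟩]
      · rw [Function.update_of_ne h, ihq]
        congr 1
        refine propext ⟨fun ⟨l, hl, hl'⟩ => ⟨l, by omega, hl'⟩, fun ⟨l, hl, hl'⟩ => ⟨l, ?_, hl'⟩⟩
        have : l ≠ j := fun hlj => h (hlj ▸ hl'.symm)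
        omega
    · have hstep : (p.den X u).realArr 1 = u.realArr 1 := by
        simp only [hp, selectBody, den, Test.holds, e2, ei, if_neg hjk]
      rw [hstep, ihq, min_eq_right (by omega), min_eq_right (by omega)]

/-- Write the approximate projection of `realArr[4]` to `realArr[1]`; the weights of the indices are
`realArr[5]`. -/
def project : Code :=
  block [
    bracketInit,
    .rep 12 7 bisectBody,
    instrs [.subNat 21 20 2, .setNat 22 0],
    .rep 13 1 spliceBody,
    clear,
    .rep 13 1 selectBody]

open Classical in
theorem den_project {s : State} {k : ℕ} (hd : s.nat 1 = d) (hk : s.nat 2 = k)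
    (hD : 1 ≤ s.nat 3) (hV : ∀ q, d ≤ q → s.realArr 6 q = 0) (hw : ∀ q < d, 0 ≤ s.realArr 5 q)
    (hW : s.real 10 = ∑ q ∈ Finset.range d, s.realArr 5 q)
    (hO : ∃ O, GapSeq (s.nat 3) d k O) :
    (∀ q, d ≤ q → (project.den X s).realArr 6 q = 0) ∧
    ∃ A, GapSeq (s.nat 3) d k A ∧
      (∀ q < d, (project.den X s).realArr 1 q = if ∃ l < k, A l = q then s.realArr 4 q else 0) ∧
      ∀ O, GapSeq (s.nat 3) d k O → ∑ j ∈ Finset.range k, s.realArr 5 (O j) ≤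
        ∑ j ∈ Finset.range k, s.realArr 5 (A j) + 4 * s.real 10 / 2 ^ s.nat 7 * d := by
  have hkd : k ≤ d := hO.choose_spec.length_le hD
  have b1 := den_bracketInit X hd hD hV hw hW hO
  set s₁ := bracketInit.den X s with hs₁
  have n1 : s₁.nat 1 = d := by rw [hs₁, den_nat X (by decide), hd]
  have n2 : s₁.nat 2 = k := by rw [hs₁, den_nat X (by decide), hk]
  have n3 : s₁.nat 3 = s.nat 3 := by rw [hs₁, den_nat X (by decide)]
  have n7 : s₁.nat 7 = s.nat 7 := by rw [hs₁, den_nat X (by decide)]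
  have a4 : s₁.realArr 4 = s.realArr 4 := by rw [hs₁, den_realArr X (by decide)]
  have a5 : s₁.realArr 5 = s.realArr 5 := by rw [hs₁, den_realArr X (by decide)]
  rw [← n3] at b1
  have b2 := iter_bisectBody X n1 n2 (n3 ▸ hD) a5 b1 (s.nat 7)
  set W := if s.real 10 ≤ 0 then 1 else s.real 10 with hWdef
  set s₂ := iter (bisectBody.den X) 12 s₁ (s.nat 7) with hs₂
  have m1 : s₂.nat 1 = d := by rw [hs₂, iter_nat X (b := 7) (by decide), n1]
  have m2 : s₂.nat 2 = k := by rw [hs₂, iter_nat X (b := 7) (by decide), n2]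
  have m3 : s₂.nat 3 = s.nat 3 := by rw [hs₂, iter_nat X (b := 7) (by decide), n3]
  have c4 : s₂.realArr 4 = s.realArr 4 := by rw [hs₂, iter_realArr X (by decide), a4]
  rw [n3] at b2
  set s₃ := (instrs [.subNat 21 20 2, .setNat 22 0]).den X s₂ with hs₃
  have l1 : s₃.nat 1 = d := by rw [hs₃, den_nat X (by decide), m1]
  have l2 : s₃.nat 2 = k := by rw [hs₃, den_nat X (by decide), m2]
  have l3 : s₃.nat 3 = s.nat 3 := by rw [hs₃, den_nat X (by decide), m3]
  have l23 : s₃.nat 23 = s₂.nat 23 := by rw [hs₃, den_nat X (by decide)]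
  have l21 : s₃.nat 21 = s₂.nat 20 - k := by simp [hs₃, instrs, den, Instr.run, m2]
  have l22 : s₃.nat 22 = 0 := by simp [hs₃, instrs, den, Instr.run]
  have lA : s₃.natArr 3 = s₂.natArr 3 := by rw [hs₃, den_natArr X (by decide)]
  have lB : s₃.natArr 4 = s₂.natArr 4 := by rw [hs₃, den_natArr X (by decide)]
  obtain ⟨k1, k2, k3⟩ := iter_spliceBody X (s := s₃) l22 l3 l23 lA lB d
  set s₄ := iter (spliceBody.den X) 13 s₃ d with hs₄
  set m := s₄.nat 22 with hm
  rw [l21] at k2 k3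
  -- If the search never came to rest then `m = d`, but a blocked `m` satisfies `m < a ≤ k ≤ d`.
  have hfree : ¬ Blocked (s₂.natArr 3) (s₂.natArr 4) (s.nat 3) (s₂.nat 23) (s₂.nat 20 - k) m := by
    rcases k3 with k3 | k3
    · intro hb
      have := hb.1
      have := b2.ge
      omega
    · exact k3
  set A := splice (s₂.natArr 3) (s₂.natArr 4) m (s₂.nat 20 - k) with hA
  have hgap : GapSeq (s.nat 3) d k A := b2.upper.1.splice b2.lower.1 b2.le k1 k2
  have i1 : s₄.nat 1 = d := by rw [hs₄, iter_nat X (b := 1) (by decide), l1]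
  set s₅ := clear.den X s₄ with hs₅
  have j1 : s₅.nat 1 = d := by rw [hs₅, den_nat X (by decide), i1]
  have e : project.den X s = iter (selectBody.den X) 13 s₅ d := by
    have e1 : (Code.rep 12 7 bisectBody).den X s₁ = s₂ := by rw [den, n7]
    have e2 : (Code.rep 13 1 spliceBody).den X s₃ = s₄ := by rw [den, l1]
    have e3 : (Code.rep 13 1 selectBody).den X s₅ = iter (selectBody.den X) 13 s₅ d := by
      rw [den, j1]
    simp only [project, block]
    rw [den, den, den, den, den, ← hs₁, e1, ← hs₃, e2, ← hs₅, e3]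
  refine ⟨fun q hq => ?_, A, hgap, fun q hq => ?_, fun O hO' => ?_⟩
  · rw [e, iter_realArr X (by decide), hs₅, den_realArr X (by decide), hs₄,
      iter_realArr X (by decide), hs₃, den_realArr X (by decide), b2.zero q hq]
  · have j2 : s₅.nat 2 = k := by
      rw [hs₅, den_nat X (by decide), hs₄, iter_nat X (b := 1) (by decide), l2]
    have j21 : s₅.nat 21 = s₂.nat 20 - k := by
      rw [hs₅, den_nat X (by decide), hs₄, iter_nat X (b := 1) (by decide), l21]
    have j22 : s₅.nat 22 = m := by rw [hs₅, den_nat X (by decide)]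
    have jA : s₅.natArr 3 = s₂.natArr 3 := by
      rw [hs₅, den_natArr X (by decide), hs₄, iter_natArr X (by decide), lA]
    have jB : s₅.natArr 4 = s₂.natArr 4 := by
      rw [hs₅, den_natArr X (by decide), hs₄, iter_natArr X (by decide), lB]
    have jz : s₅.realArr 4 = s.realArr 4 := by
      rw [hs₅, den_realArr X (by decide), hs₄, iter_realArr X (by decide), hs₃,
        den_realArr X (by decide), c4]
    have := iter_selectBody X (s := s₅) (fun q hq => den_clear X i1 q hq) d q hq
    rw [e, this, j2, j21, j22, jA, jB, jz, min_eq_right hkd]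
  · have h1 := sum_le_sum_splice b2.upper b2.lower b2.ge b2.le k1 hfree hO'
    rw [b2.gap] at h1
    have hb : ((s₂.nat 20 : ℕ) : ℝ) ≤ d := by exact_mod_cast b2.lower.1.length_le hD
    have hk0 : (0 : ℝ) ≤ k := Nat.cast_nonneg k
    have hW0 : 0 ≤ s.real 10 := by
      rw [hW]
      exact Finset.sum_nonneg fun q hq => hw q (by simpa using hq)
    -- For total weight zero the bracket was started from `1` and its gap is not bounded by the
    -- claimed error; but then all weights vanish and both sums are zero.
    rcases hW0.eq_or_lt with h0 | h0
    · have hz : ∀ q < d, s.realArr 5 q = 0 := by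
        intro q hq
        rw [← h0] at hW
        exact (Finset.sum_eq_zero_iff_of_nonneg fun q hq => hw q (by simpa using hq)).1 hW.symm q
          (by simpa using hq)
      rw [Finset.sum_eq_zero fun j hj => hz _ (hO'.1 j (by simpa using hj)),
        Finset.sum_eq_zero fun j hj => hz _ (hgap.1 j (by simpa using hj)), ← h0]
      simp
    · rw [hWdef, if_neg (not_le.2 h0)] at h1
      refine h1.trans ?_
      gcongr
      linarith

end Code

/-- The vector in the first `m` cells of an array. -/
noncomputable def vec (m : ℕ) (f : ℕ → ℝ) : EuclideanSpace ℝ (Fin m) := WithLp.toLp 2 (readVec m f)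

@[simp] theorem vec_apply (m : ℕ) (f : ℕ → ℝ) (i : Fin m) : vec m f i = f i := rfl

namespace Code

variable {n d : ℕ} (X : Matrix (Fin n) (Fin d) ℝ)

theorem den_mulX (a b : ℕ) (s : State) :
    vec n (((Code.basic (.mulX a b)).den X s).realArr a) = mulVecE X (vec d (s.realArr b)) := by
  ext i
  simp [den, Instr.run, readVec, writeVec, mulVecE, vec]

theorem den_mulXT (a b : ℕ) (s : State) :
    vec d (((Code.basic (.mulXT a b)).den X s).realArr a) =
      mulVecE X.transpose (vec n (s.realArr b)) := by
  ext i
  simp [den, Instr.run, readVec, writeVec, mulVecE, vec]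

/-! ### The gradient step -/

/-- Compute the number of terms of a separated sequence that fit into `[0, nat[13]]`. -/
def countBody : Code :=
  block [
    .ite (.ltNat 13 3)
      (instrs [.setNat 15 1])
      (instrs [.subNat 16 13 3, .loadNat 15 0 16, .setNat 5 1, .addNat 15 15 5]),
    instrs [.storeNat 0 13 15]]

/-- Natural numbers cannot be divided on the machine; the quotient is tabulated through `q / D = (q
- D) / D + 1`. -/
theorem iter_countBody {s : State} {D : ℕ} (hD : s.nat 3 = D) (hD1 : 1 ≤ D) (j : ℕ) :
    ∀ q < j, (iter (countBody.den X) 13 s j).natArr 0 q = q / D + 1 := by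
  induction j with
  | zero => simp
  | succ j ih =>
    have e3 : (iter (countBody.den X) 13 s j).nat 3 = D := by
      rw [iter_nat X (b := 1) (by decide), hD]
    have ei := iter_counter (countBody.den X) 13 s j
    intro q hq
    rw [iter]
    generalize iter (countBody.den X) 13 s j = u at *
    have hstep : (countBody.den X u).natArr 0 = Function.update (u.natArr 0) j (j / D + 1) := by
      simp only [countBody, block, instrs, den, Instr.run, Test.holds]
      by_cases c : j < D
      · simp [c, e3, ei, writeCell, Nat.div_eq_of_lt c]
      · have := ih (j - D) (by omega)
        have h2 : j / D = (j - D) / D + 1 := Nat.div_eq_sub_div (by omega) (by omega)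
        simp [c, e3, ei, writeCell, this, h2]
    dsimp only
    rw [hstep]
    rcases eq_or_ne q j with rfl | hne
    · simp
    · rw [Function.update_of_ne hne, ih q (by omega)]

/-- Subtract `realArr[2]` from the observations. -/
def residualBody : Code :=
  instrs [.loadReal 3 0 13, .loadReal 4 2 13, .arith .sub 3 3 4, .storeReal 2 13 3]

theorem iter_residualBody {s : State} (j : ℕ) (q : ℕ) :
    (iter (residualBody.den X) 13 s j).realArr 2 q =
      if q < j then s.realArr 0 q - s.realArr 2 q else s.realArr 2 q := by
  induction j with
  | zero => simp [iter]
  | succ j ih =>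
    have e0 : (iter (residualBody.den X) 13 s j).realArr 0 = s.realArr 0 :=
      iter_realArr X (by decide)
    have ei := iter_counter (residualBody.den X) 13 s j
    have ihj : q = j → (iter (residualBody.den X) 13 s j).realArr 2 j = s.realArr 2 j := by
      rintro rfl; simpa using ih
    rw [iter]
    generalize iter (residualBody.den X) 13 s j = u at *
    have hstep : (residualBody.den X u).realArr 2 =
        Function.update (u.realArr 2) j (s.realArr 0 j - u.realArr 2 j) := by
      simp [residualBody, instrs, den, Instr.run, ArithOp.eval, writeCell, ei, e0]
    dsimp only
    rw [hstep]
    rcases eq_or_ne q j with rfl | hne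
    · simp [ihj rfl]
    · rw [Function.update_of_ne hne, ih]
      simp only [show q < j + 1 ↔ q < j by omega]

/-- Add one entry of the gradient, if its index belongs to some support of the model. -/
def gradientBody : Code :=
  block [
    instrs [.loadNat 15 0 13, .setNat 5 1, .addNat 16 13 5, .subNat 16 1 16, .loadNat 16 0 16,
      .addNat 15 15 16],
    -- The tables at `q` and at the mirrored position `d - (q + 1)` both count the index itself,
    -- hence the strict inequality.
    .ite (.ltNat 2 15)
      (instrs [.loadReal 3 1 13, .loadReal 4 3 13, .arith .add 3 3 4])
      (instrs [.setReal 3 0]),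
    instrs [.storeReal 4 13 3, .arith .mul 3 3 3, .storeReal 5 13 3, .arith .add 10 10 3]]

/-- Entries outside all supports of the model are set to zero: the RIP does not control those
columns, and their gradient entries could make the total weight, and with it the initial bracket,
arbitrarily large. -/
theorem iter_gradientBody {s : State} {z : ℕ → ℝ} (hd : s.nat 1 = d) (hW : s.real 10 = 0)
    (hz : ∀ q < d, z q = if s.nat 2 < s.natArr 0 q + s.natArr 0 (d - (q + 1))
      then s.realArr 1 q + s.realArr 3 q else 0) (j : ℕ) (hj : j ≤ d) :
    (∀ q < j, (iter (gradientBody.den X) 13 s j).realArr 4 q = z q ∧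
      (iter (gradientBody.den X) 13 s j).realArr 5 q = z q ^ 2) ∧
      (iter (gradientBody.den X) 13 s j).real 10 = ∑ q ∈ Finset.range j, z q ^ 2 := by
  induction j with
  | zero => simp [iter, hW]
  | succ j ih =>
    have e1 : (iter (gradientBody.den X) 13 s j).nat 1 = d := by
      rw [iter_nat X (b := 1) (by decide), hd]
    have e2 : (iter (gradientBody.den X) 13 s j).nat 2 = s.nat 2 :=
      iter_nat X (b := 1) (by decide)
    have eL : (iter (gradientBody.den X) 13 s j).natArr 0 = s.natArr 0 := iter_natArr X (by decide)
    have ex : (iter (gradientBody.den X) 13 s j).realArr 1 = s.realArr 1 :=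
      iter_realArr X (by decide)
    have eg : (iter (gradientBody.den X) 13 s j).realArr 3 = s.realArr 3 :=
      iter_realArr X (by decide)
    have ei := iter_counter (gradientBody.den X) 13 s j
    obtain ⟨ih1, ih2⟩ := ih (by omega)
    have hzj := hz j (by omega)
    rw [iter]
    generalize iter (gradientBody.den X) 13 s j = u at *
    have hstep : (gradientBody.den X u).realArr 4 = Function.update (u.realArr 4) j (z j) ∧
        (gradientBody.den X u).realArr 5 = Function.update (u.realArr 5) j (z j ^ 2) ∧
        (gradientBody.den X u).real 10 = u.real 10 + z j ^ 2 := by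
      simp only [gradientBody, block, instrs, den, Instr.run, Test.holds, ArithOp.eval]
      by_cases c : s.nat 2 < s.natArr 0 j + s.natArr 0 (d - (j + 1))
      · simp [c, e1, e2, eL, ex, eg, ei, writeCell, hzj, sq]
      · simp [c, e1, e2, eL, ei, writeCell, hzj]
    obtain ⟨h4, h5, h10⟩ := hstep
    dsimp only
    rw [h4, h5, h10]
    refine ⟨fun q hq => ?_, by rw [Finset.sum_range_succ, ih2]⟩
    rcases eq_or_ne q j with rfl | hne
    · simp
    · rw [Function.update_of_ne hne, Function.update_of_ne hne]
      exact ih1 q (by omega)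

/-- One step of projected gradient descent. -/
def step : Code :=
  block [
    .basic (.mulX 2 1),
    .rep 13 0 residualBody,
    .basic (.mulXT 3 2),
    instrs [.setReal 10 0],
    .rep 13 1 gradientBody,
    project]

/-- The input, the parameters and the tables are in place. -/
structure Ready (k Δ N : ℕ) (y : EuclideanSpace ℝ (Fin n)) (d : ℕ) (s : State) : Prop where
  dim_n : s.nat 0 = n
  dim_d : s.nat 1 = d
  sparsity : s.nat 2 = k
  separation : s.nat 3 = max Δ 1
  rounds : s.nat 7 = N
  count : ∀ q < d, s.natArr 0 q = q / max Δ 1 + 1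
  obs : vec n (s.realArr 0) = y
  zero : ∀ q, d ≤ q → s.realArr 6 q = 0

open Classical in
-- The mask does not affect any sum over a support of the model (`hmask`), so optimality is stated
-- for the unmasked `z`; only the total weight in the error term is masked.
theorem den_step {s : State} {k Δ N : ℕ} {y : EuclideanSpace ℝ (Fin n)} (h : Ready k Δ N y d s)
    (hO : ∃ O, GapSeq (max Δ 1) d k O) {x z : EuclideanSpace ℝ (Fin d)}
    (hx : x = vec d (s.realArr 1)) (hz : z = x + mulVecE X.transpose (y - mulVecE X x)) :
    Ready k Δ N y d (step.den X s) ∧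
    ∃ Ω ∈ separatedSupports d k Δ,
      (∀ i, vec d ((step.den X s).realArr 1) i = if i ∈ Ω then z i else 0) ∧
      ∀ O ∈ separatedSupports d k Δ, ∑ i ∈ O, z i ^ 2 ≤ ∑ i ∈ Ω, z i ^ 2 +
        4 * (∑ i : Fin d, if k < (i : ℕ) / max Δ 1 + 1 + ((d - 1 - i) / max Δ 1 + 1)
          then z i ^ 2 else 0) / 2 ^ N * d := by
  obtain ⟨g0, g1, g2, g3, g7, gL, gy, gV⟩ := h
  set s₁ := (Code.basic (.mulX 2 1)).den X s with hs₁
  have a1 : vec n (s₁.realArr 2) = mulVecE X x := by rw [hs₁, den_mulX, hx]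
  have a2 : s₁.realArr 0 = s.realArr 0 := by rw [hs₁, den_realArr X (by decide)]
  set s₂ := iter (residualBody.den X) 13 s₁ n with hs₂
  have b1 : vec n (s₂.realArr 2) = y - mulVecE X x := by
    ext i
    have e1 : y i = s.realArr 0 i := by rw [← gy, vec_apply]
    have e2 : mulVecE X x i = s₁.realArr 2 i := by rw [← a1, vec_apply]
    rw [vec_apply, hs₂, iter_residualBody, if_pos i.2, a2, PiLp.sub_apply, e1, e2]
  set s₃ := (Code.basic (.mulXT 3 2)).den X s₂ with hs₃
  have c1 : vec d (s₃.realArr 3) = mulVecE X.transpose (y - mulVecE X x) := by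
    rw [hs₃, den_mulXT, b1]
  set s₄ := (instrs [.setReal 10 0]).den X s₃ with hs₄
  have d1 : s₄.realArr 3 = s₃.realArr 3 := by rw [hs₄, den_realArr X (by decide)]
  have d2 : s₄.realArr 1 = s.realArr 1 := by
    rw [hs₄, den_realArr X (by decide), hs₃, den_realArr X (by decide), hs₂,
      iter_realArr X (by decide), hs₁, den_realArr X (by decide)]
  have hn : ∀ r, r ∉ [5, 13] → s₄.nat r = s.nat r := fun r hr => by
    rw [hs₄, den_nat X (by simp [instrs, natWrites]), hs₃, den_nat X (by simp [natWrites]), hs₂,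
      iter_nat X (b := 1) (by simpa [natWrites, residualBody, instrs, and_comm] using hr), hs₁,
      den_nat X (by simp [natWrites])]
  have d3 : s₄.natArr 0 = s.natArr 0 := by
    rw [hs₄, den_natArr X (by decide), hs₃, den_natArr X (by decide), hs₂,
      iter_natArr X (by decide), hs₁, den_natArr X (by decide)]
  have d4 : s₄.real 10 = 0 := by simp [hs₄, instrs, den, Instr.run]
  have d5 : s₄.realArr 6 = s.realArr 6 := by
    rw [hs₄, den_realArr X (by decide), hs₃, den_realArr X (by decide), hs₂,
      iter_realArr X (by decide), hs₁, den_realArr X (by decide)]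
  let zm : ℕ → ℝ := fun q =>
    if k < q / max Δ 1 + 1 + ((d - 1 - q) / max Δ 1 + 1) then s.realArr 1 q + s₄.realArr 3 q else 0
  have hzm : ∀ i : Fin d, zm i =
      if k < (i : ℕ) / max Δ 1 + 1 + ((d - 1 - i) / max Δ 1 + 1) then z i else 0 := fun i => by
    simp only [zm]
    congr 1
    rw [hz, PiLp.add_apply, hx, ← hx, ← c1, vec_apply, d1, hx, vec_apply]
  have hgrad := iter_gradientBody X (s := s₄) (z := zm) (by rw [hn 1 (by decide), g1]) d4
    (fun q hq => by
      rw [d3, gL q hq, gL _ (by omega), hn 2 (by decide), g2, d2,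
        show d - (q + 1) = d - 1 - q by omega]) d le_rfl
  set s₅ := iter (gradientBody.den X) 13 s₄ d with hs₅
  obtain ⟨f1, f10⟩ := hgrad
  have p0 : s₅.nat 0 = n := by rw [hs₅, iter_nat X (b := 1) (by decide), hn 0 (by decide), g0]
  have p1 : s₅.nat 1 = d := by rw [hs₅, iter_nat X (b := 1) (by decide), hn 1 (by decide), g1]
  have p2 : s₅.nat 2 = k := by rw [hs₅, iter_nat X (b := 1) (by decide), hn 2 (by decide), g2]
  have p3 : s₅.nat 3 = max Δ 1 := by
    rw [hs₅, iter_nat X (b := 1) (by decide), hn 3 (by decide), g3]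
  have p7 : s₅.nat 7 = N := by rw [hs₅, iter_nat X (b := 1) (by decide), hn 7 (by decide), g7]
  have pV : s₅.realArr 6 = s.realArr 6 := by rw [hs₅, iter_realArr X (by decide), d5]
  have hW : s₅.real 10 = ∑ q ∈ Finset.range d, s₅.realArr 5 q := by
    rw [f10]
    exact Finset.sum_congr rfl fun q hq => ((f1 q (by simpa using hq)).2).symm
  obtain ⟨q1, A, hA, hA1, hA2⟩ := den_project X p1 p2 (by rw [p3]; exact le_max_right _ _)
    (by rw [pV]; exact gV) (fun q hq => by rw [(f1 q hq).2]; positivity) hW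
    (by rw [p3]; exact hO)
  rw [p3] at hA hA2
  have e : step.den X s = project.den X s₅ := by
    have e1 : (Code.rep 13 0 residualBody).den X s₁ = s₂ := by
      rw [den, hs₁, den_nat X (by decide), g0]
    have e2 : (Code.rep 13 1 gradientBody).den X s₄ = s₅ := by rw [den, hn 1 (by decide), g1]
    simp only [step, block]
    rw [den_seq, den_seq, den_seq, den_seq, den_seq, ← hs₁, e1, ← hs₃, ← hs₄, e2]
  have hmask : ∀ O ∈ separatedSupports d k Δ, ∀ i ∈ O, zm i = z i := fun O hO i hi => by
    rw [hzm, if_pos (lt_of_mem_separatedSupports hO hi)]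
  rw [e]
  refine ⟨⟨?_, ?_, ?_, ?_, ?_, ?_, ?_, q1⟩, _, hA.mem_separatedSupports, fun i => ?_,
    fun O hO' => ?_⟩
  · rw [den_nat X (by decide), p0]
  · rw [den_nat X (by decide), p1]
  · rw [den_nat X (by decide), p2]
  · rw [den_nat X (by decide), p3]
  · rw [den_nat X (by decide), p7]
  · rw [den_natArr X (by decide), hs₅, iter_natArr X (by decide), d3]
    exact gL
  · rw [den_realArr X (by decide), hs₅, iter_realArr X (by decide), hs₄, den_realArr X (by decide),
      hs₃, den_realArr X (by decide), hs₂, iter_realArr X (by decide), a2, gy]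
  · rw [vec_apply, hA1 i i.2]
    simp only [Finset.mem_filter, Finset.mem_univ, true_and]
    split_ifs with hi
    · rw [(f1 i i.2).1]
      exact hmask _ hA.mem_separatedSupports i (by simpa using hi)
    · rfl
  · obtain ⟨B, hB, -, hB2⟩ := exists_gapSeq hO'
    have h1 := hA2 B hB
    have r1 : ∑ j ∈ Finset.range k, s₅.realArr 5 (B j) = ∑ i ∈ O, z i ^ 2 := by
      rw [hB2 (s₅.realArr 5)]
      exact Finset.sum_congr rfl fun i hi => by rw [(f1 i i.2).2, hmask O hO' i hi]
    have r2 : ∑ j ∈ Finset.range k, s₅.realArr 5 (A j) =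
        ∑ i ∈ Finset.univ.filter (fun i : Fin d => ∃ j < k, A j = i), z i ^ 2 := by
      rw [← sum_filter_gapSeq hA (le_max_right _ _)]
      exact Finset.sum_congr rfl fun i hi => by
        rw [(f1 i i.2).2, hmask _ hA.mem_separatedSupports i hi]
    have r3 : s₅.real 10 = ∑ i : Fin d,
        if k < (i : ℕ) / max Δ 1 + 1 + ((d - 1 - i) / max Δ 1 + 1) then z i ^ 2 else 0 := by
      rw [f10, Finset.sum_range]
      exact Finset.sum_congr rfl fun i _ => by rw [hzm]; split_ifs <;> simp
    rwa [r1, r2, r3, p7] at h1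

/-! ### Rounding -/

/-- One bit of the rounding of a number. -/
def roundStep : Code :=
  block [
    instrs [.arith .add 5 14 15],
    .ite (.leReal 5 3) (instrs [.arith .add 14 14 15]) .skip,
    instrs [.setReal 4 2, .arith .div 15 15 4]]

/-- Binary search in `[-P, 3 P)`. With `h = 2 * P / 2 ^ j` the current step, the target lies in
`[real[14], real[14] + 2 h)`, and `real[14]` is a point of the grid `-P + 2 h ℤ`. The integer `m`
exists only in the proof, as a real cannot be converted into a natural number. -/
theorem iter_roundStep {s : State} {P : ℝ} (h14 : s.real 14 = -P) (h15 : s.real 15 = 2 * P)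
    (hl : -P ≤ s.real 3) (hu : s.real 3 < 3 * P) (j : ℕ) :
    let u := iter (roundStep.den X) 14 s j
    u.real 15 = 2 * P / 2 ^ j ∧ u.real 14 ≤ s.real 3 ∧ s.real 3 < u.real 14 + 2 * (2 * P / 2 ^ j) ∧
      ∃ m : ℤ, u.real 14 = -P + m * (2 * (2 * P / 2 ^ j)) := by
  induction j with
  | zero =>
    refine ⟨by simp [iter, h15], by simpa [iter, h14] using hl, ?_, 0, by simp [iter, h14]⟩
    simp only [iter, h14]
    linarith
  | succ j ih =>
    have e3 : (iter (roundStep.den X) 14 s j).real 3 = s.real 3 := iter_real X (by decide)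
    rw [iter]
    generalize iter (roundStep.den X) 14 s j = u at *
    obtain ⟨i1, i2, i3, m, i4⟩ := ih
    dsimp only
    have hstep : (roundStep.den X u).real 15 = 2 * P / 2 ^ (j + 1) ∧ (roundStep.den X u).real 14 =
        if u.real 14 + 2 * P / 2 ^ j ≤ s.real 3 then u.real 14 + 2 * P / 2 ^ j else u.real 14 := by
      simp only [roundStep, block, instrs, den, Instr.run, Test.holds, ArithOp.eval]
      by_cases c : u.real 14 + 2 * P / 2 ^ j ≤ s.real 3
      · simp [c, e3, i1, div_div, pow_succ]
      · simp [c, e3, i1, div_div, pow_succ]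
    have hh : 2 * (2 * P / 2 ^ (j + 1)) = 2 * P / 2 ^ j := by
      rw [pow_succ]; field_simp
    rw [hstep.1, hstep.2, hh]
    split_ifs with c
    · exact ⟨rfl, c, by linarith, 2 * m + 1, by rw [i4]; push_cast; ring⟩
    · exact ⟨rfl, i2, by linarith, 2 * m, by rw [i4]; push_cast; ring⟩

/-- Round one entry of `realArr[1]`. -/
def roundBody : Code :=
  block [
    instrs [.loadReal 3 1 13, .arith .add 3 3 13, .setReal 4 0, .arith .sub 14 4 12,
      .arith .add 15 12 12],
    .rep 14 9 roundStep,
    instrs [.storeReal 7 13 14]]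

/-- Half a unit is added first, so that rounding down becomes rounding to the nearest grid point.
After `2 γ + 2` bits the grid spacing is `2 * (2 * 2 ^ γ / 2 ^ (2 * γ + 2)) = 1 / 2 ^ γ`. -/
theorem den_roundBody {s : State} {γ q : ℕ} {θ : ℝ} (h9 : s.nat 9 = 2 * γ + 2)
    (h12 : s.real 12 = 2 ^ γ) (h13 : s.real 13 = 1 / (2 * 2 ^ γ)) (hq : s.nat 13 = q)
    (hθ : IsFixedPoint γ θ) (hx : |s.realArr 1 q - θ| < 1 / (2 * 2 ^ γ)) :
    (roundBody.den X s).realArr 7 q = θ := by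
  set s₁ := (instrs [.loadReal 3 1 13, .arith .add 3 3 13, .setReal 4 0, .arith .sub 14 4 12,
    .arith .add 15 12 12]).den X s with hs₁
  have r3 : s₁.real 3 = s.realArr 1 q + 1 / (2 * 2 ^ γ) := by
    simp [hs₁, instrs, den, Instr.run, ArithOp.eval, hq, h13]
  have r14 : s₁.real 14 = -2 ^ γ := by
    simp [hs₁, instrs, den, Instr.run, ArithOp.eval, h12]
  have r15 : s₁.real 15 = 2 * 2 ^ γ := by
    simp [hs₁, instrs, den, Instr.run, ArithOp.eval, h12]
    ring
  have n9 : s₁.nat 9 = 2 * γ + 2 := by rw [hs₁, den_nat X (by decide), h9]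
  have n13 : s₁.nat 13 = q := by rw [hs₁, den_nat X (by decide), hq]
  have hP : (1 : ℝ) ≤ 2 ^ γ := one_le_pow₀ (by norm_num)
  have hP0 : (0 : ℝ) < 2 ^ γ := by linarith
  have hh : (1 : ℝ) / (2 * 2 ^ γ) ≤ 1 / 2 := by
    rw [div_le_div_iff₀ (by positivity) (by norm_num)]; linarith
  obtain ⟨hθ1, t, ht⟩ := hθ
  obtain ⟨hx1, hx2⟩ := abs_lt.1 hx
  obtain ⟨hθ2, hθ3⟩ := abs_le.1 hθ1
  obtain ⟨-, k2, k3, m, k4⟩ := iter_roundStep X (s := s₁) r14 r15 (by rw [r3]; linarith)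
    (by rw [r3]; linarith) (2 * γ + 2)
  have e : (roundBody.den X s).realArr 7 q =
      (iter (roundStep.den X) 14 s₁ (2 * γ + 2)).real 14 := by
    have e1 : (Code.rep 14 9 roundStep).den X s₁ = iter (roundStep.den X) 14 s₁ (2 * γ + 2) := by
      rw [den, n9]
    have e2 : (iter (roundStep.den X) 14 s₁ (2 * γ + 2)).nat 13 = q := by
      rw [iter_nat X (b := 9) (by decide), n13]
    simp only [roundBody, block]
    rw [den_seq, den_seq, ← hs₁, e1]
    simp [instrs, den, Instr.run, writeCell, e2]
  rw [e]
  set acc := (iter (roundStep.den X) 14 s₁ (2 * γ + 2)).real 14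
  have hst : 2 * (2 * 2 ^ γ / 2 ^ (2 * γ + 2)) = (1 : ℝ) / 2 ^ γ := by
    rw [show 2 * γ + 2 = γ + γ + 2 by ring, pow_add, pow_add]
    field_simp
  have hhalf : (1 : ℝ) / (2 * 2 ^ γ) = 1 / 2 ^ γ / 2 := by rw [div_div, mul_comm]
  rw [hst] at k3 k4
  rw [r3, hhalf] at k2 k3
  rw [hhalf] at hx1 hx2
  -- After scaling by `2 ^ γ` the result and `θ` are integers at distance less than `1`, hence
  -- equal.
  have h5 : 2 ^ γ * acc = ((-(2 ^ γ * 2 ^ γ) + m : ℤ) : ℝ) := by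
    rw [k4]; push_cast; field_simp
  have h6 : (2 : ℝ) ^ γ * (1 / 2 ^ γ) = 1 := by field_simp
  have h7 : ((-(2 ^ γ * 2 ^ γ) + m : ℤ) : ℝ) - t < 1 := by
    rw [← h5, ← ht, ← mul_sub]
    calc (2 : ℝ) ^ γ * (acc - θ) < 2 ^ γ * (1 / 2 ^ γ) := by gcongr; linarith
      _ = 1 := h6
  have h8 : (t : ℝ) - ((-(2 ^ γ * 2 ^ γ) + m : ℤ) : ℝ) < 1 := by
    rw [← h5, ← ht, ← mul_sub]
    calc (2 : ℝ) ^ γ * (θ - acc) < 2 ^ γ * (1 / 2 ^ γ) := by gcongr; linarith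
      _ = 1 := h6
  have h9' : -(2 ^ γ * 2 ^ γ) + m = t := by
    have a1 : (-(2 ^ γ * 2 ^ γ) + m : ℤ) - t < 1 := by exact_mod_cast h7
    have a2 : t - (-(2 ^ γ * 2 ^ γ) + m : ℤ) < 1 := by exact_mod_cast h8
    omega
  rw [h9', ← ht] at h5
  exact mul_left_cancel₀ hP0.ne' h5

/-- Round `realArr[1]` to fixed-point numbers, and write the result to `realArr[7]`. -/
def round : Code :=
  block [
    instrs [.setReal 3 1, .arith .add 4 12 12, .arith .div 13 3 4],
    .rep 13 1 roundBody]

theorem den_round {s : State} {γ : ℕ} (hd : s.nat 1 = d) (h9 : s.nat 9 = 2 * γ + 2)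
    (h12 : s.real 12 = 2 ^ γ) {q : ℕ} (hq : q < d) {θ : ℝ}
    (hθ : IsFixedPoint γ θ) (hx : |s.realArr 1 q - θ| < 1 / (2 * 2 ^ γ)) :
    (round.den X s).realArr 7 q = θ := by
  set s₁ := (instrs [.setReal 3 1, .arith .add 4 12 12, .arith .div 13 3 4]).den X s with hs₁
  have e : round.den X s = iter (roundBody.den X) 13 s₁ d := by
    have e1 : s₁.nat 1 = d := by rw [hs₁, den_nat X (by decide), hd]
    simp only [round, block]
    rw [den_seq, ← hs₁, den, e1]
  rw [e]
  have r13 : s₁.real 13 = 1 / (2 * 2 ^ γ) := by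
    simp [hs₁, instrs, den, Instr.run, ArithOp.eval, h12]
    ring
  have key : ∀ j, q < j → (iter (roundBody.den X) 13 s₁ j).realArr 7 q = θ := by
    intro j
    induction j with
    | zero => simp
    | succ j ih =>
      intro hj
      have f9 : (iter (roundBody.den X) 13 s₁ j).nat 9 = 2 * γ + 2 := by
        rw [iter_nat X (b := 1) (by decide), hs₁, den_nat X (by decide), h9]
      have f12 : (iter (roundBody.den X) 13 s₁ j).real 12 = 2 ^ γ := by
        rw [iter_real X (by decide), hs₁, den_real X (by decide), h12]
      have f13 : (iter (roundBody.den X) 13 s₁ j).real 13 = 1 / (2 * 2 ^ γ) := by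
        rw [iter_real X (by decide), r13]
      have f1 : (iter (roundBody.den X) 13 s₁ j).realArr 1 = s.realArr 1 := by
        rw [iter_realArr X (by decide), hs₁, den_realArr X (by decide)]
      have fi := iter_counter (roundBody.den X) 13 s₁ j
      rw [iter]
      generalize iter (roundBody.den X) 13 s₁ j = u at *
      dsimp only
      rcases eq_or_ne q j with rfl | hne
      · exact den_roundBody X f9 f12 f13 fi hθ (by rw [f1]; exact hx)
      · rw [← ih (by omega)]
        set u₁ := (instrs [.loadReal 3 1 13, .arith .add 3 3 13, .setReal 4 0,
          .arith .sub 14 4 12, .arith .add 15 12 12]).den X u with hu₁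
        have g13 : ((Code.rep 14 9 roundStep).den X u₁).nat 13 = j := by
          rw [den_nat X (by decide), hu₁, den_nat X (by decide), fi]
        have g7 : ((Code.rep 14 9 roundStep).den X u₁).realArr 7 = u.realArr 7 := by
          rw [den_realArr X (by decide), hu₁, den_realArr X (by decide)]
        simp only [roundBody, block]
        rw [den_seq, den_seq, ← hu₁]
        generalize (Code.rep 14 9 roundStep).den X u₁ = v at *
        simp [instrs, den, Instr.run, writeCell, g13, g7, Function.update_of_ne hne]
  exact key d hq

/-! ### Selecting the better candidate -/

/-- Accumulate the squared norms of the residuals. -/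
def normBody : Code :=
  instrs [.loadReal 5 0 13, .loadReal 6 2 13, .arith .sub 6 5 6, .arith .mul 6 6 6,
    .arith .add 3 3 6, .loadReal 6 3 13, .arith .sub 6 5 6, .arith .mul 6 6 6, .arith .add 4 4 6]

theorem iter_normBody {s : State} (h3 : s.real 3 = 0) (h4 : s.real 4 = 0) (j : ℕ) :
    (iter (normBody.den X) 13 s j).real 3 =
      ∑ q ∈ Finset.range j, (s.realArr 0 q - s.realArr 2 q) ^ 2 ∧
    (iter (normBody.den X) 13 s j).real 4 =
      ∑ q ∈ Finset.range j, (s.realArr 0 q - s.realArr 3 q) ^ 2 := by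
  induction j with
  | zero => simp [iter, h3, h4]
  | succ j ih =>
    have e0 : (iter (normBody.den X) 13 s j).realArr 0 = s.realArr 0 := iter_realArr X (by decide)
    have e2 : (iter (normBody.den X) 13 s j).realArr 2 = s.realArr 2 := iter_realArr X (by decide)
    have e3 : (iter (normBody.den X) 13 s j).realArr 3 = s.realArr 3 := iter_realArr X (by decide)
    have ei := iter_counter (normBody.den X) 13 s j
    rw [iter]
    generalize iter (normBody.den X) 13 s j = u at *
    rw [Finset.sum_range_succ, Finset.sum_range_succ, ← ih.1, ← ih.2]
    simp [normBody, instrs, den, Instr.run, ArithOp.eval, e0, e2, e3, ei, sq]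

/-- Replace `realArr[1]` by `realArr[7]`. -/
def copyRounded : Code := .rep 13 1 (instrs [.loadReal 3 7 13, .storeReal 1 13 3])

theorem den_copyRounded {s : State} (hd : s.nat 1 = d) :
    vec d ((copyRounded.den X s).realArr 1) = vec d (s.realArr 7) := by
  rw [copyRounded, den, hd]
  set p := instrs [.loadReal 3 7 13, .storeReal 1 13 3] with hp
  have key : ∀ j, ∀ q < j, (iter (p.den X) 13 s j).realArr 1 q = s.realArr 7 q := by
    intro j
    induction j with
    | zero => simp
    | succ j ih =>
      intro q hq
      have e7 : (iter (p.den X) 13 s j).realArr 7 = s.realArr 7 := iter_realArr X (by decide)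
      have ei := iter_counter (p.den X) 13 s j
      rw [iter]
      generalize iter (p.den X) 13 s j = u at *
      simp only [hp, instrs, den, Instr.run]
      rcases eq_or_ne q j with rfl | hne
      · simp [writeCell, ei, e7]
      · simpa [writeCell, ei, Function.update_of_ne hne] using ih q (by omega)
  ext i
  exact key d i i.2

/-- Keep the one of `realArr[1]` and `realArr[7]` that has the smaller residual. -/
def select : Code :=
  block [
    .basic (.mulX 2 1),
    .basic (.mulX 3 7),
    instrs [.setReal 3 0, .setReal 4 0],
    .rep 13 0 normBody,
    .ite (.ltReal 4 3) copyRounded .skip]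

theorem den_select {s : State} {y : EuclideanSpace ℝ (Fin n)} (hn : s.nat 0 = n)
    (hd : s.nat 1 = d) (hy : vec n (s.realArr 0) = y) {u v o : EuclideanSpace ℝ (Fin d)}
    (hu : u = vec d (s.realArr 1)) (hv : v = vec d (s.realArr 7))
    (ho : o = vec d ((select.den X s).realArr 1)) :
    (o = u ∨ o = v) ∧ ‖y - mulVecE X o‖ ≤ ‖y - mulVecE X u‖ ∧
      ‖y - mulVecE X o‖ ≤ ‖y - mulVecE X v‖ := by
  set s₁ := (Code.basic (.mulX 2 1)).den X s with hs₁
  set s₂ := (Code.basic (.mulX 3 7)).den X s₁ with hs₂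
  set s₃ := (instrs [.setReal 3 0, .setReal 4 0]).den X s₂ with hs₃
  set s₄ := iter (normBody.den X) 13 s₃ n with hs₄
  have a2 : vec n (s₃.realArr 2) = mulVecE X u := by
    rw [hs₃, den_realArr X (by decide), hs₂, den_realArr X (by decide), hs₁, den_mulX, hu]
  have a3 : vec n (s₃.realArr 3) = mulVecE X v := by
    rw [hs₃, den_realArr X (by decide), hs₂, den_mulX, hs₁, den_realArr X (by decide), hv]
  have a0 : vec n (s₃.realArr 0) = y := by
    rw [hs₃, den_realArr X (by decide), hs₂, den_realArr X (by decide), hs₁,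
      den_realArr X (by decide), hy]
  obtain ⟨h3, h4⟩ := iter_normBody X (s := s₃) (by simp [hs₃, instrs, den, Instr.run])
    (by simp [hs₃, instrs, den, Instr.run]) n
  have hnorm : ∀ f g : ℕ → ℝ, ∑ q ∈ Finset.range n, (f q - g q) ^ 2 = ‖vec n f - vec n g‖ ^ 2 := by
    intro f g
    rw [EuclideanSpace.norm_sq_eq, Finset.sum_range]
    simp
  rw [hnorm, a0, a2, ← hs₄] at h3
  rw [hnorm, a0, a3, ← hs₄] at h4
  have b1 : s₄.realArr 1 = s.realArr 1 := by
    rw [hs₄, iter_realArr X (by decide), hs₃, den_realArr X (by decide), hs₂,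
      den_realArr X (by decide), hs₁, den_realArr X (by decide)]
  have b7 : s₄.realArr 7 = s.realArr 7 := by
    rw [hs₄, iter_realArr X (by decide), hs₃, den_realArr X (by decide), hs₂,
      den_realArr X (by decide), hs₁, den_realArr X (by decide)]
  have c0 : s₃.nat 0 = n := by
    rw [hs₃, den_nat X (by decide), hs₂, den_nat X (by decide), hs₁, den_nat X (by decide), hn]
  have c1 : s₄.nat 1 = d := by
    rw [hs₄, iter_nat X (b := 0) (by decide), hs₃, den_nat X (by decide), hs₂,
      den_nat X (by decide), hs₁, den_nat X (by decide), hd]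
  have e : select.den X s = (Code.ite (.ltReal 4 3) copyRounded .skip).den X s₄ := by
    have e1 : (Code.rep 13 0 normBody).den X s₃ = s₄ := by rw [den, c0]
    simp only [select, block]
    rw [den_seq, den_seq, den_seq, den_seq, ← hs₁, ← hs₂, ← hs₃, e1]
  rw [e, den] at ho
  simp only [Test.holds, h3, h4] at ho
  split_ifs at ho with c
  · rw [den_copyRounded X c1, b7, ← hv] at ho
    rw [ho]
    exact ⟨Or.inr rfl, (lt_of_pow_lt_pow_left₀ 2 (norm_nonneg _) c).le, le_rfl⟩
  · rw [den, b1, ← hu] at ho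
    rw [ho]
    exact ⟨Or.inl rfl, le_rfl, le_of_sq_le_sq (not_lt.1 c) (norm_nonneg _)⟩

/-! ### Initialisation -/

/-- Set the parameters. -/
def setup (a b : ℕ) : Code :=
  block [
    instrs [.setNat 5 1],
    .ite (.ltNat 3 5) (instrs [.setNat 3 1]) .skip,
    instrs [.addNat 6 4 5, .setNat 10 1, .setNat 16 a, .setNat 17 b, .addNat 9 6 6,
      .setReal 12 1]]

/-- Count the doublings needed to exceed `nat[13]`. -/
def logBody : Code :=
  .ite (.leNat 10 13) (instrs [.addNat 10 10 10, .setNat 5 1, .addNat 6 6 5]) .skip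

/-- After `j ≥ 1` passes `2 ^ l` is the least power of two that is at least `j`. One doubling per
pass suffices, since `1 ≤ 2 ^ l` and `j ≤ 2 ^ l` imply `j + 1 ≤ 2 ^ (l + 1)`. -/
theorem iter_logBody {s : State} {c : ℕ} (h6 : s.nat 6 = c) (h10 : s.nat 10 = 1) (j : ℕ) :
    ∃ l, (iter (logBody.den X) 13 s j).nat 6 = c + l ∧
      (iter (logBody.den X) 13 s j).nat 10 = 2 ^ l ∧ j ≤ 2 ^ l ∧ 2 ^ l ≤ max 1 (2 * (j - 1)) := by
  induction j with
  | zero => exact ⟨0, by simp [iter, h6], by simp [iter, h10], by simp, by simp⟩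
  | succ j ih =>
    obtain ⟨l, i1, i2, i3, i4⟩ := ih
    have hpos : 1 ≤ 2 ^ l := Nat.one_le_two_pow
    have ei := iter_counter (logBody.den X) 13 s j
    rw [iter]
    generalize iter (logBody.den X) 13 s j = u at *
    by_cases hc : 2 ^ l ≤ j
    · refine ⟨l + 1, ?_, ?_, by rw [pow_succ]; omega, by rw [pow_succ]; omega⟩
      · simp only [logBody, instrs, den, Instr.run, Test.holds, i2, ei]
        simp [hc, i1, add_assoc]
      · simp only [logBody, instrs, den, Instr.run, Test.holds, i2, ei]
        simp [hc, pow_succ]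
        ring
    · refine ⟨l, ?_, ?_, by omega, by omega⟩
      · simp only [logBody, instrs, den, Test.holds, i2, ei]
        simp [hc, i1]
      · simp only [logBody, instrs, den, Test.holds, i2, ei]
        simp [hc, i2]

/-- Compute the precision `nat[6]`. -/
def precision (a b : ℕ) : Code := block [setup a b, .rep 13 1 logBody]

/-- Compute the numbers of rounds, and tabulate what is needed later. -/
def tables : Code :=
  block [
    .rep 13 6 (instrs [.addNat 7 7 16, .addNat 8 8 17]),
    .rep 13 4 (instrs [.arith .add 12 12 12]),
    .rep 13 1 countBody]

/-- The numbers of rounds are constant multiples of `nat[6]`, formed by repeated addition. -/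
theorem iter_rounds {s : State} (h7 : s.nat 7 = 0) (h8 : s.nat 8 = 0) (j : ℕ) :
    (iter ((instrs [.addNat 7 7 16, .addNat 8 8 17]).den X) 13 s j).nat 7 = j * s.nat 16 ∧
    (iter ((instrs [.addNat 7 7 16, .addNat 8 8 17]).den X) 13 s j).nat 8 = j * s.nat 17 := by
  set p := instrs [.addNat 7 7 16, .addNat 8 8 17] with hp
  induction j with
  | zero => simp [iter, h7, h8]
  | succ j ih =>
    have e1 : (iter (p.den X) 13 s j).nat 16 = s.nat 16 := iter_nat X (b := 6) (by decide)
    have e2 : (iter (p.den X) 13 s j).nat 17 = s.nat 17 := iter_nat X (b := 6) (by decide)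
    rw [iter]
    generalize iter (p.den X) 13 s j = u at *
    simp [hp, instrs, den, Instr.run, e1, e2, ih, add_mul]

theorem iter_double {s : State} (h : s.real 12 = 1) (j : ℕ) :
    (iter ((instrs [.arith .add 12 12 12]).den X) 13 s j).real 12 = 2 ^ j := by
  induction j with
  | zero => simp [iter, h]
  | succ j ih =>
    rw [iter]
    simp [instrs, den, Instr.run, ArithOp.eval] at ih ⊢
    rw [ih, pow_succ]
    ring

theorem den_precision {k Δ γ a b : ℕ} {y : EuclideanSpace ℝ (Fin n)} :
    ∃ l, d ≤ 2 ^ l ∧ 2 ^ l ≤ max 1 (2 * (d - 1)) ∧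
      ((precision a b).den X (initState d k Δ γ y)).nat 6 = γ + 1 + l := by
  set s := (setup a b).den X (initState d k Δ γ y) with hs
  have e1 : s.nat 1 = d := by
    rw [hs, den_nat X (by simp [setup, block, instrs, natWrites])]
    rfl
  have e6 : s.nat 6 = γ + 1 := by
    simp only [hs, setup, block, instrs, den, Instr.run, Test.holds]
    by_cases c : Δ < 1 <;> simp [initState, c]
  have e10 : s.nat 10 = 1 := by
    simp only [hs, setup, block, instrs, den, Instr.run]
    simp
  obtain ⟨l, h1, -, h3, h4⟩ := iter_logBody X (s := s) e6 e10 d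
  refine ⟨l, h3, h4, ?_⟩
  simp only [precision, block]
  rw [den_seq, ← hs, den, e1, h1]

theorem den_tables {k Δ γ a b ℓ : ℕ} {y : EuclideanSpace ℝ (Fin n)} {s : State}
    (hs : s = (precision a b).den X (initState d k Δ γ y)) (hℓ : s.nat 6 = ℓ) :
    Ready k Δ (ℓ * a) y d (tables.den X s) ∧ (tables.den X s).nat 8 = ℓ * b ∧
      (tables.den X s).nat 9 = 2 * γ + 2 ∧ (tables.den X s).real 12 = 2 ^ γ ∧
      vec d ((tables.den X s).realArr 1) = 0 := by
  set s₀ := (setup a b).den X (initState d k Δ γ y) with hs₀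
  have es : s = (Code.rep 13 1 logBody).den X s₀ := by
    rw [hs, precision]
    simp only [block, den_seq, ← hs₀]
  have hi : ∀ r, r ∉ [3, 5, 6, 9, 10, 16, 17] → s₀.nat r = (initState d k Δ γ y).nat r :=
    fun r hr => by
      rw [hs₀, den_nat X (by
        simp only [setup, block, instrs, natWrites]
        simp at hr ⊢
        tauto)]
  have hi' : ∀ r, r ∉ [3, 5, 6, 9, 10, 13, 16, 17] → s.nat r = (initState d k Δ γ y).nat r :=
    fun r hr => by
      rw [es, den_nat X (by
        simp only [logBody, instrs, natWrites]
        simp at hr ⊢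
        tauto), hi r (by simp at hr ⊢; tauto)]
  have g3 : s.nat 3 = max Δ 1 := by
    rw [es, den_nat X (by decide)]
    simp only [hs₀, setup, block, instrs, den, Instr.run, Test.holds]
    by_cases c : Δ < 1
    · obtain rfl : Δ = 0 := by omega
      simp [initState]
    · simp [initState, c]; omega
  have g9 : s.nat 9 = 2 * γ + 2 := by
    rw [es, den_nat X (by decide)]
    simp only [hs₀, setup, block, instrs, den, Instr.run, Test.holds]
    by_cases c : Δ < 1
    · simp [initState, c]; ring
    · simp [initState, c]; ring
  have g16 : s.nat 16 = a := by
    rw [es, den_nat X (by decide)]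
    simp [hs₀, setup, block, instrs, den, Instr.run]
  have g17 : s.nat 17 = b := by
    rw [es, den_nat X (by decide)]
    simp [hs₀, setup, block, instrs, den, Instr.run]
  have g12 : s.real 12 = 1 := by
    rw [es, den_real X (by decide)]
    simp [hs₀, setup, block, instrs, den, Instr.run]
  have gr : s.realArr = (initState d k Δ γ y).realArr := by
    funext r
    rw [es, den_realArr X (by simp [logBody, instrs, realArrWrites]), hs₀,
      den_realArr X (by simp [setup, block, instrs, realArrWrites])]
  set s₁ := iter ((instrs [.addNat 7 7 16, .addNat 8 8 17]).den X) 13 s ℓ with hs₁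
  obtain ⟨r7, r8⟩ := iter_rounds X (s := s) (by rw [hi' 7 (by decide)]; rfl)
    (by rw [hi' 8 (by decide)]; rfl) ℓ
  have f4 : s₁.nat 4 = γ := by
    rw [hs₁, iter_nat X (b := 6) (by decide), hi' 4 (by decide)]
    rfl
  set s₂ := iter ((instrs [.arith .add 12 12 12]).den X) 13 s₁ γ with hs₂
  have f1 : s₂.nat 1 = d := by
    rw [hs₂, iter_nat X (b := 4) (by decide), hs₁, iter_nat X (b := 6) (by decide),
      hi' 1 (by decide)]
    rfl
  have f12 := iter_double X (s := s₁) (by rw [hs₁, iter_real X (by decide), g12]) γ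
  have e : tables.den X s = iter (countBody.den X) 13 s₂ d := by
    have e1 : (Code.rep 13 6 (instrs [.addNat 7 7 16, .addNat 8 8 17])).den X s = s₁ := by
      rw [den, hℓ]
    have e2 : (Code.rep 13 4 (instrs [.arith .add 12 12 12])).den X s₁ = s₂ := by
      rw [den, f4]
    simp only [tables, block]
    rw [den_seq, den_seq, e1, e2, den, f1]
  have f3 : s₂.nat 3 = max Δ 1 := by
    rw [hs₂, iter_nat X (b := 4) (by decide), hs₁, iter_nat X (b := 6) (by decide), g3]
  have fr : ∀ r, (iter (countBody.den X) 13 s₂ d).realArr r = (initState d k Δ γ y).realArr r := by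
    intro r
    rw [iter_realArr X (by simp [countBody, block, instrs, realArrWrites]), hs₂,
      iter_realArr X (by simp [instrs, realArrWrites]), hs₁,
      iter_realArr X (by simp [instrs, realArrWrites]), gr]
  rw [e]
  refine ⟨⟨?_, ?_, ?_, ?_, ?_, ?_, ?_, ?_⟩, ?_, ?_, ?_, ?_⟩
  · rw [iter_nat X (b := 1) (by decide), hs₂, iter_nat X (b := 4) (by decide), hs₁,
      iter_nat X (b := 6) (by decide), hi' 0 (by decide)]
    rfl
  · rw [iter_nat X (b := 1) (by decide), f1]
  · rw [iter_nat X (b := 1) (by decide), hs₂, iter_nat X (b := 4) (by decide), hs₁,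
      iter_nat X (b := 6) (by decide), hi' 2 (by decide)]
    rfl
  · rw [iter_nat X (b := 1) (by decide), f3]
  · rw [iter_nat X (b := 1) (by decide), hs₂, iter_nat X (b := 4) (by decide), hs₁, r7, g16]
  · exact iter_countBody X f3 (le_max_right _ _) d
  · rw [fr]
    ext i
    simp [initState, writeVec]
  · intro q _
    rw [fr]
    rfl
  · rw [iter_nat X (b := 1) (by decide), hs₂, iter_nat X (b := 4) (by decide), hs₁, r8, g17]
  · rw [iter_nat X (b := 1) (by decide), hs₂, iter_nat X (b := 4) (by decide), hs₁,
      iter_nat X (b := 6) (by decide), g9]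
  · rw [iter_real X (by decide), f12]
  · rw [fr]
    rfl

/-! ### Convergence of the iteration -/

/-- The splicing loss is at most `4 (d Z ^ 2) / 2 ^ (2 M) * d = (2 d / 2 ^ M * Z) ^ 2`, where `Z`
bounds the unmasked entries of `z`. The even number `2 M` of bisections makes this a square, as
`ModelRIP.step` requires. -/
theorem step_error {s : State} {k Δ M : ℕ} {δ : ℝ} {θ : EuclideanSpace ℝ (Fin d)}
    {e : EuclideanSpace ℝ (Fin n)} (hδ0 : 0 ≤ δ) (hδ : δ ≤ 3 / 4)
    (hX : ModelRIP (separatedSupports d k Δ) 3 δ X) (hθ : supp θ ∈ separatedSupports d k Δ)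
    (h : Ready k Δ (2 * M) (mulVecE X θ + e) d s)
    (hx : vec d (s.realArr 1) ∈ modelVectors (separatedSupports d k Δ)) :
    Ready k Δ (2 * M) (mulVecE X θ + e) d (step.den X s) ∧
    vec d ((step.den X s).realArr 1) ∈ modelVectors (separatedSupports d k Δ) ∧
    ‖vec d ((step.den X s).realArr 1) - θ‖ ≤ 2 * δ * ‖vec d (s.realArr 1) - θ‖ + 4 * ‖e‖ +
      2 * d / 2 ^ M * (‖θ‖ + 5 * ‖vec d (s.realArr 1) - θ‖ + 2 * ‖e‖) := by
  obtain ⟨O, hO, -, -⟩ := exists_gapSeq hθ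
  have hθM : θ ∈ modelVectors (separatedSupports d k Δ) := ⟨_, hθ, subset_rfl⟩
  obtain ⟨hR, Ω, hΩ, hout, hopt⟩ := den_step X h ⟨O, hO⟩ rfl rfl
  set x := vec d (s.realArr 1) with hxdef
  set x' := vec d ((step.den X s).realArr 1) with hx'def
  have hx' : x' ∈ modelVectors (separatedSupports d k Δ) :=
    ⟨Ω, hΩ, supp_subset_iff.2 fun i hi => by rw [hout i, if_neg hi]⟩
  refine ⟨hR, hx', ?_⟩
  set r := mulVecE X θ + e - mulVecE X x with hr
  set z := x + mulVecE X.transpose r with hz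
  have hb := norm_nonneg (x - θ)
  have he := norm_nonneg e
  -- For `k = 0` the mask admits indices that lie in no support, so the bound on the columns fails;
  -- but then both vectors are zero.
  rcases Nat.eq_zero_or_pos k with rfl | hk
  · have e1 : Ω = ∅ := Finset.card_eq_zero.1 hΩ.2
    have e2 : supp θ = ∅ := Finset.card_eq_zero.1 hθ.2
    have e3 : x' - θ = 0 := by
      ext i
      have := supp_subset_iff.1 e2.le i (by simp)
      simp [hout i, e1, this]
    rw [e3, norm_zero]
    positivity
  -- `|z i| ≤ ‖x‖ + 2 ‖r‖` with `‖x‖ ≤ ‖x - θ‖ + ‖θ‖` and `‖r‖ ≤ 2 ‖x - θ‖ + ‖e‖`.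
  set Z := ‖θ‖ + 5 * ‖x - θ‖ + 2 * ‖e‖ with hZ
  have hZ0 : 0 ≤ Z := by positivity
  have hW : (∑ i : Fin d, if k < (i : ℕ) / max Δ 1 + 1 + ((d - 1 - i) / max Δ 1 + 1)
      then z i ^ 2 else 0) ≤ d * Z ^ 2 := by
    have : ∀ i ∈ (Finset.univ : Finset (Fin d)),
        (if k < (i : ℕ) / max Δ 1 + 1 + ((d - 1 - i) / max Δ 1 + 1) then z i ^ 2 else 0) ≤
          Z ^ 2 := by
      intro i _
      split_ifs with hi
      · obtain ⟨Ω', hΩ', hi'⟩ := exists_mem_separatedSupports hk i hi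
        have h1 := hX.abs_transpose_le (by linarith) hΩ' hi' r
        have h2 : ‖r‖ ≤ 2 * ‖x - θ‖ + ‖e‖ := hX.norm_residual_le (by linarith) hx hθM
        have h3 : |x i| ≤ ‖x‖ := by simpa using PiLp.norm_apply_le x i
        have h4 : ‖x‖ ≤ ‖x - θ‖ + ‖θ‖ := by simpa using norm_add_le (x - θ) θ
        rw [← sq_abs]
        have h5 : |z i| ≤ Z := by
          rw [hz, PiLp.add_apply]
          refine (abs_add_le _ _).trans ?_
          rw [hZ]
          linarith
        gcongr
      · positivity
    refine (Finset.sum_le_sum this).trans ?_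
    simp
  refine hX.step hδ0 (by linarith) hx hx' hθM (by positivity) ?_
  refine norm_restrict_sub_sq_le hout subset_rfl ((hopt _ hθ).trans ?_)
  gcongr
  rw [pow_mul']
  calc _ ≤ 4 * (d * Z ^ 2) / (2 ^ M) ^ 2 * d := by gcongr
    _ = (2 * d / 2 ^ M * Z) ^ 2 := by ring

theorem iter_step {s : State} {k Δ M : ℕ} {δ : ℝ} {θ : EuclideanSpace ℝ (Fin d)}
    {e : EuclideanSpace ℝ (Fin n)} (hδ0 : 0 ≤ δ) (hδ : δ ≤ 3 / 4)
    (hX : ModelRIP (separatedSupports d k Δ) 3 δ X) (hθ : supp θ ∈ separatedSupports d k Δ)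
    (h : Ready k Δ (2 * M) (mulVecE X θ + e) d s)
    (hx : vec d (s.realArr 1) = 0) (j : ℕ) :
    Ready k Δ (2 * M) (mulVecE X θ + e) d (iter (step.den X) 11 s j) ∧
    vec d ((iter (step.den X) 11 s j).realArr 1) ∈ modelVectors (separatedSupports d k Δ) := by
  induction j with
  | zero =>
    refine ⟨⟨by simpa [iter] using h.dim_n, by simpa [iter] using h.dim_d,
      by simpa [iter] using h.sparsity, by simpa [iter] using h.separation,
      by simpa [iter] using h.rounds, h.count, h.obs, h.zero⟩, ⟨_, hθ, ?_⟩⟩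
    refine supp_subset_iff.2 fun i _ => ?_
    change vec d (s.realArr 1) i = 0
    rw [hx, PiLp.zero_apply]
  | succ j ih =>
    obtain ⟨h1, h2, -⟩ := step_error X hδ0 hδ hX hθ ih.1 ih.2
    rw [iter]
    generalize step.den X _ = u at *
    exact ⟨⟨by simpa using h1.dim_n, by simpa using h1.dim_d,
      by simpa using h1.sparsity, by simpa using h1.separation,
      by simpa using h1.rounds, h1.count, h1.obs, h1.zero⟩, h2⟩

end Code

/-! ### Numbers of gradient steps and bisections -/

/-- The projection error raises the contraction factor from `2 δ` to at most `2 δ + g = 1 / 2 + δ <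
1`, with `g = 1 / 2 - δ`. The decayed initial error and the accumulated projection error are each at
most `b 0 / 2 ^ (7 ℓ)`, and their sum is at most `b 0 / 2 ^ (6 ℓ)`. -/
theorem exists_rates {δ : ℝ} (hδ0 : 0 ≤ δ) (hδ : δ < 1 / 2) :
    ∃ (a J : ℕ) (C : ℝ), 0 ≤ C ∧ ∀ (ℓ d : ℕ) (b : ℕ → ℝ) (E : ℝ), 1 ≤ ℓ → d ≤ 2 ^ ℓ →
      (∀ t, 0 ≤ b t) → 0 ≤ E →
      (∀ t, b (t + 1) ≤ 2 * δ * b t + 4 * E + 2 * d / 2 ^ (ℓ * a) * (b 0 + 5 * b t + 2 * E)) →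
      b (ℓ * J) ≤ b 0 / 2 ^ (6 * ℓ) + C * E := by
  set g := 1 / 2 - δ with hg
  have hg0 : 0 < g := by linarith
  obtain ⟨a, ha⟩ := exists_pow_lt_of_lt_one hg0 (show (1 / 2 : ℝ) < 1 by norm_num)
  obtain ⟨J, hJ⟩ := exists_pow_lt_of_lt_one (show (0 : ℝ) < (1 / 2) ^ 7 by norm_num)
    (show 1 / 2 + δ < 1 by linarith)
  -- In the exponent `ℓ (9 + a)`, `2 ℓ` absorbs the factor `2 d ≤ 2 ^ ℓ * 2 ^ ℓ`, `7 ℓ` gives the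
  -- decay, and `ℓ a` the factor `g`.
  refine ⟨9 + a, J, 6 / g, by positivity, fun ℓ d b E hℓ hd hb hE h => ?_⟩
  set ε : ℝ := 2 * d / 2 ^ (ℓ * (9 + a)) with hε
  have hε0 : 0 ≤ ε := by positivity
  have hq : ((1 : ℝ) / 2) ^ (7 * ℓ) ≤ 1 / 128 := by
    calc ((1 : ℝ) / 2) ^ (7 * ℓ) ≤ (1 / 2) ^ 7 :=
          pow_le_pow_of_le_one (by norm_num) (by norm_num) (by omega)
      _ = 1 / 128 := by norm_num
  have hε1 : ε ≤ g * (1 / 2) ^ (7 * ℓ) := by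
    have h1 : (d : ℝ) ≤ 2 ^ ℓ := by exact_mod_cast hd
    have h2 : (2 : ℝ) ≤ 2 ^ ℓ := by
      calc (2 : ℝ) = 2 ^ 1 := by norm_num
        _ ≤ 2 ^ ℓ := pow_le_pow_right₀ (by norm_num) hℓ
    have h3 : ((1 : ℝ) / 2) ^ (ℓ * a) ≤ (1 / 2) ^ a :=
      pow_le_pow_of_le_one (by norm_num) (by norm_num) (by nlinarith)
    calc ε ≤ 2 ^ ℓ * 2 ^ ℓ / 2 ^ (ℓ * (9 + a)) := by rw [hε]; gcongr
      _ = (1 / 2) ^ (7 * ℓ) * (1 / 2) ^ (ℓ * a) := by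
        rw [div_pow, div_pow, one_pow, one_pow,
          show ℓ * (9 + a) = ℓ + ℓ + 7 * ℓ + ℓ * a by ring, pow_add, pow_add, pow_add]
        field_simp
      _ ≤ (1 / 2) ^ (7 * ℓ) * g := by gcongr; exact h3.trans ha.le
      _ = _ := mul_comm _ _
  have hε2 : 5 * ε ≤ g := by nlinarith
  have hg1 : g ≤ 1 / 2 := by linarith
  have key := le_of_affine_recursion (b := b) (ρ := 1 / 2 + δ) (c := 6 * E + ε * b 0)
    (by linarith) (by linarith) (by have := hb 0; positivity) (fun t => by
      have := h t
      have h1 := mul_le_mul_of_nonneg_right hε2 (hb t)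
      have h2 : ε * E ≤ 1 * E := mul_le_mul_of_nonneg_right (by linarith) hE
      rw [hg] at h1
      nlinarith) (ℓ * J)
  rw [show 1 - (1 / 2 + δ) = g by rw [hg]; ring] at key
  have h1 : (1 / 2 + δ) ^ (ℓ * J) ≤ (1 / 2 : ℝ) ^ (7 * ℓ) := by
    rw [mul_comm, pow_mul, pow_mul]
    exact pow_le_pow_left₀ (by positivity) hJ.le _
  have h2 : ε * b 0 / g ≤ (1 / 2) ^ (7 * ℓ) * b 0 := by
    rw [div_le_iff₀ hg0]
    have := mul_le_mul_of_nonneg_right hε1 (hb 0)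
    linarith
  have h3 : (2 : ℝ) * (1 / 2) ^ (7 * ℓ) ≤ 1 / 2 ^ (6 * ℓ) := by
    have h4 : ((1 : ℝ) / 2) ^ ℓ ≤ 1 / 2 := by
      calc ((1 : ℝ) / 2) ^ ℓ ≤ (1 / 2) ^ 1 :=
            pow_le_pow_of_le_one (by norm_num) (by norm_num) hℓ
        _ = 1 / 2 := by norm_num
    have h5 : (1 : ℝ) / 2 ^ (6 * ℓ) = (1 / 2) ^ (6 * ℓ) := by rw [div_pow, one_pow]
    rw [h5, show 7 * ℓ = 6 * ℓ + ℓ by ring, pow_add]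
    have h6 : (0 : ℝ) ≤ (1 / 2) ^ (6 * ℓ) := by positivity
    nlinarith
  have h4 := mul_le_mul_of_nonneg_right h1 (hb 0)
  have h5 := mul_le_mul_of_nonneg_right h3 (hb 0)
  calc b (ℓ * J) ≤ (1 / 2 + δ) ^ (ℓ * J) * b 0 + (6 * E + ε * b 0) / g := key
    _ = (1 / 2 + δ) ^ (ℓ * J) * b 0 + ε * b 0 / g + 6 / g * E := by ring
    _ ≤ 1 / 2 ^ (6 * ℓ) * b 0 + 6 / g * E := by linarith
    _ = b 0 / 2 ^ (6 * ℓ) + 6 / g * E := by ring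

/-! ### Error and running time of the whole program -/

namespace Code

variable {n d : ℕ} (X : Matrix (Fin n) (Fin d) ℝ)

/-- The iteration, followed by rounding and the selection of the better candidate. -/
def main : Code := block [.rep 11 8 step, round, select]

theorem isFixedPoint_zero (γ : ℕ) : IsFixedPoint γ 0 := ⟨by simp, 0, by simp⟩

/-- A vector of fixed-point numbers has bounded norm. -/
theorem norm_le_of_isFixedPoint {γ : ℕ} {θ : EuclideanSpace ℝ (Fin d)}
    (h : ∀ i, IsFixedPoint γ (θ i)) : ‖θ‖ ≤ d * 2 ^ γ := by
  refine abs_le_of_sq_le_sq' ?_ (by positivity) |>.2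
  rw [EuclideanSpace.norm_sq_eq]
  have : ∀ i ∈ (Finset.univ : Finset (Fin d)), ‖θ i‖ ^ 2 ≤ (2 ^ γ) ^ 2 := fun i _ => by
    have := (h i).1
    rw [Real.norm_eq_abs]
    gcongr
  refine (Finset.sum_le_sum this).trans ?_
  rw [Finset.sum_const, Finset.card_univ, Fintype.card_fin, nsmul_eq_mul, mul_pow]
  gcongr
  rcases Nat.eq_zero_or_pos d with rfl | hd
  · simp
  · have : (1 : ℝ) ≤ d := by exact_mod_cast hd
    nlinarith

theorem main_error {s : State} {k Δ M J γ l ℓ : ℕ} {δ C : ℝ} {θ : EuclideanSpace ℝ (Fin d)}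
    {e : EuclideanSpace ℝ (Fin n)} (hδ0 : 0 ≤ δ) (hδ : δ ≤ 3 / 4)
    (hX : ModelRIP (separatedSupports d k Δ) 3 δ X) (hθ : supp θ ∈ separatedSupports d k Δ)
    (h : Ready k Δ (2 * M) (mulVecE X θ + e) d s) (h8 : s.nat 8 = J) (h9 : s.nat 9 = 2 * γ + 2)
    (h12 : s.real 12 = 2 ^ γ) (hx : vec d (s.realArr 1) = 0) (hC : 0 ≤ C)
    (hℓ : ℓ = γ + 1 + l) (hd : d ≤ 2 ^ l)
    (hrate : ∀ b : ℕ → ℝ, (∀ t, 0 ≤ b t) →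
      (∀ t, b (t + 1) ≤ 2 * δ * b t + 4 * ‖e‖ + 2 * d / 2 ^ M * (b 0 + 5 * b t + 2 * ‖e‖)) →
      b J ≤ b 0 / 2 ^ (6 * ℓ) + C * ‖e‖)
    (hcase : ‖θ‖ ≤ 2 ^ γ * ‖e‖ ∨ ∀ i, IsFixedPoint γ (θ i)) :
    ‖vec d ((main.den X s).realArr 1) - θ‖ ≤ (8 + 8 * C) * ‖e‖ := by
  have hθM : θ ∈ modelVectors (separatedSupports d k Δ) := ⟨_, hθ, subset_rfl⟩
  have hall := iter_step X hδ0 hδ hX hθ h hx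
  have hb0 : vec d ((iter (step.den X) 11 s 0).realArr 1) = 0 := hx
  have herr := hrate (fun t => ‖vec d ((iter (step.den X) 11 s t).realArr 1) - θ‖)
    (fun t => norm_nonneg _) (fun t => by
      have := (step_error X hδ0 hδ hX hθ (hall t).1 (hall t).2).2.2
      rw [hb0, zero_sub, norm_neg]
      simp only [iter]
      exact this)
  simp only [hb0, zero_sub, norm_neg] at herr
  obtain ⟨hR, huM⟩ := hall J
  set s₁ := iter (step.den X) 11 s J with hs₁
  have f9 : s₁.nat 9 = 2 * γ + 2 := by rw [hs₁, iter_nat X (b := 8) (by decide), h9]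
  have f12 : s₁.real 12 = 2 ^ γ := by rw [hs₁, iter_real X (by decide), h12]
  set s₂ := round.den X s₁ with hs₂
  have g0 : s₂.nat 0 = n := by rw [hs₂, den_nat X (by decide), hR.dim_n]
  have g1 : s₂.nat 1 = d := by rw [hs₂, den_nat X (by decide), hR.dim_d]
  have gy : vec n (s₂.realArr 0) = mulVecE X θ + e := by
    rw [hs₂, den_realArr X (by decide), hR.obs]
  have gu : s₂.realArr 1 = s₁.realArr 1 := by rw [hs₂, den_realArr X (by decide)]
  have hround : ∀ (i : Fin d) (t : ℝ), IsFixedPoint γ t →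
      |vec d (s₁.realArr 1) i - t| < 1 / (2 * 2 ^ γ) → vec d (s₂.realArr 7) i = t :=
    fun i t ht hlt => den_round X hR.dim_d f9 f12 i.2 ht hlt
  set u := vec d (s₁.realArr 1) with hu
  set v := vec d (s₂.realArr 7) with hv
  -- Zero is a fixed-point number, so rounding keeps the zero entries of `u`. Hence `v` lies in the
  -- model even if `θ` is not fixed-point, and the RIP applies to it.
  have hvM : v ∈ modelVectors (separatedSupports d k Δ) := by
    obtain ⟨Ω, hΩ, hsub⟩ := huM
    refine ⟨Ω, hΩ, supp_subset_iff.2 fun i hi => hround i 0 (isFixedPoint_zero γ) ?_⟩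
    rw [supp_subset_iff.1 hsub i hi, sub_zero, abs_zero]
    positivity
  have e1 : main.den X s = select.den X s₂ := by
    have e1 : (Code.rep 11 8 step).den X s = s₁ := by rw [den, h8]
    simp only [main, block]
    rw [den_seq, den_seq, e1]
  rw [e1]
  obtain ⟨ho, ho1, ho2⟩ := den_select X (s := s₂) g0 g1 gy (u := u) (by rw [gu]) hv rfl
  set o := vec d ((select.den X s₂).realArr 1) with hodef
  have hoM : o ∈ modelVectors (separatedSupports d k Δ) := by
    rcases ho with ho | ho
    · rw [ho]; exact huM
    · rw [ho]; exact hvM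
  have he := norm_nonneg e
  have hCe : 0 ≤ C * ‖e‖ := by positivity
  have hγ : (0 : ℝ) < 2 ^ γ := by positivity
  have good : v = θ ∨ ‖u - θ‖ ≤ (1 + 2 * C) * ‖e‖ := by
    rcases hcase with hcase | hfix
    · right
      have : ‖θ‖ / 2 ^ (6 * ℓ) ≤ ‖e‖ := by
        rw [div_le_iff₀ (by positivity)]
        have h1 : (2 : ℝ) ^ γ ≤ 2 ^ (6 * ℓ) := pow_le_pow_right₀ (by norm_num) (by omega)
        nlinarith
      linarith
    -- The rounding radius `1 / (2 * 2 ^ γ)` is split evenly between the remaining initial error and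
    -- the noise term `C ‖e‖`. If the noise exceeds its half, it dominates the initial error as
    -- well.
    · have h1 : ‖θ‖ / 2 ^ (6 * ℓ) ≤ 1 / (4 * 2 ^ γ) := by
        have h2 := norm_le_of_isFixedPoint hfix
        have h3 : (d : ℝ) ≤ 2 ^ l := by exact_mod_cast hd
        have h4 : ‖θ‖ ≤ 2 ^ l * 2 ^ γ := h2.trans (by gcongr)
        rw [div_le_div_iff₀ (by positivity) (by positivity), one_mul]
        calc ‖θ‖ * (4 * 2 ^ γ) ≤ 2 ^ l * 2 ^ γ * (4 * 2 ^ γ) := by gcongr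
          _ = 2 ^ (l + γ + 2 + γ) := by ring
          _ ≤ 2 ^ (6 * ℓ) := pow_le_pow_right₀ (by norm_num) (by omega)
      have h2 : (1 : ℝ) / (2 * 2 ^ γ) = 1 / (4 * 2 ^ γ) + 1 / (4 * 2 ^ γ) := by
        field_simp; norm_num
      rcases lt_or_ge (C * ‖e‖) (1 / (4 * 2 ^ γ)) with hlt | hge
      · left
        ext i
        refine hround i _ (hfix i) (lt_of_le_of_lt ?_ (show ‖u - θ‖ < _ by rw [h2]; linarith))
        simpa using PiLp.norm_apply_le (u - θ) i
      · right
        linarith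
  rcases good with good | good
  · have h1 := hX.norm_sub_le_of_residual hδ hoM hθM hθM (by rw [good] at ho2; exact ho2)
    rw [sub_self, norm_zero] at h1
    linarith
  -- `4 (1 + 2 C) + 4 = 8 + 8 C`.
  · have h1 := hX.norm_sub_le_of_residual hδ hoM huM hθM ho1
    linarith

/-! ### Running time -/

theorem timeBound_bisectBody_le {T U : ℕ} {σ : ℕ → ℕ} (hd : σ 1 ≤ U) (hU : 1 ≤ U) :
    bisectBody.timeBound T σ ≤ 100 * U := by
  simp only [bisectBody, solve, valueTable, traceBack, traceBody, copyList, block, instrs,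
    timeBound, Instr.cost]
  norm_num
  omega

theorem timeBound_step_le {T U : ℕ} {σ : ℕ → ℕ} (hn : σ 0 ≤ U) (hd : σ 1 ≤ U) (hT : T ≤ U)
    (hU : 1 ≤ U) : step.timeBound T σ ≤ 400 * U * (σ 7 + 1) := by
  have h1 := timeBound_bisectBody_le (T := T) hd hU
  have h2 : σ 7 * (bisectBody.timeBound T σ + 3) ≤ σ 7 * (103 * U) :=
    Nat.mul_le_mul_left _ (by omega)
  simp only [step, project, bracketInit, solve, valueTable, traceBack, traceBody, copyList, block,
    instrs, residualBody, gradientBody, spliceBody, clear, selectBody, timeBound, Instr.cost]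
  generalize bisectBody.timeBound T σ = β at *
  have h3 : 400 * U * (σ 7 + 1) = 4 * (σ 7 * (100 * U)) + 400 * U := by ring
  have h4 : σ 7 * (103 * U) ≤ 4 * (σ 7 * (100 * U)) := by nlinarith
  norm_num
  omega

theorem timeBound_main_le {T U : ℕ} {σ : ℕ → ℕ} (hn : σ 0 ≤ U) (hd : σ 1 ≤ U) (hT : T ≤ U)
    (hU : 1 ≤ U) :
    main.timeBound T σ ≤ 500 * U * (σ 7 + 1) * (σ 8 + 1) + 50 * U * (σ 9 + 1) := by
  have h1 := timeBound_step_le hn hd hT hU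
  have h2 : σ 8 * (step.timeBound T σ + 3) ≤ σ 8 * (403 * U * (σ 7 + 1)) :=
    Nat.mul_le_mul_left _ (by nlinarith)
  have h3 : σ 1 * (5 + (σ 9 * 8 + 2 + 1) + 3) ≤ U * (8 * σ 9 + 11) :=
    Nat.mul_le_mul hd (by omega)
  simp only [main, round, roundBody, roundStep, select, normBody, copyRounded, block, instrs,
    timeBound, Instr.cost]
  generalize step.timeBound T σ = β at *
  have h4 : U * (8 * σ 9 + 11) = 8 * (U * σ 9) + 11 * U := by ring
  have h5 : 50 * U * (σ 9 + 1) = 50 * (U * σ 9) + 50 * U := by ring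
  have h6 : 500 * U * (σ 7 + 1) * (σ 8 + 1) =
      500 * (σ 8 * (U * (σ 7 + 1))) + 500 * (U * σ 7) + 500 * U := by ring
  have h7 : σ 8 * (403 * U * (σ 7 + 1)) = 403 * (σ 8 * (U * (σ 7 + 1))) := by ring
  norm_num at h3 ⊢
  omega

theorem guarded_precision (a b : ℕ) : (precision a b).Guarded [1] := by
  simp [precision, setup, logBody, block, instrs, Guarded, natWrites]

theorem total_time_le {U L ℓ γ : ℕ} (a b : ℕ) (hU : 1 ≤ U) (hL : 1 ≤ L) (hℓ : ℓ ≤ 2 * L)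
    (hγ : γ + 1 ≤ L) :
    20 * U + (50 * U + 20 * L + (500 * U * (ℓ * a + 1) * (ℓ * b + 1) +
      50 * U * (2 * γ + 2 + 1))) ≤ 3000 * (a + 1) * (b + 1) * U * L ^ 2 := by
  have c1 : ∀ c, ℓ * c + 1 ≤ 2 * (c + 1) * L := fun c => by
    calc ℓ * c + 1 ≤ 2 * L * c + 2 * L := add_le_add (Nat.mul_le_mul_right c hℓ) (by omega)
      _ = 2 * (c + 1) * L := by ring
  have c3 : 500 * U * (ℓ * a + 1) * (ℓ * b + 1) ≤ 2000 * ((a + 1) * (b + 1) * (U * L ^ 2)) := by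
    calc _ ≤ 500 * U * (2 * (a + 1) * L) * (2 * (b + 1) * L) :=
          Nat.mul_le_mul (Nat.mul_le_mul_left _ (c1 a)) (c1 b)
      _ = _ := by ring
  have c5 : U ≤ U * L ^ 2 := Nat.le_mul_of_pos_right _ (by positivity)
  have c6 : U * L ≤ U * L ^ 2 := Nat.mul_le_mul_left _ (Nat.le_self_pow (by norm_num) L)
  have c7 : L ≤ U * L ^ 2 := le_trans (Nat.le_mul_of_pos_left _ hU) c6
  have c8 : 50 * U * (2 * γ + 2 + 1) ≤ 150 * (U * L ^ 2) := by
    calc 50 * U * (2 * γ + 2 + 1) ≤ 50 * U * (3 * L) := Nat.mul_le_mul_left _ (by omega)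
      _ = 150 * (U * L) := by ring
      _ ≤ _ := Nat.mul_le_mul_left _ c6
  have c10 : U * L ^ 2 ≤ (a + 1) * (b + 1) * (U * L ^ 2) :=
    Nat.le_mul_of_pos_left _ (by positivity)
  calc _ ≤ 3000 * ((a + 1) * (b + 1) * (U * L ^ 2)) := by
        generalize U * L ^ 2 = Q at *
        generalize (a + 1) * (b + 1) * Q = R at *
        omega
    _ = _ := by ring

/-- Loop bounds must not be written while a time bound is in force, yet the program computes some of
its own. It is therefore cut into three stages, each bounded by registers that are final when it
starts: `d`; then `d, γ, ℓ`; then `n, d` and the numbers of rounds. -/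
theorem exec_main {a b k Δ γ T l : ℕ} {y : EuclideanSpace ℝ (Fin n)} {s₁ : State}
    (hs₁ : s₁ = (precision a b).den X (initState d k Δ γ y)) (hd : 1 ≤ d) (hT : n ≤ T)
    (h6 : s₁.nat 6 = γ + 1 + l) (hl : l ≤ Nat.log 2 d + 1) :
    ∃ t ≤ (3000 * (a + 1) * (b + 1)) * (T + d) * (Nat.log 2 d + γ + 1) ^ 2,
      Exec X T (.seq (precision a b).toProg (.seq tables.toProg main.toProg))
        (initState d k Δ γ y) (main.den X (tables.den X s₁)) t := by
  set L := Nat.log 2 d + γ + 1 with hL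
  set U := T + d with hU
  obtain ⟨t₁, ht₁, e₁⟩ := exec_toProg X (T := T) (s := initState d k Δ γ y)
    (guarded_precision a b) fun _ _ => rfl
  rw [← hs₁] at e₁
  have g1 : s₁.nat 1 = d := by
    rw [hs₁, den_nat X (Guarded.notMem_natWrites (by simp) (guarded_precision a b))]
    rfl
  have g4 : s₁.nat 4 = γ := by
    rw [hs₁, den_nat X (by simp [precision, setup, logBody, block, instrs, natWrites])]
    rfl
  obtain ⟨t₂, ht₂, e₂⟩ := exec_toProg X (T := T) (B := [1, 4, 6]) (σ := s₁.nat) (p := tables)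
    (s := s₁) (by decide) fun _ _ => rfl
  obtain ⟨hR, h8, h9, -, -⟩ := den_tables X hs₁ h6
  set s₂ := tables.den X s₁ with hs₂
  obtain ⟨t₃, ht₃, e₃⟩ := exec_toProg X (T := T) (B := [0, 1, 7, 8, 9]) (σ := s₂.nat) (p := main)
    (s := s₂) (by decide) fun _ _ => rfl
  refine ⟨t₁ + (t₂ + t₃), ?_, Exec.seq _ _ _ _ _ _ _ e₁ (Exec.seq _ _ _ _ _ _ _ e₂ e₃)⟩
  have b₃ := timeBound_main_le (T := T) (U := U) (σ := s₂.nat) (by rw [hR.dim_n]; omega)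
    (by rw [hR.dim_d]; omega) (by omega) (by omega)
  rw [hR.rounds, h8, h9] at b₃
  have b₁ : (precision a b).timeBound T (initState d k Δ γ y).nat ≤ 20 * U := by
    simp only [precision, setup, logBody, block, instrs, timeBound, Instr.cost,
      show (initState d k Δ γ y).nat 1 = d from rfl]
    norm_num
    omega
  have b₂ : tables.timeBound T s₁.nat ≤ 50 * U + 20 * L := by
    simp only [tables, countBody, block, instrs, timeBound, Instr.cost, g1, g4, h6]
    norm_num
    omega
  have := total_time_le (U := U) (L := L) (ℓ := γ + 1 + l) a b (by omega) (by omega) (by omega)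
    (show γ + 1 ≤ L by omega)
  omega

end Code

end SepSparse

theorem mainTheorem3 (δ : ℝ) (hδ : δ < 1 / 2) :
    ∃ (C : ℝ) (K p : ℕ) (alg : SepSparse.Prog),
      ∀ (n d k Δ γ T : ℕ) (X : Matrix (Fin n) (Fin d) ℝ)
        (y : EuclideanSpace ℝ (Fin n)) (θ : EuclideanSpace ℝ (Fin d))
        (e : EuclideanSpace ℝ (Fin n)),
        1 ≤ d →
        n ≤ T →
        SepSparse.ModelRIP (SepSparse.separatedSupports d k Δ) 3 δ X →
        SepSparse.supp θ ∈ SepSparse.separatedSupports d k Δ →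
        y = SepSparse.mulVecE X θ + e →
        (‖θ‖ ≤ 2 ^ γ * ‖e‖ ∨ ∀ i, SepSparse.IsFixedPoint γ (θ i)) →
        ∃ (s : SepSparse.State) (t : ℕ),
          SepSparse.Exec X T alg (SepSparse.initState d k Δ γ y) s t ∧
          ‖SepSparse.output d s - θ‖ ≤ C * ‖e‖ ∧
          t ≤ K * (T + d) * (Nat.log 2 d + γ + 1) ^ p := by
  -- `δ` may be negative; the RIP also holds for `max δ 0`, which is still less than `1 / 2`.
  obtain ⟨a, J, C, hC, hrate⟩ := SepSparse.exists_rates (δ := max δ 0) (le_max_right _ _)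
    (max_lt hδ (by norm_num))
  refine ⟨8 + 8 * C, 3000 * (2 * a + 1) * (J + 1), 2,
    .seq (SepSparse.Code.precision (2 * a) J).toProg
      (.seq SepSparse.Code.tables.toProg SepSparse.Code.main.toProg), ?_⟩
  intro n d k Δ γ T X y θ e hd hT hX hθ hy hcase
  obtain ⟨l, hl1, hl2, h6⟩ := SepSparse.Code.den_precision X (k := k) (Δ := Δ) (γ := γ)
    (a := 2 * a) (b := J) (y := y)
  have hl3 : l ≤ Nat.log 2 d + 1 := by
    rcases Nat.eq_zero_or_pos l with rfl | hpos
    · omega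
    obtain ⟨l, rfl⟩ : ∃ m, l = m + 1 := ⟨l - 1, by omega⟩
    -- Minimality of the power: half of it is below `d`, so the precision exceeds the logarithm by
    -- at most one.
    have h2 : 2 ^ l ≤ d := by
      rw [pow_succ] at hl2
      have := Nat.one_le_two_pow (n := l)
      omega
    have := Nat.le_log_of_pow_le (by norm_num) h2
    omega
  obtain ⟨t, ht, hex⟩ := SepSparse.Code.exec_main X rfl hd hT h6 hl3
  refine ⟨_, t, hex, ?_, ht⟩
  obtain ⟨hR, h8, h9, h12, hx⟩ := SepSparse.Code.den_tables X rfl h6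
  rw [show (γ + 1 + l) * (2 * a) = 2 * ((γ + 1 + l) * a) by ring, hy] at hR
  rw [hy] at h8 h9 h12 hx ⊢
  exact SepSparse.Code.main_error X (le_max_right _ _)
    (max_le (by linarith) (by norm_num)) (hX.mono (le_max_left _ _)) hθ hR h8 h9 h12 hx hC rfl hl1
    (fun b hb h => hrate _ d b ‖e‖ (by omega)
      (hl1.trans (Nat.pow_le_pow_right (by norm_num) (by omega))) hb (norm_nonneg _) h) hcase
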